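/- **Setting.** Let $n=1+n_2\ge 1$ and write points of $\mathbb R^n$ as $\xi=(x,x')\in\mathbb R\times\mathbb R^{n_2}$; also write $d\xi$ for Lebesgue measure. Let $\nabla=(X_1,\dots,X_\ell)$ be a finite family of vector fields on $\mathbb R^n$ with continuous, $W^{1,1}_{\mathrm{loc}}$ coefficients and vanishing divergence, and let $\Delta=\sum_i X_i^2$; derivatives along the $X_i$ are understood in the distributional sense. Let $d$ be a metric on $\mathbb R^n$ which induces the usual topology, has bounded balls, and is related to $\nabla$ as follows: every $d$-Lipschitz function $f$ has a weak subgradient $\nabla f$ and, for almost every $\xi$, $$|\nabla f(\xi)|=\limsup_{d(\xi,\eta)\to0^+}\frac{|f(\xi)-f(\eta)|}{d(\xi,\eta)} .$$ For a probability measure $\mu$ let $$I_\mu(t)=\inf\{\mu^+(A): A\text{ Borel},\ \mu(A)=t\},\qquad \mu^+(A)=\liminf_{\epsilon\to0^+}\frac{\mu(A_\epsilon)-\mu(A)}{\epsilon},\quad A_\epsilon=\{\eta: d(\eta,A)<\epsilon\},$$ and let $\mathcal U_r$ be the isoperimetric profile, defined in the same way with the Euclidean metric, of the probability measure $Z^{-1}e^{-|\xi|^r}d\xi$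 on $\mathbb R^n$. For functions, $f\lesssim g$ means $f\le Cg$ for some constant $C>0$, and $\gtrsim_\delta$ means that the constant may depend on $\delta$; no constant depends on the point $\xi$, on the function $f$ or on $t$. **Assumptions.** Let $\alpha>0$, $p\ge\alpha+1$, and let $N:\mathbb R^n\to\mathbb R$ be continuous with $\int e^{-N^p}d\xi<\infty$; put $d\mu=Z^{-1}e^{-N^p}d\xi$. Assume: 1. in the distributional sense on $\mathbb R^n\setminus\{0\}$, $$\frac{|x|^\alpha}{N^\alpha}\lesssim|\nabla N|\lesssim\frac{|x|^\alpha}{N^\alpha},\qquad \Delta N\lesssim\frac{|x|^{2\alpha}}{N^{2\alpha+1}},\qquad \nabla N\cdot\nabla|x|\lesssim\frac{|x|^{2\alpha+1}}{N^{2\alpha+1}};$$ 2. $|\nabla|x||\lesssim1$, $\Delta|x|=0$ in the distributional sense on $\{x\ne0\}$, and $X_jx=1$ for some $j$; 3. $|x|\lesssim N$ and $d(0,\cdot)\lesssim N\lesssim d(0,\cdot)$; 4. for some $Q>0$ and some $\tilde\beta_1$ with $\tilde\beta_1(\delta)\lesssim1+\delta^{-Q}$, all $\delta>0$ and all $f\in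 W^{1,2}(\mu)$, $$\int|f|\,d\xi\le\delta\int|\nabla f|\,d\xi+\tilde\beta_1(\delta)\Big(\int|f|^{1/2}d\xi\Big)^2;$$ 5. for each $R>0$, with $B_R=\{\xi:d(0,\xi)<R\}$, there is $C_R$ such that for all $f\in W^{1,2}(B_R)$ $$\int_{B_R}\Big|f-\frac1{|B_R|}\int_{B_R}f\,d\xi\Big|d\xi\le C_R\int_{B_R}|\nabla f|\,d\xi .$$ **Conclusion.** If $p=\alpha+1$, then $I_\mu\gtrsim\mathcal U_1$ on $[0,1]$. If $p>\alpha+1$, then for each $\delta\in(0,1]$ $$I_\mu\gtrsim_\delta\mathcal U_r\ \text{ on }[0,1],\qquad r=\frac{(\alpha+1-\delta)p}{\alpha+1-\delta+\alpha(p-\delta)}\in\Big[1,\frac{(\alpha+1)p}{\alpha+1+\alpha p}\Big).$$ -/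

import Mathlib

open MeasureTheory Filter Topology Set
open scoped ENNReal ContDiff

/-! ### Weak derivatives along vector fields on `ℝⁿ` -/

/-- `X φ`, the derivative of a (smooth) function `φ` along the vector field `X`. -/
noncomputable def fieldDeriv {n : ℕ} (X : EuclideanSpace ℝ (Fin n) → EuclideanSpace ℝ (Fin n))
    (φ : EuclideanSpace ℝ (Fin n) → ℝ) (ξ : EuclideanSpace ℝ (Fin n)) : ℝ :=
  fderiv ℝ φ ξ (X ξ)

/-- `φ ∈ C_c^∞(Ω)`. -/
structure IsTestFunction {n : ℕ} (Ω : Set (EuclideanSpace ℝ (Fin n)))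
    (φ : EuclideanSpace ℝ (Fin n) → ℝ) : Prop where
  contDiff : ContDiff ℝ ∞ φ
  hasCompactSupport : HasCompactSupport φ
  tsupport_subset : tsupport φ ⊆ Ω

/-- The divergence of `X` with respect to Lebesgue measure vanishes (in the weak sense). -/
def IsDivFree {n : ℕ} (X : EuclideanSpace ℝ (Fin n) → EuclideanSpace ℝ (Fin n)) : Prop :=
  ∀ φ : EuclideanSpace ℝ (Fin n) → ℝ, IsTestFunction univ φ → ∫ ξ, fieldDeriv X φ ξ = 0

/-- `g = X f` in the distributional sense on the open set `Ω`. It is used for divergence free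
`X` only, so that the formal adjoint of `X` is `-X`. -/
structure HasWeakFieldDeriv {n : ℕ}
    (X : EuclideanSpace ℝ (Fin n) → EuclideanSpace ℝ (Fin n))
    (Ω : Set (EuclideanSpace ℝ (Fin n))) (f g : EuclideanSpace ℝ (Fin n) → ℝ) : Prop where
  locallyIntegrableOn : LocallyIntegrableOn f Ω
  locallyIntegrableOn_deriv : LocallyIntegrableOn g Ω
  integral_eq : ∀ φ : EuclideanSpace ℝ (Fin n) → ℝ, IsTestFunction Ω φ →
    ∫ ξ, f ξ * fieldDeriv X φ ξ = -∫ ξ, g ξ * φ ξ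

/-- `G = ∇ f = (X₁ f, …, X_ℓ f)` in the distributional sense on the open set `Ω`. -/
def HasWeakGrad {n l : ℕ}
    (X : Fin l → EuclideanSpace ℝ (Fin n) → EuclideanSpace ℝ (Fin n))
    (Ω : Set (EuclideanSpace ℝ (Fin n))) (f : EuclideanSpace ℝ (Fin n) → ℝ)
    (G : EuclideanSpace ℝ (Fin n) → EuclideanSpace ℝ (Fin l)) : Prop :=
  ∀ i, HasWeakFieldDeriv (X i) Ω f (fun ξ => G ξ i)

/-- `f ∈ W^{1,2}(Ω, ν)`, with weak subgradient `G`. -/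
structure HasSobolevGrad {n l : ℕ}
    (X : Fin l → EuclideanSpace ℝ (Fin n) → EuclideanSpace ℝ (Fin n))
    (Ω : Set (EuclideanSpace ℝ (Fin n))) (ν : Measure (EuclideanSpace ℝ (Fin n)))
    (f : EuclideanSpace ℝ (Fin n) → ℝ)
    (G : EuclideanSpace ℝ (Fin n) → EuclideanSpace ℝ (Fin l)) : Prop where
  hasWeakGrad : HasWeakGrad X Ω f G
  memLp : MemLp f 2 (ν.restrict Ω)
  memLp_grad : MemLp G 2 (ν.restrict Ω)

/-- The vector fields of a subgradient: continuous, with coefficients in `W^{1,1}_loc`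
(for instance smooth), and divergence free. -/
structure IsSubgradient {n l : ℕ}
    (X : Fin l → EuclideanSpace ℝ (Fin n) → EuclideanSpace ℝ (Fin n)) : Prop where
  continuous : ∀ i, Continuous (X i)
  weakDeriv : ∀ i (j k : Fin n), ∃ g : EuclideanSpace ℝ (Fin n) → ℝ,
    HasWeakFieldDeriv (fun _ => EuclideanSpace.single k (1 : ℝ)) univ (fun ξ => X i ξ j) g
  divFree : ∀ i, IsDivFree (X i)

/-! ### The metric -/

/-- `d` is a metric on `ℝⁿ` which induces the usual topology and whose balls are bounded in the
usual sense (so that their closures are compact). -/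
structure IsProperMetric {n : ℕ}
    (d : EuclideanSpace ℝ (Fin n) → EuclideanSpace ℝ (Fin n) → ℝ) : Prop where
  eq_zero_iff : ∀ ξ η, d ξ η = 0 ↔ ξ = η
  symm : ∀ ξ η, d ξ η = d η ξ
  triangle : ∀ ξ η ζ, d ξ ζ ≤ d ξ η + d η ζ
  nhds_basis : ∀ ξ, (𝓝 ξ).HasBasis (fun r : ℝ => 0 < r) (fun r => {η | d ξ η < r})
  isBounded_ball : ∀ ξ, ∀ r : ℝ, Bornology.IsBounded {η | d ξ η < r}

/-- The local slope `limsup_{d(ξ, η) → 0⁺} |f ξ - f η| / d(ξ, η)`; it is used for functions that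
are Lipschitz with respect to `d`, and for `d` inducing the usual topology. -/
noncomputable def localSlope {n : ℕ}
    (d : EuclideanSpace ℝ (Fin n) → EuclideanSpace ℝ (Fin n) → ℝ)
    (f : EuclideanSpace ℝ (Fin n) → ℝ) (ξ : EuclideanSpace ℝ (Fin n)) : ℝ :=
  limsup (fun η => |f ξ - f η| / d ξ η) (𝓝[≠] ξ)

/-- `d` is related to the subgradient: each function that is Lipschitz with respect to `d` has a
weak subgradient, whose length is almost everywhere the local slope with respect to `d`. -/
def MetricRelatedTo {n l : ℕ}
    (d : EuclideanSpace ℝ (Fin n) → EuclideanSpace ℝ (Fin n) → ℝ)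
    (X : Fin l → EuclideanSpace ℝ (Fin n) → EuclideanSpace ℝ (Fin n)) : Prop :=
  ∀ f : EuclideanSpace ℝ (Fin n) → ℝ, (∃ K : ℝ, ∀ ξ η, |f ξ - f η| ≤ K * d ξ η) →
    ∃ G : EuclideanSpace ℝ (Fin n) → EuclideanSpace ℝ (Fin l),
      HasWeakGrad X univ f G ∧ ∀ᵐ ξ, ‖G ξ‖ = localSlope d f ξ

/-! ### Isoperimetric profiles -/

/-- `A_ε = {η | d(η, A) < ε}`. -/
def enlargement {n : ℕ} (d : EuclideanSpace ℝ (Fin n) → EuclideanSpace ℝ (Fin n) → ℝ)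
    (A : Set (EuclideanSpace ℝ (Fin n))) (ε : ℝ) : Set (EuclideanSpace ℝ (Fin n)) :=
  {η | ∃ a ∈ A, d η a < ε}

/-- The surface measure `μ⁺(A) = liminf_{ε → 0⁺} (μ(A_ε) - μ(A)) / ε`. -/
noncomputable def surfaceMeasure {n : ℕ}
    (d : EuclideanSpace ℝ (Fin n) → EuclideanSpace ℝ (Fin n) → ℝ)
    (μ : Measure (EuclideanSpace ℝ (Fin n))) (A : Set (EuclideanSpace ℝ (Fin n))) : ℝ≥0∞ :=
  liminf (fun ε : ℝ => (μ (enlargement d A ε) - μ A) / ENNReal.ofReal ε) (𝓝[>] 0)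

/-- The isoperimetric profile `I_μ(t) = inf {μ⁺(A) | A Borel, μ(A) = t}`. -/
noncomputable def isoProfile {n : ℕ}
    (d : EuclideanSpace ℝ (Fin n) → EuclideanSpace ℝ (Fin n) → ℝ)
    (μ : Measure (EuclideanSpace ℝ (Fin n))) (t : ℝ) : ℝ≥0∞ :=
  ⨅ (A : Set (EuclideanSpace ℝ (Fin n))) (_ : MeasurableSet A) (_ : μ A = ENNReal.ofReal t),
    surfaceMeasure d μ A

/-- The measure `dμ = Z⁻¹ e^{-N^p} dξ`. -/
noncomputable def powerMeasure {n : ℕ} (N : EuclideanSpace ℝ (Fin n) → ℝ) (p : ℝ) :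
    Measure (EuclideanSpace ℝ (Fin n)) :=
  (volume : Measure (EuclideanSpace ℝ (Fin n))).tilted (fun ξ => -(N ξ) ^ p)

/-- `𝒰_r`, the isoperimetric profile of `dν_r = Z⁻¹ e^{-|ξ|^r} dξ` on `ℝⁿ` with respect to the
Euclidean metric. -/
noncomputable def modelProfile (n : ℕ) (r : ℝ) (t : ℝ) : ℝ≥0∞ :=
  isoProfile (fun ξ η : EuclideanSpace ℝ (Fin n) => dist ξ η)
    (powerMeasure (fun ξ : EuclideanSpace ℝ (Fin n) => ‖ξ‖) r) t

/-- `I_μ ≳ 𝒰_r` on `[0, 1]`. -/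
def ProfileDominates {n : ℕ} (d : EuclideanSpace ℝ (Fin n) → EuclideanSpace ℝ (Fin n) → ℝ)
    (μ : Measure (EuclideanSpace ℝ (Fin n))) (r : ℝ) : Prop :=
  ∃ c : ℝ, 0 < c ∧ ∀ t ∈ Icc (0 : ℝ) 1, ENNReal.ofReal c * modelProfile n r t ≤ isoProfile d μ t

/-! ### The assumptions on `N` and on the first layer, for `n₁ = 1`

A point of `ℝⁿ = ℝ × ℝ^{n₂}`, with `n = n₂ + 1`, is written `ξ = (x, x')`, where `x = ξ 0`. -/

/-- The estimates `|x|^α / N^α ≲ |∇N| ≲ |x|^α / N^α`, `ΔN ≲ |x|^{2α} / N^{2α+1}` and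
`∇N · ∇|x| ≲ |x|^{2α+1} / N^{2α+1}`, in the distributional sense away from the origin
(where `N` vanishes). -/
def GaugeEstimates {m l : ℕ}
    (X : Fin l → EuclideanSpace ℝ (Fin (m + 1)) → EuclideanSpace ℝ (Fin (m + 1)))
    (N : EuclideanSpace ℝ (Fin (m + 1)) → ℝ) (α : ℝ) : Prop :=
  ∃ (GN Gx : EuclideanSpace ℝ (Fin (m + 1)) → EuclideanSpace ℝ (Fin l)) (C : ℝ), 0 < C ∧
    HasWeakGrad X {0}ᶜ N GN ∧ HasWeakGrad X {0}ᶜ (fun ξ => |ξ 0|) Gx ∧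
    (∀ᵐ ξ, |ξ 0| ^ α / N ξ ^ α ≤ C * ‖GN ξ‖) ∧
    (∀ᵐ ξ, ‖GN ξ‖ ≤ C * (|ξ 0| ^ α / N ξ ^ α)) ∧
    (∀ φ, IsTestFunction {0}ᶜ φ → (∀ ξ, 0 ≤ φ ξ) →
      -∫ ξ, ∑ i, GN ξ i * fieldDeriv (X i) φ ξ ≤
        C * ∫ ξ, |ξ 0| ^ (2 * α) / N ξ ^ (2 * α + 1) * φ ξ) ∧
    (∀ᵐ ξ, ∑ i, GN ξ i * Gx ξ i ≤ C * (|ξ 0| ^ (2 * α + 1) / N ξ ^ (2 * α + 1)))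

/-- The conditions `|∇|x|| ≲ 1`, `Δ|x| = (n₁ - 1) / |x| = 0` on `{x ≠ 0}`, and `∇ · x = n₁ = 1`,
in the distributional sense; in the last one `x` is the vector field whose only nonzero component,
of index `j`, is `x`, so that `∇ · x = X_j x`. -/
def LayerConditions {m l : ℕ}
    (X : Fin l → EuclideanSpace ℝ (Fin (m + 1)) → EuclideanSpace ℝ (Fin (m + 1))) : Prop :=
  (∃ (Gx : EuclideanSpace ℝ (Fin (m + 1)) → EuclideanSpace ℝ (Fin l)) (C : ℝ),
    HasWeakGrad X univ (fun ξ => |ξ 0|) Gx ∧ (∀ᵐ ξ, ‖Gx ξ‖ ≤ C) ∧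
    ∀ φ, IsTestFunction {ξ | ξ 0 ≠ 0} φ → ∫ ξ, ∑ i, Gx ξ i * fieldDeriv (X i) φ ξ = 0) ∧
  ∃ j, HasWeakFieldDeriv (X j) univ (fun ξ => ξ 0) (fun _ => 1)

/-- The comparison `|x| ≲ N` and `d ≲ N ≲ d`, where `d = d(0, ·)`. -/
def GaugeComparison {m : ℕ}
    (d : EuclideanSpace ℝ (Fin (m + 1)) → EuclideanSpace ℝ (Fin (m + 1)) → ℝ)
    (N : EuclideanSpace ℝ (Fin (m + 1)) → ℝ) : Prop :=
  ∃ C : ℝ, 0 < C ∧ ∀ ξ, |ξ 0| ≤ C * N ξ ∧ d 0 ξ ≤ C * N ξ ∧ N ξ ≤ C * d 0 ξ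

/-! ### The local functional inequalities -/

/-- The `1`-super-Poincaré inequality for Lebesgue measure with growth `≲ 1 + δ^{-Q}`, for
functions in `W^{1,2}(μ)`. -/
def LocalSuperPoincare {n l : ℕ}
    (X : Fin l → EuclideanSpace ℝ (Fin n) → EuclideanSpace ℝ (Fin n))
    (μ : Measure (EuclideanSpace ℝ (Fin n))) (Q : ℝ) : Prop :=
  ∃ (β : ℝ → ℝ) (C : ℝ), (∀ δ : ℝ, 0 < δ → β δ ≤ C * (1 + δ ^ (-Q))) ∧
    ∀ δ : ℝ, 0 < δ → ∀ (f : EuclideanSpace ℝ (Fin n) → ℝ)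
      (G : EuclideanSpace ℝ (Fin n) → EuclideanSpace ℝ (Fin l)), HasSobolevGrad X univ μ f G →
      ∫⁻ ξ, ‖f ξ‖ₑ ≤ ENNReal.ofReal δ * (∫⁻ ξ, ‖G ξ‖ₑ) +
        ENNReal.ofReal (β δ) * (∫⁻ ξ, ‖f ξ‖ₑ ^ (1 / 2 : ℝ)) ^ 2

/-- The local `1`-Poincaré inequality on each `d`-ball `B_R` centred at the origin, for functions
in `W^{1,2}(B_R)`; the constant may depend on `R`. -/
def LocalPoincare {n l : ℕ}
    (d : EuclideanSpace ℝ (Fin n) → EuclideanSpace ℝ (Fin n) → ℝ)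
    (X : Fin l → EuclideanSpace ℝ (Fin n) → EuclideanSpace ℝ (Fin n)) : Prop :=
  ∀ R : ℝ, 0 < R → ∃ C : ℝ, 0 < C ∧ ∀ (f : EuclideanSpace ℝ (Fin n) → ℝ)
    (G : EuclideanSpace ℝ (Fin n) → EuclideanSpace ℝ (Fin l)),
    HasSobolevGrad X {ξ | d 0 ξ < R} volume f G →
    ∫⁻ ξ in {ξ | d 0 ξ < R}, ‖f ξ - ⨍ η in {η | d 0 η < R}, f η‖ₑ ≤
      ENNReal.ofReal C * ∫⁻ ξ in {ξ | d 0 ξ < R}, ‖G ξ‖ₑ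

/-! The heart is a weighted L¹ estimate. Put κ = (p - 1 - α)/(α + 1), which is `gaugeExp α p`, so
that p = (α + 1)(κ + 1). The U-bound `IsGauge.exists_uBound` says ∫ f (1 + N^κ) dμ ≤ C ∫ |∇f| dμ + C
∫_{N ≤ R} f dμ for f ≥ 0. It comes from integrating by parts against two bounded fields. Along a
multiple of ∇N, differentiating e^{-N^p} produces p N^{p-1} |∇N|², which is large except near x = 0,
where ∇N degenerates. There X_j takes over: since X_j x = 1, the derivative of a bounded profile of
x N^κ along X_j is of order N^κ. In the variable y = |x| N^κ both gains, and all errors, are N^κ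
times functions of y, up to a factor N^{-p} that is small far out. `pointwise_bound` makes this
reduction and `exists_balance` chooses the constants.

The functions N, |x| and f have only weak derivatives, along fields with W^{1,1}_loc coefficients.
The Friedrichs lemma `tendsto_fieldDeriv_mollify` supplies the chain rule `HasLipDeriv.comp_pi` and
admits nonsmooth test functions in the Laplacian inequality (`laplacian_le_of_hasLipDeriv`).

If f vanishes on a set of μ-measure at least 1/4, the local Poincaré inequality absorbs the integral
over {N ≤ R} (`IsGauge.exists_cheeger`). Now let f resemble the indicator of a set of measure s.
Either a fixed share of ∫ f dμ sits where N^p ≳ log(1/s), and the weight N^κ yields the factor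
(log(1/s))^{κ/p}; or it sits where e^{-N^p} is at least a small power of s, and the super-Poincaré
inequality, with δ a power of s, yields even a power of 1/s. Hence s (1 - log s)^{κ/p} ≲ ∫ |∇f| dμ
(`IsGauge.exists_log_cheeger`).

Lipschitz approximations of indicators turn this into I_μ(t) ≳ s (1 - log s)^{κ/p} with s = min(t, 1
- t) (`le_isoProfile_of_functional`). Balls and their complements as competitors give 𝒰_r(t) ≲ s (1
- log s)^{1 - 1/r} (`exists_modelProfile_le`). So every r ≥ 1 with 1 - 1/r ≤ κ/p is admissible.
Equality holds at r = (α + 1)p/(α + 1 + αp), and the exponents of the theorem do not exceed it. -/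

/-! ### Mollification -/

/-- The Euclidean space `ℝⁿ`. -/
abbrev Rn (n : ℕ) := EuclideanSpace ℝ (Fin n)

/-- A bump function supported in the ball of radius `1 / (k + 1)`. -/
noncomputable def mollBump (n k : ℕ) : ContDiffBump (0 : Rn n) where
  rIn := (2 * (k + 1 : ℝ))⁻¹
  rOut := (k + 1 : ℝ)⁻¹
  rIn_pos := by positivity
  rIn_lt_rOut := by
    have : (0 : ℝ) < k + 1 := by positivity
    exact inv_strictAnti₀ this (by linarith)

/-- The standard mollifier at scale `1 / (k + 1)`. -/
noncomputable def mollKernel (n k : ℕ) : Rn n → ℝ := (mollBump n k).normed volume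

/-- Mollification at scale `1 / (k + 1)`. -/
noncomputable def mollify {n : ℕ} (k : ℕ) (u : Rn n → ℝ) (ξ : Rn n) : ℝ :=
  ∫ y, mollKernel n k (ξ - y) * u y

variable {n : ℕ}

lemma mollKernel_nonneg (k : ℕ) (z : Rn n) : 0 ≤ mollKernel n k z :=
  (mollBump n k).nonneg_normed z

lemma contDiff_mollKernel (n k : ℕ) : ContDiff ℝ ∞ (mollKernel n k) :=
  (mollBump n k).contDiff_normed

lemma tsupport_mollKernel (n k : ℕ) :
    tsupport (mollKernel n k) = Metric.closedBall 0 ((k + 1 : ℝ)⁻¹) :=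
  (mollBump n k).tsupport_normed_eq

lemma hasCompactSupport_mollKernel (n k : ℕ) : HasCompactSupport (mollKernel n k) :=
  (mollBump n k).hasCompactSupport_normed

lemma integral_mollKernel (n k : ℕ) : ∫ z, mollKernel n k z = 1 :=
  (mollBump n k).integral_normed

lemma mollKernel_eq_zero {k : ℕ} {z : Rn n} (hz : (k + 1 : ℝ)⁻¹ ≤ ‖z‖) :
    mollKernel n k z = 0 := by
  by_contra h
  have h1 : z ∈ Function.support (mollKernel n k) := h
  rw [mollKernel, (mollBump n k).support_normed_eq] at h1
  have h2 : ‖z‖ < (k + 1 : ℝ)⁻¹ := by simpa [mollBump] using h1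
  linarith

lemma fderiv_mollKernel_eq_zero {k : ℕ} {z : Rn n} (hz : (k + 1 : ℝ)⁻¹ < ‖z‖) :
    fderiv ℝ (mollKernel n k) z = 0 := by
  by_contra h
  have h1 := support_fderiv_subset ℝ (f := mollKernel n k) h
  rw [tsupport_mollKernel] at h1
  simp at h1
  linarith

lemma continuous_fderiv_mollKernel (n k : ℕ) : Continuous (fderiv ℝ (mollKernel n k)) :=
  (contDiff_mollKernel n k).continuous_fderiv (by simp)

lemma mollify_eq_convolution (k : ℕ) (u : Rn n → ℝ) :
    mollify k u = convolution (mollKernel n k) u (ContinuousLinearMap.lsmul ℝ ℝ) volume := by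
  ext ξ
  rw [convolution_lsmul_swap]
  rfl

lemma contDiff_mollify (k : ℕ) {u : Rn n → ℝ} (hu : LocallyIntegrable u) :
    ContDiff ℝ ∞ (mollify k u) := by
  rw [mollify_eq_convolution]
  exact (hasCompactSupport_mollKernel n k).contDiff_convolution_left _
    (contDiff_mollKernel n k) hu

lemma fderiv_mollify (k : ℕ) {u : Rn n → ℝ} (hu : LocallyIntegrable u) (ξ v : Rn n) :
    fderiv ℝ (mollify k u) ξ v = ∫ y, fderiv ℝ (mollKernel n k) (ξ - y) v * u y := by
  have h := (hasCompactSupport_mollKernel n k).hasFDerivAt_convolution_left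
    (ContinuousLinearMap.lsmul ℝ ℝ) ((contDiff_mollKernel n k).of_le (by simp)) hu ξ
  rw [mollify_eq_convolution, h.fderiv, convolution_eq_swap]
  have hint : Integrable fun t => ((ContinuousLinearMap.lsmul ℝ ℝ).precompL (Rn n)
      (fderiv ℝ (mollKernel n k) (ξ - t))) (u t) := by
    have := ((hasCompactSupport_mollKernel n k).fderiv ℝ).convolutionExists_left
      (L := (ContinuousLinearMap.lsmul ℝ ℝ).precompL (Rn n))
      (continuous_fderiv_mollKernel n k) hu ξ
    exact this.integrable_swap
  rw [ContinuousLinearMap.integral_apply hint]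
  rfl

lemma integrable_mollKernel_mul (k : ℕ) {u : Rn n → ℝ} (hu : LocallyIntegrable u) (ξ : Rn n) :
    Integrable fun y => mollKernel n k (ξ - y) * u y :=
  ((hasCompactSupport_mollKernel n k).convolutionExists_left (ContinuousLinearMap.lsmul ℝ ℝ)
    (contDiff_mollKernel n k).continuous hu ξ).integrable_swap

lemma integral_mollKernel_sub (k : ℕ) (ξ : Rn n) : ∫ y, mollKernel n k (ξ - y) = 1 := by
  rw [integral_sub_left_eq_self (mollKernel n k) volume ξ, integral_mollKernel]

lemma integral_fderiv_mollKernel (k : ℕ) (ξ v : Rn n) :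
    ∫ y, fderiv ℝ (mollKernel n k) (ξ - y) v = 0 := by
  have h := fderiv_mollify k (u := fun _ : Rn n => (1 : ℝ)) continuous_const.locallyIntegrable ξ v
  have h1 : mollify k (fun _ : Rn n => (1 : ℝ)) = fun _ => 1 := by
    ext ξ
    simp [mollify, integral_mollKernel_sub]
  rw [h1] at h
  simpa using h.symm

lemma mollify_nonneg (k : ℕ) {u : Rn n → ℝ} (hu : ∀ ξ, 0 ≤ u ξ) (ξ : Rn n) :
    0 ≤ mollify k u ξ :=
  integral_nonneg fun y => mul_nonneg (mollKernel_nonneg k _) (hu y)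

lemma mollify_eq_zero (k : ℕ) {u : Rn n → ℝ} {ξ : Rn n}
    (hu : ∀ y, dist y ξ < (k + 1 : ℝ)⁻¹ → u y = 0) : mollify k u ξ = 0 := by
  refine integral_eq_zero_of_ae (Eventually.of_forall fun y => ?_)
  by_cases hy : dist y ξ < (k + 1 : ℝ)⁻¹
  · simp [hu y hy]
  · rw [dist_comm, dist_eq_norm] at hy
    simp [mollKernel_eq_zero (not_lt.1 hy)]

lemma abs_mollify_le (k : ℕ) {g : Rn n → ℝ} {M : ℝ} {ξ : Rn n}
    (hg : ∀ᵐ y, dist y ξ ≤ (k + 1 : ℝ)⁻¹ → |g y| ≤ M) : |mollify k g ξ| ≤ M := by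
  have h1 : Integrable fun y => mollKernel n k (ξ - y) * M :=
    integrable_mollKernel_mul k continuous_const.locallyIntegrable ξ
  have h2 := norm_integral_le_of_norm_le (f := fun y => mollKernel n k (ξ - y) * g y) h1 (by
    filter_upwards [hg] with y hy
    by_cases hd : dist y ξ ≤ (k + 1 : ℝ)⁻¹
    · rw [Real.norm_eq_abs, abs_mul, abs_of_nonneg (mollKernel_nonneg k _)]
      exact mul_le_mul_of_nonneg_left (hy hd) (mollKernel_nonneg k _)
    · rw [dist_comm, dist_eq_norm] at hd
      simp [mollKernel_eq_zero (not_le.1 hd).le])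
  rw [integral_mul_const, integral_mollKernel_sub, one_mul] at h2
  exact h2

/-- Lebesgue differentiation. It applies because the ratio of outer to inner radius of the bumps is
2 at every scale. -/
lemma ae_tendsto_mollify {g : Rn n → ℝ} (hg : LocallyIntegrable g) :
    ∀ᵐ ξ, Tendsto (fun k => mollify k g ξ) atTop (𝓝 (g ξ)) := by
  have h := ContDiffBump.ae_convolution_tendsto_right_of_locallyIntegrable (μ := volume)
    (φ := fun k => mollBump n k) (l := atTop) (K := 2) (g := g) ?_ ?_ hg
  · simp only [mollify_eq_convolution]
    exact h
  · exact tendsto_inv_atTop_zero.comp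
      (tendsto_atTop_add_const_right _ _ tendsto_natCast_atTop_atTop)
  · refine Eventually.of_forall fun k => ?_
    simp only [mollBump]
    rw [mul_inv, ← mul_assoc]
    norm_num

lemma abs_mollify_sub_le (k : ℕ) {u : Rn n → ℝ} (hu : AEStronglyMeasurable u volume) {ξ : Rn n}
    {ε : ℝ} (h : ∀ y, dist y ξ < (k + 1 : ℝ)⁻¹ → |u y - u ξ| ≤ ε) : |mollify k u ξ - u ξ| ≤ ε := by
  rw [mollify_eq_convolution]
  exact (mollBump n k).dist_normed_convolution_le hu fun y hy => h y hy

/-- The modulus of continuity on a ball tends to zero. -/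
lemma eventually_osc_le {u : Rn n → ℝ} (hu : Continuous u) (R : ℝ) {ε : ℝ} (hε : 0 < ε) :
    ∀ᶠ k : ℕ in atTop, ∀ ξ ∈ Metric.closedBall (0 : Rn n) R, ∀ y, dist y ξ ≤ (k + 1 : ℝ)⁻¹ →
      |u y - u ξ| ≤ ε := by
  have hK := isCompact_closedBall (0 : Rn n) (R + 1)
  have huc := hK.uniformContinuousOn_of_continuous hu.continuousOn
  obtain ⟨δ, hδ, h⟩ := Metric.uniformContinuousOn_iff.1 huc ε hε
  have h0 : Tendsto (fun k : ℕ => (k + 1 : ℝ)⁻¹) atTop (𝓝 0) :=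
    tendsto_inv_atTop_zero.comp (tendsto_atTop_add_const_right _ _ tendsto_natCast_atTop_atTop)
  filter_upwards [h0.eventually_lt_const hδ, h0.eventually_lt_const one_pos] with k hk hk1 ξ hξ y hy
  have hξ' : ‖ξ‖ ≤ R := by simpa using hξ
  have hy' : ‖y - ξ‖ ≤ (k + 1 : ℝ)⁻¹ := by rwa [← dist_eq_norm]
  have hy1 : ‖y‖ ≤ R + 1 := by
    have := norm_add_le (y - ξ) ξ
    rw [sub_add_cancel] at this
    linarith
  exact (h y (by simpa using hy1) ξ (by simpa using hξ'.trans (by linarith))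
    (hy.trans_lt hk)).le

lemma eventually_abs_mollify_sub_le {u : Rn n → ℝ} (hu : Continuous u) (R : ℝ) {ε : ℝ}
    (hε : 0 < ε) : ∀ᶠ k : ℕ in atTop, ∀ ξ ∈ Metric.closedBall (0 : Rn n) R,
      |mollify k u ξ - u ξ| ≤ ε := by
  filter_upwards [eventually_osc_le hu R hε] with k hk ξ hξ
  exact abs_mollify_sub_le k hu.aestronglyMeasurable fun y hy => hk ξ hξ y hy.le

lemma tendsto_mollify {u : Rn n → ℝ} (hu : Continuous u) (ξ : Rn n) :
    Tendsto (fun k => mollify k u ξ) atTop (𝓝 (u ξ)) := by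
  rw [Metric.tendsto_nhds]
  intro ε hε
  filter_upwards [eventually_abs_mollify_sub_le hu ‖ξ‖ (half_pos hε)] with k hk
  rw [Real.dist_eq]
  exact (hk ξ (by simp)).trans_lt (half_lt_self hε)

/-- All bumps are dilations of a single one; this is what makes the L¹ norm of the gradient of the
mollifier computable. -/
lemma mollBump_apply (k : ℕ) (z : Rn n) : mollBump n k z = mollBump n 0 ((k + 1 : ℝ) • z) := by
  have h : (k + 1 : ℝ) ≠ 0 := by positivity
  rw [ContDiffBump.apply, ContDiffBump.apply]
  simp only [mollBump, sub_zero, smul_smul, Nat.cast_zero]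
  have h1 : (k + 1 : ℝ)⁻¹ / (2 * (k + 1 : ℝ))⁻¹ = (0 + 1 : ℝ)⁻¹ / (2 * (0 + 1 : ℝ))⁻¹ := by
    field_simp
  have h2 : ((2 * (k + 1 : ℝ))⁻¹)⁻¹ = ((2 * (0 + 1 : ℝ))⁻¹)⁻¹ * (k + 1 : ℝ) := by
    field_simp
    simp
  rw [h1, h2]

lemma mollKernel_apply (k : ℕ) (z : Rn n) :
    mollKernel n k z = (k + 1 : ℝ) ^ n * mollKernel n 0 ((k + 1 : ℝ) • z) := by
  have h : (0 : ℝ) < k + 1 := by positivity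
  have h1 : ∫ x, mollBump n k x = ((k + 1 : ℝ) ^ n)⁻¹ * ∫ x, mollBump n 0 x := by
    simp_rw [mollBump_apply k]
    rw [Measure.integral_comp_smul volume (fun x => mollBump n 0 x) (k + 1 : ℝ)]
    simp [abs_of_pos h]
  have h2 : (0 : ℝ) < ∫ x, mollBump n 0 x := ContDiffBump.integral_pos _
  rw [mollKernel, mollKernel, ContDiffBump.normed_def, ContDiffBump.normed_def, h1,
    mollBump_apply k]
  field_simp

/-- The `L¹` norm of the gradient of the mollifier. -/
noncomputable def mollConst (n : ℕ) : ℝ := ∫ z : Rn n, ‖fderiv ℝ (mollKernel n 0) z‖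

/-- A derivative of the mollifier costs exactly one inverse power of the scale. In the commutator
estimate this loss is repaid by the increments of the field. -/
lemma lintegral_fderiv_mollKernel (n k : ℕ) :
    ∫⁻ z : Rn n, ‖fderiv ℝ (mollKernel n k) z‖ₑ = ENNReal.ofReal ((k + 1) * mollConst n) := by
  have h : (0 : ℝ) < k + 1 := by positivity
  have h1 : ∀ z : Rn n, fderiv ℝ (mollKernel n k) z =
      ((k + 1 : ℝ) ^ n * (k + 1)) • fderiv ℝ (mollKernel n 0) ((k + 1 : ℝ) • z) := by
    intro z
    have : mollKernel n k = fun z => (k + 1 : ℝ) ^ n * mollKernel n 0 ((k + 1 : ℝ) • z) := by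
      ext z; exact mollKernel_apply k z
    rw [this]
    have hd : Differentiable ℝ (mollKernel n 0) := (contDiff_mollKernel n 0).differentiable (by simp)
    rw [fderiv_const_mul, fderiv_comp_smul, smul_smul]
    exact (hd _).comp z (by fun_prop)
  have hint : Integrable (fderiv ℝ (mollKernel n k)) :=
    (continuous_fderiv_mollKernel n k).integrable_of_hasCompactSupport
      ((hasCompactSupport_mollKernel n k).fderiv ℝ)
  rw [← ofReal_integral_norm_eq_lintegral_enorm hint]
  simp_rw [h1, norm_smul]
  rw [integral_const_mul, Measure.integral_comp_smul volume
    (fun z => ‖fderiv ℝ (mollKernel n 0) z‖) (k + 1 : ℝ)]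
  simp only [finrank_euclideanSpace, Fintype.card_fin, smul_eq_mul, mollConst]
  rw [Real.norm_eq_abs, abs_of_pos (by positivity), abs_of_pos (by positivity)]
  congr 1
  field_simp

lemma setLIntegral_sub_le (F : Rn n → ℝ≥0∞) (R : ℝ) {v : Rn n} (hv : ‖v‖ ≤ 1) :
    ∫⁻ ξ in Metric.closedBall 0 R, F (ξ - v) ≤ ∫⁻ ξ in Metric.closedBall 0 (R + 1), F ξ := by
  rw [← lintegral_indicator Metric.isClosed_closedBall.measurableSet,
    ← lintegral_indicator Metric.isClosed_closedBall.measurableSet,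
    ← lintegral_sub_right_eq_self ((Metric.closedBall (0 : Rn n) (R + 1)).indicator F) v]
  refine lintegral_mono fun ξ => ?_
  by_cases h : ξ ∈ Metric.closedBall (0 : Rn n) R
  · have h' : ξ - v ∈ Metric.closedBall (0 : Rn n) (R + 1) := by
      simp only [mem_closedBall_zero_iff] at h ⊢
      exact (norm_sub_le _ _).trans (add_le_add h hv)
    simp [indicator_of_mem h, indicator_of_mem h']
  · simp [indicator_of_notMem h]

/-- Young's inequality, localized: the kernels are supported in the unit ball, so enlarging the
radius by one is enough at every scale. -/
lemma setLIntegral_mollify_le (k : ℕ) {g : Rn n → ℝ} (hg : LocallyIntegrable g) (R : ℝ) :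
    ∫⁻ ξ in Metric.closedBall 0 R, ‖mollify k g ξ‖ₑ ≤
      ∫⁻ ξ in Metric.closedBall 0 (R + 1), ‖g ξ‖ₑ := by
  have hk : ((k : ℝ) + 1)⁻¹ ≤ 1 := inv_le_one_of_one_le₀ (by linarith [k.cast_nonneg (α := ℝ)])
  have hcont := (contDiff_mollKernel n k).continuous
  have hmeas : AEMeasurable (Function.uncurry fun ξ z : Rn n =>
      ‖mollKernel n k z‖ₑ * ‖g (ξ - z)‖ₑ)
      ((volume.restrict (Metric.closedBall (0 : Rn n) R)).prod volume) := by
    refine AEMeasurable.mul (M := ℝ≥0∞) ?_ ?_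
    · exact (hcont.comp continuous_snd).enorm.measurable.aemeasurable
    · have h1 : AEStronglyMeasurable (fun p : Rn n × Rn n => g (p.1 - p.2))
          ((volume : Measure (Rn n)).prod volume) :=
        hg.aestronglyMeasurable.comp_quasiMeasurePreserving
          (quasiMeasurePreserving_sub_of_right_invariant volume volume)
      refine (h1.mono_measure ?_).enorm
      exact Measure.prod_mono Measure.restrict_le_self le_rfl
  calc ∫⁻ ξ in Metric.closedBall 0 R, ‖mollify k g ξ‖ₑ
      ≤ ∫⁻ ξ in Metric.closedBall 0 R, ∫⁻ z, ‖mollKernel n k z‖ₑ * ‖g (ξ - z)‖ₑ := by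
        refine lintegral_mono fun ξ => ?_
        have h : mollify k g ξ = ∫ z, mollKernel n k z * g (ξ - z) := by
          rw [mollify_eq_convolution, convolution_lsmul]
          rfl
        rw [h]
        refine (enorm_integral_le_lintegral_enorm _).trans (lintegral_mono fun z => ?_)
        rw [enorm_mul]
    _ = ∫⁻ z, ∫⁻ ξ in Metric.closedBall 0 R, ‖mollKernel n k z‖ₑ * ‖g (ξ - z)‖ₑ :=
        lintegral_lintegral_swap hmeas
    _ ≤ ∫⁻ z, ‖mollKernel n k z‖ₑ * ∫⁻ ξ in Metric.closedBall 0 (R + 1), ‖g ξ‖ₑ := by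
        refine lintegral_mono fun z => ?_
        rw [lintegral_const_mul' _ _ enorm_ne_top]
        by_cases hz : ((k : ℝ) + 1)⁻¹ ≤ ‖z‖
        · simp [mollKernel_eq_zero hz]
        · exact mul_le_mul_right (setLIntegral_sub_le (fun ξ => ‖g ξ‖ₑ) R
            ((not_le.1 hz).le.trans hk)) _
    _ = ∫⁻ ξ in Metric.closedBall 0 (R + 1), ‖g ξ‖ₑ := by
        rw [lintegral_mul_const _ hcont.enorm.measurable]
        have : ∫⁻ z : Rn n, ‖mollKernel n k z‖ₑ = 1 := by
          rw [← ofReal_integral_norm_eq_lintegral_enorm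
            (hcont.integrable_of_hasCompactSupport (hasCompactSupport_mollKernel n k))]
          simp_rw [Real.norm_eq_abs, abs_of_nonneg (mollKernel_nonneg k _)]
          simp [integral_mollKernel]
        rw [this, one_mul]

/-! ### The Friedrichs lemma for divergence free fields with W^{1,1}_loc coefficients. -/

lemma isTestFunction_mollKernel (k : ℕ) (ξ : Rn n) :
    IsTestFunction univ fun y => mollKernel n k (ξ - y) where
  contDiff := (contDiff_mollKernel n k).comp (contDiff_const.sub contDiff_id)
  hasCompactSupport :=
    (hasCompactSupport_mollKernel n k).comp_homeomorph (Homeomorph.subLeft ξ)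
  tsupport_subset := subset_univ _

lemma fieldDeriv_mollKernel (X : Rn n → Rn n) (k : ℕ) (ξ y : Rn n) :
    fieldDeriv X (fun y => mollKernel n k (ξ - y)) y = -fderiv ℝ (mollKernel n k) (ξ - y) (X y) := by
  have hd : Differentiable ℝ (mollKernel n k) := (contDiff_mollKernel n k).differentiable (by simp)
  have h1 : HasFDerivAt (fun y : Rn n => ξ - y) (-ContinuousLinearMap.id ℝ (Rn n)) y := by
    exact (hasFDerivAt_id y).const_sub ξ
  have h2 := ((hd (ξ - y)).hasFDerivAt.comp y h1).fderiv
  rw [fieldDeriv]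
  change fderiv ℝ (mollKernel n k ∘ fun y => ξ - y) y (X y) = _
  rw [h2]
  simp

lemma HasWeakFieldDeriv.locallyIntegrable {X : Rn n → Rn n} {u g : Rn n → ℝ}
    (h : HasWeakFieldDeriv X univ u g) : LocallyIntegrable u :=
  locallyIntegrableOn_univ.1 h.locallyIntegrableOn

lemma HasWeakFieldDeriv.locallyIntegrable_deriv {X : Rn n → Rn n} {u g : Rn n → ℝ}
    (h : HasWeakFieldDeriv X univ u g) : LocallyIntegrable g :=
  locallyIntegrableOn_univ.1 h.locallyIntegrableOn_deriv

/-- The weak derivative is tested against y ↦ ρ(ξ - y). The minus sign from differentiating in y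
cancels the one in the definition of the weak derivative. -/
lemma HasWeakFieldDeriv.mollify_eq {X : Rn n → Rn n} {u g : Rn n → ℝ}
    (h : HasWeakFieldDeriv X univ u g) (k : ℕ) (ξ : Rn n) :
    mollify k g ξ = ∫ y, fderiv ℝ (mollKernel n k) (ξ - y) (X y) * u y := by
  have h1 := h.integral_eq _ (isTestFunction_mollKernel k ξ)
  simp_rw [fieldDeriv_mollKernel] at h1
  simp only [mul_neg, integral_neg, neg_inj] at h1
  rw [mollify]
  simp_rw [mul_comm _ (g _), mul_comm _ (u _)]
  exact h1.symm

lemma IsDivFree.integral_fderiv_mollKernel {X : Rn n → Rn n} (h : IsDivFree X) (k : ℕ) (ξ : Rn n) :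
    ∫ y, fderiv ℝ (mollKernel n k) (ξ - y) (X y) = 0 := by
  have h1 := h _ (isTestFunction_mollKernel k ξ)
  simp_rw [fieldDeriv_mollKernel, integral_neg, neg_eq_zero] at h1
  exact h1

lemma HasWeakFieldDeriv.fderiv_mollify_const {v : Rn n} {u g : Rn n → ℝ}
    (h : HasWeakFieldDeriv (fun _ => v) univ u g) (k : ℕ) (ξ : Rn n) :
    fderiv ℝ (mollify k u) ξ v = mollify k g ξ := by
  rw [h.mollify_eq, fderiv_mollify k h.locallyIntegrable]

lemma Rn.sum_single (z : Rn n) : ∑ j, z j • EuclideanSpace.single j (1 : ℝ) = z := by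
  simpa using (EuclideanSpace.basisFun (Fin n) ℝ).sum_repr z

lemma Rn.enorm_le_sum (z : Rn n) : ‖z‖ₑ ≤ ∑ j, ‖z j‖ₑ := by
  conv_lhs => rw [← Rn.sum_single z]
  refine (enorm_sum_le _ _).trans (Finset.sum_le_sum fun j _ => ?_)
  rw [enorm_smul]
  simp [enorm_eq_nnnorm]

lemma Rn.enorm_apply_le (z : Rn n) (j : Fin n) : ‖z j‖ₑ ≤ ‖z‖ₑ := by
  simp only [enorm_le_iff_norm_le]
  exact PiLp.norm_apply_le z j

/-- The increments of a `C¹` function are controlled in `L¹` by its gradient. -/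
lemma setLIntegral_increment_le_of_contDiff {b : Rn n → ℝ} (hb : ContDiff ℝ 1 b) (R : ℝ)
    {z : Rn n} (hz : ‖z‖ ≤ 1) :
    ∫⁻ ξ in Metric.closedBall 0 R, ‖b ξ - b (ξ - z)‖ₑ ≤
      ∫⁻ ξ in Metric.closedBall 0 (R + 1), ‖fderiv ℝ b ξ z‖ₑ := by
  have hd : Differentiable ℝ b := hb.differentiable one_ne_zero
  have hc : Continuous fun ξ => fderiv ℝ b ξ z :=
    (hb.continuous_fderiv one_ne_zero).clm_apply continuous_const
  have hc2 : Continuous fun p : Rn n × ℝ => fderiv ℝ b (p.1 - p.2 • z) z :=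
    hc.comp (by fun_prop)
  have key : ∀ ξ, ‖b ξ - b (ξ - z)‖ₑ ≤
      ∫⁻ t in Ioc (0 : ℝ) 1, ‖fderiv ℝ b (ξ - t • z) z‖ₑ := by
    intro ξ
    have h1 : ∀ t : ℝ, HasDerivAt (fun t : ℝ => b (ξ - t • z)) (-fderiv ℝ b (ξ - t • z) z) t := by
      intro t
      have h2 : HasDerivAt (fun t : ℝ => ξ - t • z) (-z) t := by
        simpa using! ((hasDerivAt_id t).smul_const z).const_sub ξ
      simpa using! (hd (ξ - t • z)).hasFDerivAt.comp_hasDerivAt t h2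
    have h3 : Continuous fun t : ℝ => -fderiv ℝ b (ξ - t • z) z :=
      (hc2.comp (Continuous.prodMk_right ξ)).neg
    have h4 := intervalIntegral.integral_eq_sub_of_hasDerivAt (a := 0) (b := 1)
      (fun t _ => h1 t) (h3.intervalIntegrable _ _)
    have h5 : b ξ - b (ξ - z) = ∫ t in Ioc (0 : ℝ) 1, fderiv ℝ b (ξ - t • z) z := by
      rw [intervalIntegral.integral_of_le zero_le_one, integral_neg] at h4
      simp only [one_smul, zero_smul, sub_zero] at h4
      linarith
    rw [h5]
    exact enorm_integral_le_lintegral_enorm _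
  calc ∫⁻ ξ in Metric.closedBall 0 R, ‖b ξ - b (ξ - z)‖ₑ
      ≤ ∫⁻ ξ in Metric.closedBall 0 R, ∫⁻ t in Ioc (0 : ℝ) 1, ‖fderiv ℝ b (ξ - t • z) z‖ₑ :=
        lintegral_mono key
    _ = ∫⁻ t in Ioc (0 : ℝ) 1, ∫⁻ ξ in Metric.closedBall 0 R, ‖fderiv ℝ b (ξ - t • z) z‖ₑ :=
        lintegral_lintegral_swap hc2.enorm.measurable.aemeasurable
    _ ≤ ∫⁻ t in Ioc (0 : ℝ) 1, ∫⁻ ξ in Metric.closedBall 0 (R + 1), ‖fderiv ℝ b ξ z‖ₑ := by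
        refine setLIntegral_mono' measurableSet_Ioc fun t ht => ?_
        refine setLIntegral_sub_le (fun ξ => ‖fderiv ℝ b ξ z‖ₑ) R ?_
        rw [norm_smul, Real.norm_eq_abs, abs_of_pos ht.1]
        exact mul_le_one₀ ht.2 (norm_nonneg _) hz
    _ = _ := by simp

/-- The increments of a continuous `W^{1,1}_loc` function are controlled in `L¹`. -/
lemma setLIntegral_increment_le {b : Rn n → ℝ} (hb : Continuous b) {g : Fin n → Rn n → ℝ}
    (hg : ∀ j, HasWeakFieldDeriv (fun _ => EuclideanSpace.single j (1 : ℝ)) univ b (g j)) (R : ℝ)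
    {z : Rn n} (hz : ‖z‖ ≤ 1) :
    ∫⁻ ξ in Metric.closedBall 0 R, ‖b ξ - b (ξ - z)‖ₑ ≤
      ‖z‖ₑ * ∑ j, ∫⁻ ξ in Metric.closedBall 0 (R + 2), ‖g j ξ‖ₑ := by
  have hsm : ∀ k, ContDiff ℝ ∞ (mollify k b) := fun k => contDiff_mollify k hb.locallyIntegrable
  have hk : ∀ k, ∫⁻ ξ in Metric.closedBall 0 R, ‖mollify k b ξ - mollify k b (ξ - z)‖ₑ ≤
      ‖z‖ₑ * ∑ j, ∫⁻ ξ in Metric.closedBall 0 (R + 2), ‖g j ξ‖ₑ := by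
    intro k
    refine (setLIntegral_increment_le_of_contDiff ((hsm k).of_le (by simp)) R hz).trans ?_
    calc ∫⁻ ξ in Metric.closedBall 0 (R + 1), ‖fderiv ℝ (mollify k b) ξ z‖ₑ
        ≤ ∫⁻ ξ in Metric.closedBall 0 (R + 1), ‖z‖ₑ * ∑ j, ‖mollify k (g j) ξ‖ₑ := by
          refine lintegral_mono fun ξ => ?_
          conv_lhs => rw [← Rn.sum_single z]
          rw [map_sum, Finset.mul_sum]
          refine (enorm_sum_le _ _).trans (Finset.sum_le_sum fun j _ => ?_)
          rw [map_smul, (hg j).fderiv_mollify_const k ξ, enorm_smul]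
          exact mul_le_mul_left (Rn.enorm_apply_le z j) _
      _ = ‖z‖ₑ * ∑ j, ∫⁻ ξ in Metric.closedBall 0 (R + 1), ‖mollify k (g j) ξ‖ₑ := by
          rw [lintegral_const_mul' _ _ enorm_ne_top, lintegral_finsetSum]
          intro j _
          exact (contDiff_mollify k (hg j).locallyIntegrable_deriv).continuous.enorm.measurable
      _ ≤ _ := by
          gcongr ‖z‖ₑ * ∑ j, ?_ with j
          refine (setLIntegral_mollify_le k (hg j).locallyIntegrable_deriv (R + 1)).trans ?_
          rw [add_assoc, one_add_one_eq_two]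
  -- The bound is uniform in the mollification scale, so Fatou's lemma carries it to the limit.
  have hlim : ∀ ξ, ‖b ξ - b (ξ - z)‖ₑ =
      liminf (fun k => ‖mollify k b ξ - mollify k b (ξ - z)‖ₑ) atTop := by
    intro ξ
    exact (((tendsto_mollify hb ξ).sub (tendsto_mollify hb (ξ - z))).enorm.liminf_eq).symm
  simp_rw [hlim]
  refine (lintegral_liminf_le fun k => ?_).trans ?_
  · have := (hsm k).continuous
    exact (this.sub (this.comp (by fun_prop))).enorm.measurable
  · exact liminf_le_of_frequently_le' (Eventually.of_forall hk).frequently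

/-- The increments of the field are linear in the shift, in L¹ on balls. This is where the
W^{1,1}_loc regularity of the coefficients enters. -/
lemma exists_setLIntegral_field_increment_le {X : Rn n → Rn n} (hX : Continuous X)
    (hW : ∀ j k : Fin n, ∃ g : Rn n → ℝ,
      HasWeakFieldDeriv (fun _ => EuclideanSpace.single k (1 : ℝ)) univ (fun ξ => X ξ j) g)
    (R : ℝ) : ∃ C : ℝ≥0∞, C < ⊤ ∧ ∀ z : Rn n, ‖z‖ ≤ 1 →
      ∫⁻ ξ in Metric.closedBall 0 R, ‖X ξ - X (ξ - z)‖ₑ ≤ C * ‖z‖ₑ := by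
  choose g hg using hW
  refine ⟨∑ j, ∑ k, ∫⁻ ξ in Metric.closedBall 0 (R + 2), ‖g j k ξ‖ₑ, ?_, fun z hz => ?_⟩
  · refine ENNReal.sum_lt_top.2 fun j _ => ENNReal.sum_lt_top.2 fun k _ => ?_
    exact ((hg j k).locallyIntegrable_deriv.integrableOn_isCompact (isCompact_closedBall _ _)).2
  · have hXj : ∀ j, Continuous fun ξ => X ξ j := fun j => by fun_prop
    calc ∫⁻ ξ in Metric.closedBall 0 R, ‖X ξ - X (ξ - z)‖ₑ
        ≤ ∫⁻ ξ in Metric.closedBall 0 R, ∑ j, ‖X ξ j - X (ξ - z) j‖ₑ :=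
          lintegral_mono fun ξ => Rn.enorm_le_sum (X ξ - X (ξ - z))
      _ = ∑ j, ∫⁻ ξ in Metric.closedBall 0 R, ‖X ξ j - X (ξ - z) j‖ₑ := by
          rw [lintegral_finsetSum]
          intro j _
          exact ((hXj j).sub ((hXj j).comp (by fun_prop))).enorm.measurable
      _ ≤ ∑ j, ‖z‖ₑ * ∑ k, ∫⁻ ξ in Metric.closedBall 0 (R + 2), ‖g j k ξ‖ₑ :=
          Finset.sum_le_sum fun j _ => setLIntegral_increment_le (hXj j) (hg j) R hz
      _ = _ := by rw [← Finset.mul_sum, mul_comm]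

/-- A single vector field of a subgradient: continuous, with coefficients in `W^{1,1}_loc`, and
divergence free. -/
structure IsRegularField (X : Rn n → Rn n) : Prop where
  continuous : Continuous X
  weakDeriv : ∀ j k : Fin n, ∃ g : Rn n → ℝ,
    HasWeakFieldDeriv (fun _ => EuclideanSpace.single k (1 : ℝ)) univ (fun ξ => X ξ j) g
  divFree : IsDivFree X

lemma IsSubgradient.isRegularField {l : ℕ} {X : Fin l → Rn n → Rn n} (h : IsSubgradient X)
    (i : Fin l) : IsRegularField (X i) :=
  ⟨h.continuous i, h.weakDeriv i, h.divFree i⟩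

lemma integrable_fderiv_mollKernel_mul (k : ℕ) (ξ : Rn n) {v : Rn n → Rn n} (hv : Continuous v)
    {w : Rn n → ℝ} (hw : Continuous w) :
    Integrable fun y => fderiv ℝ (mollKernel n k) (ξ - y) (v y) * w y := by
  refine Continuous.integrable_of_hasCompactSupport ?_ ?_
  · exact (((continuous_fderiv_mollKernel n k).comp (by fun_prop)).clm_apply hv).mul hw
  · have h : HasCompactSupport fun y => fderiv ℝ (mollKernel n k) (ξ - y) :=
      ((hasCompactSupport_mollKernel n k).fderiv ℝ).comp_homeomorph (Homeomorph.subLeft ξ)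
    refine h.mono fun y hy => ?_
    contrapose! hy
    simp only [Function.mem_support, ne_eq, not_not] at hy ⊢
    simp [hy]

/-- The commutator of mollification and differentiation along a divergence free field. -/
lemma fieldDeriv_mollify_sub {X : Rn n → Rn n} (hX : IsRegularField X) {u g : Rn n → ℝ}
    (hu : Continuous u) (h : HasWeakFieldDeriv X univ u g) (k : ℕ) (ξ : Rn n) :
    fieldDeriv X (mollify k u) ξ - mollify k g ξ =
      ∫ y, fderiv ℝ (mollKernel n k) (ξ - y) (X ξ - X y) * (u y - u ξ) := by
  have i1 := integrable_fderiv_mollKernel_mul k ξ (continuous_const (y := X ξ)) hu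
  have i2 := integrable_fderiv_mollKernel_mul k ξ hX.continuous hu
  have i3 := integrable_fderiv_mollKernel_mul k ξ (continuous_const (y := X ξ))
    (continuous_const (y := u ξ))
  have i4 := integrable_fderiv_mollKernel_mul k ξ hX.continuous (continuous_const (y := u ξ))
  -- Subtracting the constant u ξ is free: the term with X ξ integrates to zero because the kernel
  -- has constant total mass, the term with X y because the divergence vanishes. It brings in the
  -- oscillation of u.
  have e : ∀ y, fderiv ℝ (mollKernel n k) (ξ - y) (X ξ - X y) * (u y - u ξ) =
      (fderiv ℝ (mollKernel n k) (ξ - y) (X ξ) * u y -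
        fderiv ℝ (mollKernel n k) (ξ - y) (X y) * u y) -
      (fderiv ℝ (mollKernel n k) (ξ - y) (X ξ) * u ξ -
        fderiv ℝ (mollKernel n k) (ξ - y) (X y) * u ξ) := by
    intro y
    rw [map_sub]
    ring
  have j1 : Integrable fun y => fderiv ℝ (mollKernel n k) (ξ - y) (X ξ) * u y -
      fderiv ℝ (mollKernel n k) (ξ - y) (X y) * u y := i1.sub i2
  have j2 : Integrable fun y => fderiv ℝ (mollKernel n k) (ξ - y) (X ξ) * u ξ -
      fderiv ℝ (mollKernel n k) (ξ - y) (X y) * u ξ := i3.sub i4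
  simp_rw [e]
  rw [integral_sub j1 j2, integral_sub i1 i2, integral_sub i3 i4,
    integral_mul_const, integral_mul_const, integral_fderiv_mollKernel,
    hX.divFree.integral_fderiv_mollKernel, ← h.mollify_eq, fieldDeriv,
    fderiv_mollify k h.locallyIntegrable]
  ring

/-- Three factors compete: the oscillation of u at scale 1/(k+1), which is below ε; the L¹ norm of
the gradient of the mollifier, of order k+1; and the L¹ increments of X, of order 1/(k+1). The last
two cancel, so the commutator is as small as the oscillation. -/
lemma eventually_setLIntegral_commutator_le {X : Rn n → Rn n} (hX : IsRegularField X)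
    {u g : Rn n → ℝ} (hu : Continuous u) (h : HasWeakFieldDeriv X univ u g) (R : ℝ) :
    ∃ K : ℝ≥0∞, K < ⊤ ∧ ∀ ε : ℝ, 0 < ε → ∀ᶠ k in atTop,
      ∫⁻ ξ in Metric.closedBall 0 R, ‖fieldDeriv X (mollify k u) ξ - mollify k g ξ‖ₑ ≤
        ENNReal.ofReal ε * K := by
  obtain ⟨C, hC, hCle⟩ := exists_setLIntegral_field_increment_le hX.continuous hX.weakDeriv R
  refine ⟨ENNReal.ofReal (mollConst n) * C, ENNReal.mul_lt_top ENNReal.ofReal_lt_top hC,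
    fun ε hε => ?_⟩
  filter_upwards [eventually_osc_le hu R hε] with k hk
  have hk0 : (0 : ℝ) < k + 1 := by positivity
  have hk1 : ((k : ℝ) + 1)⁻¹ ≤ 1 := inv_le_one_of_one_le₀ (by linarith [k.cast_nonneg (α := ℝ)])
  have hDc := continuous_fderiv_mollKernel n k
  have key : ∀ ξ ∈ Metric.closedBall (0 : Rn n) R,
      ‖fieldDeriv X (mollify k u) ξ - mollify k g ξ‖ₑ ≤
        ENNReal.ofReal ε * ∫⁻ z, ‖fderiv ℝ (mollKernel n k) z‖ₑ * ‖X ξ - X (ξ - z)‖ₑ := by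
    intro ξ hξ
    rw [fieldDeriv_mollify_sub hX hu h, ← lintegral_const_mul' _ _ ENNReal.ofReal_ne_top]
    refine (enorm_integral_le_lintegral_enorm _).trans ?_
    rw [← lintegral_sub_left_eq_self _ ξ]
    refine lintegral_mono fun z => ?_
    rw [enorm_mul, sub_sub_cancel, mul_comm]
    by_cases hz : ((k : ℝ) + 1)⁻¹ < ‖z‖
    · simp [fderiv_mollKernel_eq_zero hz]
    · gcongr
      · have := hk ξ hξ (ξ - z) (by simpa [dist_eq_norm] using not_lt.1 hz)
        rw [Real.enorm_eq_ofReal_abs]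
        exact ENNReal.ofReal_le_ofReal this
      · exact ContinuousLinearMap.le_opENorm _ _
  have hcX : Continuous fun p : Rn n × Rn n => X p.1 - X (p.1 - p.2) :=
    (hX.continuous.comp continuous_fst).sub (hX.continuous.comp (by fun_prop))
  calc ∫⁻ ξ in Metric.closedBall 0 R, ‖fieldDeriv X (mollify k u) ξ - mollify k g ξ‖ₑ
      ≤ ∫⁻ ξ in Metric.closedBall 0 R, ENNReal.ofReal ε *
          ∫⁻ z, ‖fderiv ℝ (mollKernel n k) z‖ₑ * ‖X ξ - X (ξ - z)‖ₑ :=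
        setLIntegral_mono' Metric.isClosed_closedBall.measurableSet key
    _ = ENNReal.ofReal ε * ∫⁻ z, ∫⁻ ξ in Metric.closedBall 0 R,
          ‖fderiv ℝ (mollKernel n k) z‖ₑ * ‖X ξ - X (ξ - z)‖ₑ := by
        rw [lintegral_const_mul' _ _ ENNReal.ofReal_ne_top, lintegral_lintegral_swap]
        refine Measurable.aemeasurable ?_
        exact (hDc.comp continuous_snd).enorm.measurable.mul hcX.enorm.measurable
    _ ≤ ENNReal.ofReal ε * ∫⁻ z, ‖fderiv ℝ (mollKernel n k) z‖ₑ *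
          (C * ENNReal.ofReal ((k + 1 : ℝ)⁻¹)) := by
        gcongr with z
        rw [lintegral_const_mul' _ _ enorm_ne_top]
        by_cases hz : ((k : ℝ) + 1)⁻¹ < ‖z‖
        · have h0 : ‖fderiv ℝ (mollKernel n k) z‖ₑ = 0 := by
            rw [enorm_eq_nnnorm, fderiv_mollKernel_eq_zero hz, nnnorm_zero]
            rfl
          rw [h0, zero_mul, zero_mul]
        · gcongr
          refine (hCle z ((not_lt.1 hz).trans hk1)).trans ?_
          gcongr
          rw [← ofReal_norm]
          exact ENNReal.ofReal_le_ofReal (not_lt.1 hz)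
    _ = ENNReal.ofReal ε * (ENNReal.ofReal (mollConst n) * C) := by
        rw [lintegral_mul_const _ hDc.enorm.measurable, lintegral_fderiv_mollKernel,
          mul_comm C, ← mul_assoc (ENNReal.ofReal ((k + 1) * mollConst n)),
          ← ENNReal.ofReal_mul' (inv_nonneg.2 hk0.le)]
        congr 3
        rw [mul_right_comm, mul_inv_cancel₀ hk0.ne', one_mul]

/-- The Friedrichs lemma: mollification commutes asymptotically with the derivative along a
regular field. -/
theorem tendsto_fieldDeriv_mollify {X : Rn n → Rn n} (hX : IsRegularField X)
    {u g : Rn n → ℝ} (hu : Continuous u) (h : HasWeakFieldDeriv X univ u g) {R M : ℝ}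
    (hg : ∀ᵐ ξ, ‖ξ‖ ≤ R + 1 → |g ξ| ≤ M) :
    Tendsto (fun k => ∫⁻ ξ in Metric.closedBall 0 R, ‖fieldDeriv X (mollify k u) ξ - g ξ‖ₑ)
      atTop (𝓝 0) := by
  have h1 : Tendsto (fun k => ∫⁻ ξ in Metric.closedBall (0 : Rn n) R,
      ‖fieldDeriv X (mollify k u) ξ - mollify k g ξ‖ₑ) atTop (𝓝 0) := by
    obtain ⟨K, hK, hle⟩ := eventually_setLIntegral_commutator_le hX hu h R
    rw [ENNReal.tendsto_nhds_zero]
    intro ε hε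
    by_cases hε' : ε = ⊤
    · simp [hε']
    · have hpos : 0 < ε.toReal / (K.toReal + 1) :=
        div_pos (ENNReal.toReal_pos hε.ne' hε') (by positivity)
      filter_upwards [hle _ hpos] with k hk
      refine hk.trans ?_
      conv_lhs => rw [← ENNReal.ofReal_toReal hK.ne]
      rw [ENNReal.toReal_ofReal ENNReal.toReal_nonneg, ← ENNReal.ofReal_mul hpos.le]
      conv_rhs => rw [← ENNReal.ofReal_toReal hε']
      refine ENNReal.ofReal_le_ofReal ?_
      rw [div_mul_eq_mul_div, div_le_iff₀ (by positivity)]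
      nlinarith [ENNReal.toReal_nonneg (a := ε), ENNReal.toReal_nonneg (a := K)]
  have hgm := h.locallyIntegrable_deriv.aestronglyMeasurable
  have hmm : ∀ k, Continuous (mollify k g) := fun k =>
    (contDiff_mollify k h.locallyIntegrable_deriv).continuous
  -- The local bound on g passes to its mollifications, with the radius enlarged by one, and serves
  -- as the dominating function.
  have h2 : Tendsto (fun k => ∫⁻ ξ in Metric.closedBall (0 : Rn n) R,
      ‖mollify k g ξ - g ξ‖ₑ) atTop (𝓝 0) := by
    have := tendsto_lintegral_of_dominated_convergence' (μ := volume.restrict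
      (Metric.closedBall (0 : Rn n) R)) (F := fun k ξ => ‖mollify k g ξ - g ξ‖ₑ)
      (f := fun _ => 0) (fun _ => ENNReal.ofReal (M + M))
      (fun k => ((hmm k).aestronglyMeasurable.sub hgm.restrict).enorm) (fun k => ?_) ?_ ?_
    · simpa using this
    · refine (ae_restrict_iff' Metric.isClosed_closedBall.measurableSet).2 ?_
      filter_upwards [hg] with ξ hξ hξR
      have hξR' : ‖ξ‖ ≤ R := by simpa using hξR
      rw [Real.enorm_eq_ofReal_abs]
      refine ENNReal.ofReal_le_ofReal ((abs_sub _ _).trans ?_)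
      refine add_le_add (abs_mollify_le k ?_) (hξ (by linarith))
      filter_upwards [hg] with y hy hyd
      have hk1 : ((k : ℝ) + 1)⁻¹ ≤ 1 :=
        inv_le_one_of_one_le₀ (by linarith [k.cast_nonneg (α := ℝ)])
      refine hy ?_
      have := norm_add_le (y - ξ) ξ
      rw [sub_add_cancel, ← dist_eq_norm] at this
      linarith
    · rw [lintegral_const]
      refine ENNReal.mul_ne_top ENNReal.ofReal_ne_top ?_
      simpa using (measure_closedBall_lt_top (x := (0 : Rn n)) (r := R)).ne
    · refine ae_restrict_of_ae ?_
      filter_upwards [ae_tendsto_mollify h.locallyIntegrable_deriv] with ξ hξ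
      have := (hξ.sub_const (g ξ)).enorm
      simpa using this
  have h3 := h1.add h2
  rw [add_zero] at h3
  refine tendsto_of_tendsto_of_tendsto_of_le_of_le tendsto_const_nhds h3 (fun _ => zero_le) ?_
  intro k
  have hmeas : AEMeasurable (fun ξ => ‖mollify k g ξ - g ξ‖ₑ)
      (volume.restrict (Metric.closedBall (0 : Rn n) R)) :=
    ((hmm k).aestronglyMeasurable.sub hgm.restrict).enorm
  beta_reduce
  rw [← lintegral_add_right' _ hmeas]
  refine lintegral_mono fun ξ => ?_
  rw [← sub_add_sub_cancel]
  exact enorm_add_le _ _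

/-! ### Calculus of continuous functions with locally bounded weak derivatives. -/

/-- Local essential boundedness. -/
def IsLocBdd (g : Rn n → ℝ) : Prop := ∀ R : ℝ, ∃ M : ℝ, ∀ᵐ ξ, ‖ξ‖ ≤ R → |g ξ| ≤ M

lemma Continuous.isLocBdd {g : Rn n → ℝ} (hg : Continuous g) : IsLocBdd g := by
  intro R
  obtain ⟨M, hM⟩ := (isCompact_closedBall (0 : Rn n) R).exists_bound_of_continuousOn hg.continuousOn
  exact ⟨M, Eventually.of_forall fun ξ hξ => hM ξ (by simpa using hξ)⟩

lemma IsLocBdd.mul {f g : Rn n → ℝ} (hf : IsLocBdd f) (hg : IsLocBdd g) :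
    IsLocBdd fun ξ => f ξ * g ξ := by
  intro R
  obtain ⟨M, hM⟩ := hf R
  obtain ⟨M', hM'⟩ := hg R
  refine ⟨M * M', ?_⟩
  filter_upwards [hM, hM'] with ξ h1 h2 hR
  rw [abs_mul]
  exact mul_le_mul (h1 hR) (h2 hR) (abs_nonneg _) ((abs_nonneg _).trans (h1 hR))

lemma IsLocBdd.sum {ι : Type*} {s : Finset ι} {f : ι → Rn n → ℝ} (hf : ∀ i ∈ s, IsLocBdd (f i)) :
    IsLocBdd fun ξ => ∑ i ∈ s, f i ξ := by
  intro R
  choose! M hM using fun i hi => hf i hi R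
  refine ⟨∑ i ∈ s, M i, ?_⟩
  filter_upwards [(Finset.eventually_all s).2 hM] with ξ h1 hR
  exact (Finset.abs_sum_le_sum_abs _ _).trans (Finset.sum_le_sum fun i hi => h1 i hi hR)

lemma IsLocBdd.locallyIntegrable {g : Rn n → ℝ} (h : IsLocBdd g)
    (hm : AEStronglyMeasurable g volume) : LocallyIntegrable g := by
  rw [locallyIntegrable_iff]
  intro K hK
  obtain ⟨R, hR⟩ := hK.isBounded.subset_closedBall (0 : Rn n)
  obtain ⟨M, hM⟩ := h R
  refine Measure.integrableOn_of_bounded (M := M) hK.measure_lt_top.ne hm ?_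
  rw [ae_restrict_iff' hK.measurableSet]
  filter_upwards [hM] with ξ hξ hξK
  exact hξ (by simpa using hR hξK)

/-- `u` is continuous with the locally bounded weak derivative `g` along `X`. -/
structure HasLipDeriv (X : Rn n → Rn n) (u g : Rn n → ℝ) : Prop where
  continuous : Continuous u
  weak : HasWeakFieldDeriv X univ u g
  locBdd : IsLocBdd g

lemma HasLipDeriv.aestronglyMeasurable {X : Rn n → Rn n} {u g : Rn n → ℝ}
    (h : HasLipDeriv X u g) : AEStronglyMeasurable g volume :=
  h.weak.locallyIntegrable_deriv.aestronglyMeasurable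

lemma HasLipDeriv.tendsto_fieldDeriv_mollify {X : Rn n → Rn n} (hX : IsRegularField X)
    {u g : Rn n → ℝ} (h : HasLipDeriv X u g) (R : ℝ) :
    Tendsto (fun k => ∫⁻ ξ in Metric.closedBall 0 R, ‖fieldDeriv X (mollify k u) ξ - g ξ‖ₑ)
      atTop (𝓝 0) := by
  obtain ⟨M, hM⟩ := h.locBdd (R + 1)
  exact _root_.tendsto_fieldDeriv_mollify hX h.continuous h.weak hM

lemma continuous_fieldDeriv {X : Rn n → Rn n} (hX : Continuous X) {φ : Rn n → ℝ}
    (hφ : ContDiff ℝ ∞ φ) : Continuous (fieldDeriv X φ) :=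
  (hφ.continuous_fderiv (by simp)).clm_apply hX

lemma fieldDeriv_eq_zero {X : Rn n → Rn n} {φ : Rn n → ℝ} {ξ : Rn n} (h : ξ ∉ tsupport φ) :
    fieldDeriv X φ ξ = 0 := by
  rw [fieldDeriv, fderiv_of_notMem_tsupport ℝ h]
  rfl

lemma HasCompactSupport.exists_closedBall {φ : Rn n → ℝ} (h : HasCompactSupport φ) :
    ∃ R : ℝ, ∀ ξ ∉ Metric.closedBall (0 : Rn n) R, ξ ∉ tsupport φ := by
  obtain ⟨R, hR⟩ := IsCompact.isBounded h |>.subset_closedBall (0 : Rn n)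
  exact ⟨R, fun ξ hξ h' => hξ (hR h')⟩

/-- Passage to the limit in a product of a boundedly and an `L¹` convergent sequence. -/
lemma tendsto_integral_mul_of_tendsto {R C : ℝ} {A : ℕ → Rn n → ℝ} {a : Rn n → ℝ}
    {h : ℕ → Rn n → ℝ} {g : Rn n → ℝ} (hA : ∀ k, Continuous (A k))
    (hA0 : ∀ k, ∀ ξ ∉ Metric.closedBall (0 : Rn n) R, A k ξ = 0)
    (hAC : ∀ᶠ k in atTop, ∀ ξ, |A k ξ| ≤ C)
    (hAa : ∀ ξ, Tendsto (fun k => A k ξ) atTop (𝓝 (a ξ))) (hh : ∀ k, Continuous (h k))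
    (hg : LocallyIntegrable g)
    (hlim : Tendsto (fun k => ∫⁻ ξ in Metric.closedBall 0 R, ‖h k ξ - g ξ‖ₑ) atTop (𝓝 0)) :
    Tendsto (fun k => ∫ ξ, A k ξ * h k ξ) atTop (𝓝 (∫ ξ, a ξ * g ξ)) := by
  have hB : MeasurableSet (Metric.closedBall (0 : Rn n) R) := Metric.isClosed_closedBall.measurableSet
  have hgB : IntegrableOn g (Metric.closedBall (0 : Rn n) R) :=
    hg.integrableOn_isCompact (isCompact_closedBall _ _)
  have ha0 : ∀ ξ ∉ Metric.closedBall (0 : Rn n) R, a ξ = 0 := fun ξ hξ =>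
    tendsto_nhds_unique (hAa ξ) (by simp [hA0 _ ξ hξ])
  have e1 : ∀ k (w : Rn n → ℝ), ∫ ξ, A k ξ * w ξ = ∫ ξ in Metric.closedBall 0 R, A k ξ * w ξ :=
    fun k w => (setIntegral_eq_integral_of_forall_compl_eq_zero fun ξ hξ => by
      rw [hA0 k ξ hξ, zero_mul]).symm
  have e2 : ∫ ξ, a ξ * g ξ = ∫ ξ in Metric.closedBall 0 R, a ξ * g ξ :=
    (setIntegral_eq_integral_of_forall_compl_eq_zero fun ξ hξ => by rw [ha0 ξ hξ, zero_mul]).symm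
  have hAg : ∀ k, IntegrableOn (fun ξ => A k ξ * g ξ) (Metric.closedBall (0 : Rn n) R) := fun k =>
    hgB.continuousOn_mul (hA k).continuousOn (isCompact_closedBall _ _)
  have hAh : ∀ k, IntegrableOn (fun ξ => A k ξ * h k ξ) (Metric.closedBall (0 : Rn n) R) :=
    fun k => ((hA k).mul (hh k)).continuousOn.integrableOn_compact (isCompact_closedBall _ _)
  have l1 : Tendsto (fun k => ∫ ξ in Metric.closedBall 0 R, A k ξ * g ξ) atTop
      (𝓝 (∫ ξ in Metric.closedBall 0 R, a ξ * g ξ)) := by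
    refine tendsto_integral_filter_of_dominated_convergence (fun ξ => C * |g ξ|)
      (Eventually.of_forall fun k => (hAg k).1) ?_ (hgB.abs.const_mul C) ?_
    · filter_upwards [hAC] with k hk
      refine Eventually.of_forall fun ξ => ?_
      rw [Real.norm_eq_abs, abs_mul]
      exact mul_le_mul_of_nonneg_right (hk ξ) (abs_nonneg _)
    · exact Eventually.of_forall fun ξ => (hAa ξ).mul_const _
  have l2 : Tendsto (fun k => ∫ ξ in Metric.closedBall 0 R, A k ξ * h k ξ -
      A k ξ * g ξ) atTop (𝓝 0) := by
    rw [tendsto_zero_iff_norm_tendsto_zero]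
    have h3 : Tendsto (fun k => ENNReal.toReal (ENNReal.ofReal C *
        ∫⁻ ξ in Metric.closedBall (0 : Rn n) R, ‖h k ξ - g ξ‖ₑ)) atTop (𝓝 0) := by
      have := ENNReal.Tendsto.const_mul hlim (Or.inr (ENNReal.ofReal_ne_top (r := C)))
      rw [mul_zero] at this
      exact (ENNReal.tendsto_toReal ENNReal.zero_ne_top).comp this
    have hfin : ∀ k, ∫⁻ ξ in Metric.closedBall (0 : Rn n) R, ‖h k ξ - g ξ‖ₑ ≠ ⊤ := fun k =>
      (((hh k).continuousOn.integrableOn_compact (isCompact_closedBall _ _)).sub hgB).2.ne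
    refine squeeze_zero' (Eventually.of_forall fun k => norm_nonneg _) ?_ h3
    filter_upwards [hAC] with k hk
    rw [← toReal_enorm]
    refine ENNReal.toReal_mono (ENNReal.mul_ne_top ENNReal.ofReal_ne_top (hfin k)) ?_
    refine (enorm_integral_le_lintegral_enorm _).trans ?_
    rw [← lintegral_const_mul' _ _ ENNReal.ofReal_ne_top]
    refine lintegral_mono fun ξ => ?_
    rw [← mul_sub, enorm_mul]
    gcongr
    rw [Real.enorm_eq_ofReal_abs]
    exact ENNReal.ofReal_le_ofReal (hk ξ)
  simp_rw [e1, e2]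
  have := l2.add l1
  simp only [zero_add] at this
  refine this.congr fun k => ?_
  rw [integral_sub (hAh k) (hAg k), sub_add_cancel]

lemma IsTestFunction.mul_left {Ω : Set (Rn n)} {φ : Rn n → ℝ} (hφ : IsTestFunction Ω φ)
    {w : Rn n → ℝ} (hw : ContDiff ℝ ∞ w) : IsTestFunction Ω fun ξ => w ξ * φ ξ where
  contDiff := hw.mul hφ.contDiff
  hasCompactSupport := hφ.hasCompactSupport.mul_left
  tsupport_subset := (tsupport_mul_subset_right (f := w)).trans hφ.tsupport_subset

/-- The chain rule for weak derivatives. -/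
theorem HasLipDeriv.comp_pi {X : Rn n → Rn n} (hX : IsRegularField X) {ι : Type*} [Fintype ι]
    [DecidableEq ι] {u g : ι → Rn n → ℝ} (h : ∀ i, HasLipDeriv X (u i) (g i))
    {Ψ : (ι → ℝ) → ℝ} (hΨ : ContDiff ℝ ∞ Ψ) :
    HasLipDeriv X (fun ξ => Ψ fun i => u i ξ)
      fun ξ => ∑ i, fderiv ℝ Ψ (fun i => u i ξ) (Pi.single i 1) * g i ξ := by
  have hu : Continuous fun ξ i => u i ξ := continuous_pi fun i => (h i).continuous
  have hΨc : ∀ i, Continuous fun v => fderiv ℝ Ψ v (Pi.single i 1) := fun i =>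
    (hΨ.continuous_fderiv (by simp)).clm_apply continuous_const
  have hdc : ∀ i, Continuous fun ξ => fderiv ℝ Ψ (fun i => u i ξ) (Pi.single i 1) := fun i =>
    (hΨc i).comp hu
  have hbdd : IsLocBdd fun ξ => ∑ i, fderiv ℝ Ψ (fun i => u i ξ) (Pi.single i 1) * g i ξ :=
    IsLocBdd.sum fun i _ => (hdc i).isLocBdd.mul (h i).locBdd
  have hmeas : AEStronglyMeasurable
      (fun ξ => ∑ i, fderiv ℝ Ψ (fun i => u i ξ) (Pi.single i 1) * g i ξ) volume :=
    Finset.aestronglyMeasurable_fun_sum _ fun i _ =>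
      (hdc i).aestronglyMeasurable.mul (h i).aestronglyMeasurable
  have hcomp : Continuous fun ξ => Ψ fun i => u i ξ := hΨ.continuous.comp hu
  refine ⟨hcomp, ⟨locallyIntegrableOn_univ.2 hcomp.locallyIntegrable,
    locallyIntegrableOn_univ.2 (hbdd.locallyIntegrable hmeas), fun φ hφ => ?_⟩, hbdd⟩
  obtain ⟨R, hR⟩ := hφ.hasCompactSupport.exists_closedBall
  have hφ0 : ∀ ξ ∉ Metric.closedBall (0 : Rn n) R, φ ξ = 0 := fun ξ hξ =>
    image_eq_zero_of_notMem_tsupport (hR ξ hξ)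
  have hsm : ∀ k i, ContDiff ℝ ∞ (mollify k (u i)) := fun k i =>
    contDiff_mollify k (h i).continuous.locallyIntegrable
  have hUsm : ∀ k, ContDiff ℝ ∞ fun ξ i => mollify k (u i) ξ := fun k =>
    contDiff_pi.2 fun i => hsm k i
  have hΨU : ∀ k, ContDiff ℝ ∞ fun ξ => Ψ fun i => mollify k (u i) ξ := fun k => hΨ.comp (hUsm k)
  have hUlim : ∀ ξ, Tendsto (fun k => fun i => mollify k (u i) ξ) atTop (𝓝 fun i => u i ξ) :=
    fun ξ => tendsto_pi_nhds.2 fun i => tendsto_mollify (h i).continuous ξ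
  -- Over the support of φ the values of u and, eventually, of its mollifications stay in one
  -- compact set, where Ψ and its derivative are bounded.
  obtain ⟨r, hr⟩ := (isCompact_closedBall (0 : Rn n) R).exists_bound_of_continuousOn hu.continuousOn
  have hUbd : ∀ᶠ k in atTop, ∀ ξ ∈ Metric.closedBall (0 : Rn n) R,
      (fun i => mollify k (u i) ξ) ∈ Metric.closedBall (0 : ι → ℝ) (r + 1) := by
    filter_upwards [eventually_all.2 fun i =>
      eventually_abs_mollify_sub_le (h i).continuous R one_pos] with k hk ξ hξ
    have h1 : ‖(fun i => mollify k (u i) ξ) - fun i => u i ξ‖ ≤ 1 :=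
      (pi_norm_le_iff_of_nonneg zero_le_one).2 fun i => hk i ξ hξ
    have h2 := norm_add_le ((fun i => mollify k (u i) ξ) - fun i => u i ξ) fun i => u i ξ
    rw [sub_add_cancel] at h2
    rw [mem_closedBall_zero_iff]
    linarith [hr ξ hξ]
  obtain ⟨Mφ, hMφ⟩ := hφ.hasCompactSupport.exists_bound_of_continuous hφ.contDiff.continuous
  have hXφ : Continuous (fieldDeriv X φ) := continuous_fieldDeriv hX.continuous hφ.contDiff
  -- the identity for the mollified functions
  have hk : ∀ k, ∫ ξ, (Ψ fun i => mollify k (u i) ξ) * fieldDeriv X φ ξ =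
      -∑ i, ∫ ξ, (fderiv ℝ Ψ (fun i => mollify k (u i) ξ) (Pi.single i 1) * φ ξ) *
        fieldDeriv X (mollify k (u i)) ξ := by
    intro k
    -- For smooth functions the identity is the vanishing of the integral of X(Ψ(u_k) φ), expanded
    -- by the product and chain rules.
    have h1 := hX.divFree _ ((show IsTestFunction univ φ from hφ).mul_left (hΨU k))
    have h2 : ∀ ξ, fieldDeriv X (fun ξ => (Ψ fun i => mollify k (u i) ξ) * φ ξ) ξ =
        (Ψ fun i => mollify k (u i) ξ) * fieldDeriv X φ ξ +
        ∑ i, (fderiv ℝ Ψ (fun i => mollify k (u i) ξ) (Pi.single i 1) * φ ξ) *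
          fieldDeriv X (mollify k (u i)) ξ := by
      intro ξ
      have d1 : HasFDerivAt (fun ξ i => mollify k (u i) ξ)
          (ContinuousLinearMap.pi fun i => fderiv ℝ (mollify k (u i)) ξ) ξ :=
        hasFDerivAt_pi.2 fun i => ((hsm k i).differentiable (by simp) ξ).hasFDerivAt
      have d2 := (hΨ.differentiable (by simp) fun i => mollify k (u i) ξ).hasFDerivAt.comp ξ d1
      have d3 := d2.mul (hφ.contDiff.differentiable (by simp) ξ).hasFDerivAt
      have d4 : fderiv ℝ Ψ (fun i => mollify k (u i) ξ)
          (fun i => fderiv ℝ (mollify k (u i)) ξ (X ξ)) =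
          ∑ i, fderiv ℝ Ψ (fun i => mollify k (u i) ξ) (Pi.single i 1) *
            fderiv ℝ (mollify k (u i)) ξ (X ξ) := by
        conv_lhs => rw [pi_eq_sum_univ' fun i => fderiv ℝ (mollify k (u i)) ξ (X ξ)]
        rw [map_sum]
        refine Finset.sum_congr rfl fun i _ => ?_
        rw [map_smul, smul_eq_mul, mul_comm]
      have d5 : fieldDeriv X (fun ξ => (Ψ fun i => mollify k (u i) ξ) * φ ξ) ξ =
          (Ψ fun i => mollify k (u i) ξ) * fderiv ℝ φ ξ (X ξ) +
          φ ξ * fderiv ℝ Ψ (fun i => mollify k (u i) ξ)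
          (fun i => fderiv ℝ (mollify k (u i)) ξ (X ξ)) := by
        rw [fieldDeriv]
        have := d3.fderiv
        change fderiv ℝ (fun ξ => (Ψ fun i => mollify k (u i) ξ) * φ ξ) ξ = _ at this
        rw [this]
        rfl
      rw [d5, d4, Finset.mul_sum]
      simp only [fieldDeriv]
      congr 1
      exact Finset.sum_congr rfl fun i _ => by ring
    simp_rw [h2] at h1
    have i1 : Integrable fun ξ => (Ψ fun i => mollify k (u i) ξ) * fieldDeriv X φ ξ := by
      refine ((hΨU k).continuous.mul hXφ).integrable_of_hasCompactSupport ?_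
      refine HasCompactSupport.mul_left ?_
      exact HasCompactSupport.intro hφ.hasCompactSupport fun ξ hξ => fieldDeriv_eq_zero hξ
    have i2 : ∀ i, Integrable fun ξ =>
        (fderiv ℝ Ψ (fun i => mollify k (u i) ξ) (Pi.single i 1) * φ ξ) *
          fieldDeriv X (mollify k (u i)) ξ := by
      intro i
      refine Continuous.integrable_of_hasCompactSupport ?_ ?_
      · exact (((hΨc i).comp (hUsm k).continuous).mul hφ.contDiff.continuous).mul
          (continuous_fieldDeriv hX.continuous (hsm k i))
      · exact hφ.hasCompactSupport.mul_left.mul_right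
    rw [integral_add i1 (integrable_finsetSum _ fun i _ => i2 i),
      integral_finsetSum _ fun i _ => i2 i] at h1
    linarith
  -- passage to the limit on both sides
  have lhs : Tendsto (fun k => ∫ ξ, (Ψ fun i => mollify k (u i) ξ) * fieldDeriv X φ ξ) atTop
      (𝓝 (∫ ξ, (Ψ fun i => u i ξ) * fieldDeriv X φ ξ)) := by
    obtain ⟨C, hC⟩ := (isCompact_closedBall (0 : ι → ℝ) (r + 1)).exists_bound_of_continuousOn
      hΨ.continuous.continuousOn
    refine tendsto_integral_filter_of_dominated_convergence (fun ξ => C * |fieldDeriv X φ ξ|)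
      (Eventually.of_forall fun k => ((hΨU k).continuous.mul hXφ).aestronglyMeasurable) ?_ ?_ ?_
    · filter_upwards [hUbd] with k hk
      refine Eventually.of_forall fun ξ => ?_
      by_cases hξ : ξ ∈ Metric.closedBall (0 : Rn n) R
      · rw [norm_mul]
        exact mul_le_mul_of_nonneg_right (hC _ (hk ξ hξ)) (norm_nonneg _)
      · simp [fieldDeriv_eq_zero (hR ξ hξ)]
    · exact ((hXφ.integrable_of_hasCompactSupport (HasCompactSupport.intro hφ.hasCompactSupport
        fun ξ hξ => fieldDeriv_eq_zero hξ)).abs).const_mul C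
    · exact Eventually.of_forall fun ξ =>
        ((hΨ.continuous.tendsto _).comp (hUlim ξ)).mul_const _
  have rhs : ∀ i, Tendsto (fun k => ∫ ξ,
      (fderiv ℝ Ψ (fun i => mollify k (u i) ξ) (Pi.single i 1) * φ ξ) *
        fieldDeriv X (mollify k (u i)) ξ) atTop
      (𝓝 (∫ ξ, (fderiv ℝ Ψ (fun i => u i ξ) (Pi.single i 1) * φ ξ) * g i ξ)) := by
    intro i
    obtain ⟨C, hC⟩ := (isCompact_closedBall (0 : ι → ℝ) (r + 1)).exists_bound_of_continuousOn
      (hΨc i).continuousOn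
    refine tendsto_integral_mul_of_tendsto (R := R) (C := max C 0 * Mφ) (fun k => ?_)
      (fun k ξ hξ => ?_) ?_ (fun ξ => ?_) (fun k => continuous_fieldDeriv hX.continuous (hsm k i))
      (h i).weak.locallyIntegrable_deriv ((h i).tendsto_fieldDeriv_mollify hX R)
    · exact ((hΨc i).comp (hUsm k).continuous).mul hφ.contDiff.continuous
    · rw [hφ0 ξ hξ, mul_zero]
    · filter_upwards [hUbd] with k hk ξ
      by_cases hξ : ξ ∈ Metric.closedBall (0 : Rn n) R
      · rw [abs_mul]
        exact mul_le_mul ((hC _ (hk ξ hξ)).trans (le_max_left _ _)) (hMφ ξ) (abs_nonneg _)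
          (le_max_right _ _)
      · rw [hφ0 ξ hξ, mul_zero, abs_zero]
        exact mul_nonneg (le_max_right _ _) ((norm_nonneg _).trans (hMφ ξ))
    · exact (((hΨc i).tendsto _).comp (hUlim ξ)).mul_const _
  have hfin := tendsto_nhds_unique lhs
    ((tendsto_finsetSum Finset.univ fun i _ => rhs i).neg.congr fun k => (hk k).symm)
  rw [hfin, neg_inj, ← integral_finsetSum]
  · refine integral_congr_ae (Eventually.of_forall fun ξ => ?_)
    beta_reduce
    rw [Finset.sum_mul]
    exact Finset.sum_congr rfl fun i _ => by ring
  · intro i _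
    have := ((h i).weak.locallyIntegrable_deriv).integrable_smul_left_of_hasCompactSupport
      ((hdc i).mul hφ.contDiff.continuous) hφ.hasCompactSupport.mul_left
    simpa [smul_eq_mul] using this

theorem HasLipDeriv.mul {X : Rn n → Rn n} (hX : IsRegularField X) {u v g h : Rn n → ℝ}
    (hu : HasLipDeriv X u g) (hv : HasLipDeriv X v h) :
    HasLipDeriv X (fun ξ => u ξ * v ξ) fun ξ => v ξ * g ξ + u ξ * h ξ := by
  have key := HasLipDeriv.comp_pi hX (u := ![u, v]) (g := ![g, h])
    (Ψ := fun w : Fin 2 → ℝ => w 0 * w 1) (by intro i; fin_cases i <;> assumption) (by fun_prop)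
  convert key using 1
  · rfl
  · ext ξ
    have hd : ∀ w : Fin 2 → ℝ, HasFDerivAt (fun w : Fin 2 → ℝ => w 0 * w 1)
        (w 0 • ContinuousLinearMap.proj (R := ℝ) (φ := fun _ : Fin 2 => ℝ) 1 +
          w 1 • ContinuousLinearMap.proj (R := ℝ) (φ := fun _ : Fin 2 => ℝ) 0) w :=
      fun w => (hasFDerivAt_apply 0 w).mul (hasFDerivAt_apply 1 w)
    simp [Fin.sum_univ_two, (hd _).fderiv]

theorem HasLipDeriv.comp {X : Rn n → Rn n} (hX : IsRegularField X) {u g : Rn n → ℝ}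
    (hu : HasLipDeriv X u g) {ψ ψ' : ℝ → ℝ} (hψ : ContDiff ℝ ∞ ψ)
    (hψ' : ∀ t, HasDerivAt ψ (ψ' t) t) :
    HasLipDeriv X (fun ξ => ψ (u ξ)) fun ξ => ψ' (u ξ) * g ξ := by
  have key := HasLipDeriv.comp_pi hX (u := fun _ : Fin 1 => u) (g := fun _ => g)
    (Ψ := fun w : Fin 1 → ℝ => ψ (w 0)) (fun _ => hu) (by fun_prop)
  convert key using 1
  · ext ξ
    have hd : ∀ w : Fin 1 → ℝ, HasFDerivAt (fun w : Fin 1 → ℝ => ψ (w 0))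
        (ψ' (w 0) • ContinuousLinearMap.proj (R := ℝ) (φ := fun _ : Fin 1 => ℝ) 0) w :=
      fun w => (hψ' (w 0)).comp_hasFDerivAt w (hasFDerivAt_apply 0 w)
    simp [(hd _).fderiv]

/-- A weak derivative of a function vanishing on an open set vanishes there. -/
lemma HasWeakFieldDeriv.ae_eq_zero {X : Rn n → Rn n} {u g : Rn n → ℝ}
    (h : HasWeakFieldDeriv X univ u g) {O : Set (Rn n)} (hO : IsOpen O)
    (hu : ∀ ξ ∈ O, u ξ = 0) : ∀ᵐ ξ, ξ ∈ O → g ξ = 0 := by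
  refine hO.ae_eq_zero_of_integral_contDiff_smul_eq_zero
    (h.locallyIntegrable_deriv.locallyIntegrableOn O) fun φ hφ hc hs => ?_
  have h1 := h.integral_eq φ ⟨hφ, hc, subset_univ _⟩
  have h2 : ∫ ξ, u ξ * fieldDeriv X φ ξ = 0 := by
    refine integral_eq_zero_of_ae (Eventually.of_forall fun ξ => ?_)
    by_cases hξ : ξ ∈ tsupport φ
    · simp [hu ξ (hs hξ)]
    · simp [fieldDeriv_eq_zero hξ]
  simp_rw [smul_eq_mul, mul_comm (φ _)]
  linarith

lemma HasLipDeriv.ae_eq_zero_of_notMem_closedBall {X : Rn n → Rn n} {u g : Rn n → ℝ}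
    (h : HasLipDeriv X u g) {R : ℝ} (hR : ∀ ξ ∉ Metric.closedBall (0 : Rn n) R, u ξ = 0) :
    ∀ᵐ ξ, ξ ∉ Metric.closedBall (0 : Rn n) R → g ξ = 0 :=
  h.weak.ae_eq_zero Metric.isClosed_closedBall.isOpen_compl hR

lemma HasLipDeriv.integrable_of_closedBall {X : Rn n → Rn n} {u g : Rn n → ℝ}
    (h : HasLipDeriv X u g) {R : ℝ} (hR : ∀ ξ ∉ Metric.closedBall (0 : Rn n) R, u ξ = 0) :
    Integrable g := by
  have h1 : IntegrableOn g (Metric.closedBall (0 : Rn n) R) :=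
    h.weak.locallyIntegrable_deriv.integrableOn_isCompact (isCompact_closedBall _ _)
  exact h1.integrable_of_ae_notMem_eq_zero (h.ae_eq_zero_of_notMem_closedBall hR)

/-- A smooth cutoff, equal to one on the ball of radius `r` and vanishing outside that of
radius `2 r`. -/
lemma exists_cutoff (x : Rn n) {r : ℝ} (hr : 0 < r) : ∃ χ : Rn n → ℝ, ContDiff ℝ ∞ χ ∧
    HasCompactSupport χ ∧ (∀ ξ ∈ Metric.closedBall x r, χ ξ = 1) ∧
    (∀ ξ ∉ Metric.ball x (2 * r), χ ξ = 0) ∧ ∀ ξ, χ ξ ∈ Icc (0 : ℝ) 1 := by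
  let f : ContDiffBump x := ⟨r, 2 * r, hr, by linarith⟩
  refine ⟨f, f.contDiff, f.hasCompactSupport, fun ξ hξ => f.one_of_mem_closedBall hξ,
    fun ξ hξ => f.zero_of_le_dist ?_, fun ξ => ⟨f.nonneg, f.le_one⟩⟩
  simpa using hξ

/-- The weak derivative is tested against a cutoff equal to one near the support of u, where the
derivative of the cutoff vanishes. -/
lemma HasLipDeriv.integral_eq_zero {X : Rn n → Rn n} {u g : Rn n → ℝ} (h : HasLipDeriv X u g)
    (hc : HasCompactSupport u) : ∫ ξ, g ξ = 0 := by
  obtain ⟨R, hR⟩ := hc.exists_closedBall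
  have hR0 : ∀ ξ ∉ Metric.closedBall (0 : Rn n) R, u ξ = 0 := fun ξ hξ =>
    image_eq_zero_of_notMem_tsupport (hR ξ hξ)
  obtain ⟨χ, hχ, hχc, hχ1, -, -⟩ := exists_cutoff (0 : Rn n) (r := |R| + 1) (by positivity)
  have h1 := h.weak.integral_eq χ ⟨hχ, hχc, subset_univ _⟩
  have h2 : ∫ ξ, u ξ * fieldDeriv X χ ξ = 0 := by
    refine integral_eq_zero_of_ae (Eventually.of_forall fun ξ => ?_)
    by_cases hξ : ξ ∈ Metric.closedBall (0 : Rn n) R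
    · have h3 : χ =ᶠ[𝓝 ξ] fun _ => 1 := by
        have hlt : ξ ∈ Metric.ball (0 : Rn n) (|R| + 1) := by
          rw [mem_closedBall_zero_iff] at hξ
          rw [mem_ball_zero_iff]
          linarith [le_abs_self R]
        filter_upwards [Metric.isOpen_ball.mem_nhds hlt] with y hy
        exact hχ1 y (Metric.ball_subset_closedBall hy)
      simp [fieldDeriv, h3.fderiv_eq]
    · simp [hR0 ξ hξ]
  have h4 : ∫ ξ, g ξ * χ ξ = ∫ ξ, g ξ := by
    refine integral_congr_ae ?_
    filter_upwards [h.ae_eq_zero_of_notMem_closedBall hR0] with ξ hξ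
    by_cases hm : ξ ∈ Metric.closedBall (0 : Rn n) R
    · rw [hχ1 ξ, mul_one]
      rw [mem_closedBall_zero_iff] at hm ⊢
      linarith [le_abs_self R]
    · simp [hξ hm]
  linarith

/-- Counterpart of `tendsto_integral_mul_of_tendsto` for a fixed multiplier that is merely
measurable and locally bounded, such as a component of ∇N. -/
lemma tendsto_integral_mul_of_locBdd {R : ℝ} {A : Rn n → ℝ} {h : ℕ → Rn n → ℝ} {g : Rn n → ℝ}
    (hA : IsLocBdd A) (hAm : AEStronglyMeasurable A volume) (hh : ∀ k, Continuous (h k))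
    (hh0 : ∀ k, ∀ ξ ∉ Metric.closedBall (0 : Rn n) R, h k ξ = 0) (hg : LocallyIntegrable g)
    (hg0 : ∀ᵐ ξ, ξ ∉ Metric.closedBall (0 : Rn n) R → g ξ = 0)
    (hlim : Tendsto (fun k => ∫⁻ ξ in Metric.closedBall 0 R, ‖h k ξ - g ξ‖ₑ) atTop (𝓝 0)) :
    Integrable (fun ξ => A ξ * g ξ) ∧
      Tendsto (fun k => ∫ ξ, A ξ * h k ξ) atTop (𝓝 (∫ ξ, A ξ * g ξ)) := by
  have hB : MeasurableSet (Metric.closedBall (0 : Rn n) R) := Metric.isClosed_closedBall.measurableSet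
  obtain ⟨M, hM⟩ := hA R
  have hMB : ∀ᵐ ξ ∂volume.restrict (Metric.closedBall (0 : Rn n) R), ‖A ξ‖ ≤ M := by
    rw [ae_restrict_iff' hB]
    filter_upwards [hM] with ξ hξ hm
    exact hξ (by simpa using hm)
  have hgB : IntegrableOn g (Metric.closedBall (0 : Rn n) R) :=
    hg.integrableOn_isCompact (isCompact_closedBall _ _)
  have i1 : IntegrableOn (fun ξ => A ξ * g ξ) (Metric.closedBall (0 : Rn n) R) :=
    hgB.bdd_mul hAm.restrict hMB
  have i2 : ∀ k, IntegrableOn (fun ξ => A ξ * h k ξ) (Metric.closedBall (0 : Rn n) R) := fun k =>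
    Integrable.bdd_mul ((hh k).continuousOn.integrableOn_compact (isCompact_closedBall _ _))
      hAm.restrict hMB
  refine ⟨i1.integrable_of_ae_notMem_eq_zero (by
    filter_upwards [hg0] with ξ hξ hm
    rw [hξ hm, mul_zero]), ?_⟩
  have e1 : ∀ k, ∫ ξ, A ξ * h k ξ = ∫ ξ in Metric.closedBall 0 R, A ξ * h k ξ := fun k =>
    (setIntegral_eq_integral_of_forall_compl_eq_zero fun ξ hξ => by
      rw [hh0 k ξ hξ, mul_zero]).symm
  have e2 : ∫ ξ, A ξ * g ξ = ∫ ξ in Metric.closedBall 0 R, A ξ * g ξ :=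
    (setIntegral_eq_integral_of_ae_compl_eq_zero (by
      filter_upwards [hg0] with ξ hξ hm
      rw [hξ hm, mul_zero])).symm
  simp_rw [e1, e2]
  refine tendsto_integral_of_L1 _ i1.1 (Eventually.of_forall i2) ?_
  have h3 := ENNReal.Tendsto.const_mul hlim (Or.inr (ENNReal.ofReal_ne_top (r := M)))
  rw [mul_zero] at h3
  refine tendsto_of_tendsto_of_tendsto_of_le_of_le tendsto_const_nhds h3 (fun _ => zero_le) ?_
  intro k
  beta_reduce
  rw [← lintegral_const_mul' _ _ ENNReal.ofReal_ne_top]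
  refine lintegral_mono_ae ?_
  filter_upwards [hMB] with ξ hξ
  rw [← mul_sub, enorm_mul]
  gcongr
  rw [← ofReal_norm]
  exact ENNReal.ofReal_le_ofReal hξ

/-! ### Nonsmooth test functions in the Laplacian inequality, and removability of the origin. -/

lemma mollify_eq_zero_of_closedBall {u : Rn n → ℝ} {R : ℝ}
    (hR : ∀ ξ ∉ Metric.closedBall (0 : Rn n) R, u ξ = 0) (k : ℕ) {ξ : Rn n}
    (hξ : ξ ∉ Metric.closedBall (0 : Rn n) (R + 1)) : mollify k u ξ = 0 := by
  refine mollify_eq_zero k fun y hy => hR y fun hy' => hξ ?_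
  have hk1 : ((k : ℝ) + 1)⁻¹ ≤ 1 := inv_le_one_of_one_le₀ (by linarith [k.cast_nonneg (α := ℝ)])
  rw [mem_closedBall_zero_iff] at hy' ⊢
  rw [dist_comm, dist_eq_norm] at hy
  have := norm_add_le (ξ - y) y
  rw [sub_add_cancel] at this
  linarith

/-- A distributional inequality for the Laplacian of `N` away from the origin extends to test
functions which are merely continuous with locally bounded weak derivatives. -/
theorem laplacian_le_of_hasLipDeriv {l : ℕ} {X : Fin l → Rn n → Rn n}
    (hX : ∀ i, IsRegularField (X i)) {GN : Fin l → Rn n → ℝ} (hGN : ∀ i, IsLocBdd (GN i))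
    (hGNm : ∀ i, AEStronglyMeasurable (GN i) volume) {V : Rn n → ℝ} (hV : ContinuousOn V {0}ᶜ)
    {C : ℝ} (hineq : ∀ φ, IsTestFunction {0}ᶜ φ → (∀ ξ, 0 ≤ φ ξ) →
      -∫ ξ, ∑ i, GN i ξ * fieldDeriv (X i) φ ξ ≤ C * ∫ ξ, V ξ * φ ξ)
    {Φ : Rn n → ℝ} (hΦ : Continuous Φ) {GΦ : Fin l → Rn n → ℝ}
    (h : ∀ i, HasLipDeriv (X i) Φ (GΦ i))
    (hΦ0 : ∀ ξ, 0 ≤ Φ ξ) (hΦc : HasCompactSupport Φ) (h0 : (0 : Rn n) ∉ tsupport Φ) :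
    -∑ i, ∫ ξ, GN i ξ * GΦ i ξ ≤ C * ∫ ξ, V ξ * Φ ξ := by
  obtain ⟨R, hR⟩ := hΦc.exists_closedBall
  have hR0 : ∀ ξ ∉ Metric.closedBall (0 : Rn n) R, Φ ξ = 0 := fun ξ hξ =>
    image_eq_zero_of_notMem_tsupport (hR ξ hξ)
  have hR1 : ∀ ξ ∉ Metric.closedBall (0 : Rn n) (R + 1), Φ ξ = 0 := fun ξ hξ =>
    hR0 ξ fun h' => hξ (Metric.closedBall_subset_closedBall (by linarith) h')
  -- The support of Φ keeps a distance from the origin, so fine mollifications are still admissible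
  -- test functions on the punctured space.
  obtain ⟨δ, hδ, hδ0⟩ := Metric.isOpen_iff.1 (isClosed_tsupport Φ).isOpen_compl 0 h0
  have hsm : ∀ k, ContDiff ℝ ∞ (mollify k Φ) := fun k => contDiff_mollify k hΦ.locallyIntegrable
  have hlim0 : Tendsto (fun k : ℕ => (k + 1 : ℝ)⁻¹) atTop (𝓝 0) :=
    tendsto_inv_atTop_zero.comp (tendsto_atTop_add_const_right _ _ tendsto_natCast_atTop_atTop)
  have hnear : ∀ᶠ k in atTop, ∀ ξ ∈ Metric.ball (0 : Rn n) (δ / 2), mollify k Φ ξ = 0 := by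
    filter_upwards [hlim0.eventually_lt_const (half_pos hδ)] with k hk ξ hξ
    refine mollify_eq_zero k fun y hy => image_eq_zero_of_notMem_tsupport (hδ0 ?_)
    rw [mem_ball_zero_iff] at hξ ⊢
    rw [dist_eq_norm] at hy
    have := norm_add_le (y - ξ) ξ
    rw [sub_add_cancel] at this
    linarith
  have hts : ∀ k, tsupport (mollify k Φ) ⊆ Metric.closedBall (0 : Rn n) (R + 1) := fun k =>
    closure_minimal (fun ξ hξ => by
      by_contra h'
      exact hξ (mollify_eq_zero_of_closedBall hR0 k h')) Metric.isClosed_closedBall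
  have htest : ∀ᶠ k in atTop, IsTestFunction {0}ᶜ (mollify k Φ) := by
    filter_upwards [hnear] with k hk
    refine ⟨hsm k, HasCompactSupport.intro (isCompact_closedBall 0 (R + 1))
      fun ξ hξ => mollify_eq_zero_of_closedBall hR0 k hξ, ?_⟩
    rw [subset_compl_singleton_iff, notMem_tsupport_iff_eventuallyEq]
    filter_upwards [Metric.ball_mem_nhds (0 : Rn n) (half_pos hδ)] with ξ hξ using hk ξ hξ
  have hl : ∀ i, Integrable (fun ξ => GN i ξ * GΦ i ξ) ∧
      Tendsto (fun k => ∫ ξ, GN i ξ * fieldDeriv (X i) (mollify k Φ) ξ) atTop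
        (𝓝 (∫ ξ, GN i ξ * GΦ i ξ)) := fun i =>
    tendsto_integral_mul_of_locBdd (R := R + 1) (hGN i) (hGNm i)
      (fun k => continuous_fieldDeriv (hX i).continuous (hsm k))
      (fun k ξ hξ => fieldDeriv_eq_zero fun h' => hξ (hts k h'))
      (h i).weak.locallyIntegrable_deriv ((h i).ae_eq_zero_of_notMem_closedBall hR1)
      ((h i).tendsto_fieldDeriv_mollify (hX i) (R + 1))
  have hints : ∀ k i, Integrable fun ξ => GN i ξ * fieldDeriv (X i) (mollify k Φ) ξ := by
    intro k i
    have h1 : Integrable fun ξ => fieldDeriv (X i) (mollify k Φ) ξ • GN i ξ :=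
      ((hGN i).locallyIntegrable (hGNm i)).integrable_smul_left_of_hasCompactSupport
        (continuous_fieldDeriv (hX i).continuous (hsm k))
        (HasCompactSupport.intro (isCompact_closedBall 0 (R + 1))
          fun ξ hξ => fieldDeriv_eq_zero fun h' => hξ (hts k h'))
    simpa [mul_comm] using h1
  have lhs : Tendsto (fun k => -∫ ξ, ∑ i, GN i ξ * fieldDeriv (X i) (mollify k Φ) ξ) atTop
      (𝓝 (-∑ i, ∫ ξ, GN i ξ * GΦ i ξ)) := by
    refine ((tendsto_finsetSum Finset.univ fun i _ => (hl i).2).congr fun k => ?_).neg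
    rw [integral_finsetSum _ fun i _ => hints k i]
  have rhs : Tendsto (fun k => C * ∫ ξ, V ξ * mollify k Φ ξ) atTop (𝓝 (C * ∫ ξ, V ξ * Φ ξ)) := by
    refine Tendsto.const_mul C ?_
    -- V may blow up at the origin, but eventually all integrands vanish off this compact annulus,
    -- where V is bounded.
    set K : Set (Rn n) := Metric.closedBall 0 (R + 1) \ Metric.ball 0 (δ / 2) with hK
    have hKc : IsCompact K := (isCompact_closedBall _ _).diff Metric.isOpen_ball
    have hKV : ContinuousOn V K := hV.mono fun ξ hξ h' => hξ.2 (by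
      rw [mem_singleton_iff.1 h']
      exact Metric.mem_ball_self (half_pos hδ))
    obtain ⟨MV, hMV⟩ := hKc.exists_bound_of_continuousOn hKV
    obtain ⟨MΦ, hMΦ⟩ := hΦc.exists_bound_of_continuous hΦ
    have e1 : ∀ᶠ k in atTop, ∫ ξ, V ξ * mollify k Φ ξ = ∫ ξ in K, V ξ * mollify k Φ ξ := by
      filter_upwards [hnear] with k hk
      refine (setIntegral_eq_integral_of_forall_compl_eq_zero fun ξ hξ => ?_).symm
      by_cases h1 : ξ ∈ Metric.closedBall (0 : Rn n) (R + 1)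
      · rw [hk ξ (by_contra fun h2 => hξ ⟨h1, h2⟩), mul_zero]
      · rw [mollify_eq_zero_of_closedBall hR0 k h1, mul_zero]
    have e2 : ∫ ξ, V ξ * Φ ξ = ∫ ξ in K, V ξ * Φ ξ := by
      refine (setIntegral_eq_integral_of_forall_compl_eq_zero fun ξ hξ => ?_).symm
      by_cases h1 : ξ ∈ Metric.closedBall (0 : Rn n) (R + 1)
      · have h2 : ξ ∈ Metric.ball (0 : Rn n) δ :=
          Metric.ball_subset_ball (by linarith) (by_contra fun h2 => hξ ⟨h1, h2⟩)
        rw [image_eq_zero_of_notMem_tsupport (hδ0 h2), mul_zero]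
      · rw [hR1 ξ h1, mul_zero]
    rw [e2]
    refine Tendsto.congr' (e1.mono fun k hk => hk.symm) ?_
    refine tendsto_integral_filter_of_dominated_convergence (fun _ => MV * MΦ)
      (Eventually.of_forall fun k =>
        (hKV.mul (hsm k).continuous.continuousOn).aestronglyMeasurable hKc.measurableSet) ?_ ?_ ?_
    · refine Eventually.of_forall fun k => ?_
      rw [ae_restrict_iff' hKc.measurableSet]
      refine Eventually.of_forall fun ξ hξ => ?_
      rw [norm_mul]
      exact mul_le_mul (hMV ξ hξ) (abs_mollify_le k (Eventually.of_forall fun y _ => hMΦ y))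
        (norm_nonneg _) ((norm_nonneg _).trans (hMV ξ hξ))
    · exact integrableOn_const hKc.measure_lt_top.ne
    · exact Eventually.of_forall fun ξ => (tendsto_mollify hΦ ξ).const_mul _
  refine le_of_tendsto_of_tendsto lhs rhs ?_
  filter_upwards [htest] with k hk
  exact hineq _ hk fun ξ => mollify_nonneg k hΦ0 ξ

lemma tendsto_inv_natCast_add_one : Tendsto (fun k : ℕ => (k + 1 : ℝ)⁻¹) atTop (𝓝 0) :=
  tendsto_inv_atTop_zero.comp (tendsto_atTop_add_const_right _ _ tendsto_natCast_atTop_atTop)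

lemma inv_natCast_add_one_le_one (k : ℕ) : (k + 1 : ℝ)⁻¹ ≤ 1 :=
  inv_le_one_of_one_le₀ (by linarith [k.cast_nonneg (α := ℝ)])

lemma fieldDeriv_comp_smul (X : Rn n → Rn n) (χ : Rn n → ℝ) (c : ℝ)
    (ξ : Rn n) : fieldDeriv X (fun ξ => χ (c • ξ)) ξ = c * fderiv ℝ χ (c • ξ) (X ξ) := by
  rw [fieldDeriv, fderiv_comp_smul]
  rfl

/-- A shrinking cutoff has no influence on integrals along a divergence free field. -/
lemma tendsto_integral_mul_fieldDeriv_cutoff {m : ℕ} {X : Rn (m + 1) → Rn (m + 1)}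
    (hX : Continuous X) (hdiv : IsDivFree X) {w : Rn (m + 1) → ℝ} (hw : Continuous w)
    {χ : Rn (m + 1) → ℝ} (hχ : ContDiff ℝ ∞ χ) (hχc : HasCompactSupport χ) :
    Tendsto (fun k : ℕ => ∫ ξ, w ξ * fieldDeriv X (fun ξ => χ ((k + 1 : ℝ) • ξ)) ξ) atTop (𝓝 0) := by
  have hk0 : ∀ k : ℕ, (0 : ℝ) < k + 1 := fun k => by positivity
  have hχk : ∀ k : ℕ, ContDiff ℝ ∞ fun ξ => χ ((k + 1 : ℝ) • ξ) := fun k =>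
    hχ.comp (contDiff_const_smul _)
  have hχkc : ∀ k : ℕ, HasCompactSupport fun ξ => χ ((k + 1 : ℝ) • ξ) := fun k =>
    hχc.comp_homeomorph (Homeomorph.smulOfNeZero (k + 1 : ℝ) (hk0 k).ne')
  have hDc : Continuous (fderiv ℝ χ) := hχ.continuous_fderiv (by simp)
  obtain ⟨r, hr⟩ := hχc.exists_closedBall
  -- subtracting the value at the origin
  have e1 : ∀ k : ℕ, ∫ ξ, w ξ * fieldDeriv X (fun ξ => χ ((k + 1 : ℝ) • ξ)) ξ =
      ∫ ξ, (w ξ - w 0) * fieldDeriv X (fun ξ => χ ((k + 1 : ℝ) • ξ)) ξ := by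
    intro k
    have hc := continuous_fieldDeriv hX (hχk k)
    have hs : HasCompactSupport (fieldDeriv X fun ξ => χ ((k + 1 : ℝ) • ξ)) :=
      HasCompactSupport.intro (hχkc k) fun ξ hξ => fieldDeriv_eq_zero hξ
    have i1 : Integrable fun ξ => w ξ * fieldDeriv X (fun ξ => χ ((k + 1 : ℝ) • ξ)) ξ :=
      (hw.mul hc).integrable_of_hasCompactSupport hs.mul_left
    have i2 : Integrable fun ξ => w 0 * fieldDeriv X (fun ξ => χ ((k + 1 : ℝ) • ξ)) ξ :=
      (continuous_const.mul hc).integrable_of_hasCompactSupport hs.mul_left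
    simp_rw [sub_mul]
    rw [integral_sub i1 i2, integral_const_mul, hdiv _ ⟨hχk k, hχkc k, subset_univ _⟩]
    ring
  -- rescaling
  have e2 : ∀ k : ℕ, ∫ ξ, (w ξ - w 0) * fieldDeriv X (fun ξ => χ ((k + 1 : ℝ) • ξ)) ξ =
      ((k + 1 : ℝ)⁻¹) ^ m * ∫ z, (w ((k + 1 : ℝ)⁻¹ • z) - w 0) *
        fderiv ℝ χ z (X ((k + 1 : ℝ)⁻¹ • z)) := by
    intro k
    have h1 := Measure.integral_comp_smul (volume : Measure (Rn (m + 1)))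
      (fun z => (w ((k + 1 : ℝ)⁻¹ • z) - w 0) * fderiv ℝ χ z (X ((k + 1 : ℝ)⁻¹ • z))) (k + 1 : ℝ)
    simp only [smul_smul, inv_mul_cancel₀ (hk0 k).ne', one_smul, finrank_euclideanSpace,
      Fintype.card_fin, smul_eq_mul] at h1
    have h2 : ∀ ξ, (w ξ - w 0) * fieldDeriv X (fun ξ => χ ((k + 1 : ℝ) • ξ)) ξ =
        (k + 1 : ℝ) * ((w ξ - w 0) * fderiv ℝ χ ((k + 1 : ℝ) • ξ) (X ξ)) := by
      intro ξ
      rw [fieldDeriv_comp_smul X χ]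
      ring
    simp_rw [h2]
    rw [integral_const_mul, h1, ← mul_assoc, abs_of_pos (by have := hk0 k; positivity), pow_succ]
    congr 1
    rw [inv_pow, mul_inv, mul_comm, mul_assoc, inv_mul_cancel₀ (hk0 k).ne', mul_one]
  have hcont : ∀ k : ℕ, Continuous fun z => (w ((k + 1 : ℝ)⁻¹ • z) - w 0) *
      fderiv ℝ χ z (X ((k + 1 : ℝ)⁻¹ • z)) := fun k =>
    ((hw.comp (continuous_const_smul _)).sub continuous_const).mul
      (hDc.clm_apply (hX.comp (continuous_const_smul _)))
  obtain ⟨W, hW⟩ := (isCompact_closedBall (0 : Rn (m + 1)) r).exists_bound_of_continuousOn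
    (hw.sub (continuous_const (y := w 0))).continuousOn
  obtain ⟨S, hS⟩ := (isCompact_closedBall (0 : Rn (m + 1)) r).exists_bound_of_continuousOn
    hX.continuousOn
  have hscale : ∀ (k : ℕ) (z : Rn (m + 1)), z ∈ Metric.closedBall (0 : Rn (m + 1)) r →
      (k + 1 : ℝ)⁻¹ • z ∈ Metric.closedBall (0 : Rn (m + 1)) r := by
    intro k z hz
    rw [mem_closedBall_zero_iff] at hz ⊢
    rw [norm_smul, Real.norm_eq_abs, abs_of_pos (inv_pos.2 (hk0 k))]
    exact (mul_le_of_le_one_left (norm_nonneg _) (inv_natCast_add_one_le_one k)).trans hz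
  -- After rescaling the integrand tends to zero because w is continuous at the origin. In dimension
  -- one the prefactor is 1, so the subtraction of w 0 is the only source of decay.
  have l1 : Tendsto (fun k : ℕ => ∫ z, (w ((k + 1 : ℝ)⁻¹ • z) - w 0) *
      fderiv ℝ χ z (X ((k + 1 : ℝ)⁻¹ • z))) atTop (𝓝 (∫ _ : Rn (m + 1), (0 : ℝ))) := by
    refine tendsto_integral_of_dominated_convergence (fun z => W * (‖fderiv ℝ χ z‖ * S))
      (fun k => (hcont k).aestronglyMeasurable) ?_ (fun k => Eventually.of_forall fun z => ?_)
      (Eventually.of_forall fun z => ?_)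
    · exact (((hDc.norm.integrable_of_hasCompactSupport (hχc.fderiv ℝ).norm).mul_const S).const_mul
        W)
    · by_cases hz : z ∈ Metric.closedBall (0 : Rn (m + 1)) r
      · rw [norm_mul]
        have h1 := hW _ (hscale k z hz)
        refine mul_le_mul h1 ?_ (norm_nonneg _) ((norm_nonneg _).trans h1)
        exact (ContinuousLinearMap.le_opNorm _ _).trans
          (mul_le_mul_of_nonneg_left (hS _ (hscale k z hz)) (norm_nonneg _))
      · simp [fderiv_of_notMem_tsupport ℝ (hr z hz)]
    · have h1 : Tendsto (fun k : ℕ => (k + 1 : ℝ)⁻¹ • z) atTop (𝓝 0) := by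
        simpa using tendsto_inv_natCast_add_one.smul_const z
      have h2 := ((hw.tendsto 0).comp h1).sub_const (w 0)
      have h3 := ((hX.tendsto 0).comp h1)
      have h4 := h2.mul (((fderiv ℝ χ z).continuous.tendsto _).comp h3)
      simpa using h4
  rw [integral_zero] at l1
  refine squeeze_zero_norm (fun k => ?_) (by simpa using l1.norm)
  rw [e1, e2, norm_mul, norm_pow, Real.norm_of_nonneg (inv_pos.2 (hk0 k)).le]
  exact mul_le_of_le_one_left (norm_nonneg _)
    (pow_le_one₀ (inv_pos.2 (hk0 k)).le (inv_natCast_add_one_le_one k))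

/-- Points are removable for weak derivatives of continuous functions. -/
theorem HasWeakFieldDeriv.hasLipDeriv_of_compl_singleton {m : ℕ} {X : Rn (m + 1) → Rn (m + 1)}
    (hX : IsRegularField X) {u g : Rn (m + 1) → ℝ} (hu : Continuous u)
    (h : HasWeakFieldDeriv X {0}ᶜ u g) (hg : IsLocBdd g) : HasLipDeriv X u g := by
  have hgm : AEStronglyMeasurable g volume := by
    have := h.locallyIntegrableOn_deriv.aestronglyMeasurable
    rwa [restrict_compl_singleton] at this
  have hgi := hg.locallyIntegrable hgm
  refine ⟨hu, ⟨locallyIntegrableOn_univ.2 hu.locallyIntegrable, locallyIntegrableOn_univ.2 hgi,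
    fun φ hφ => ?_⟩, hg⟩
  obtain ⟨χ, hχ, hχc, hχ1, hχ0, hχI⟩ := exists_cutoff (0 : Rn (m + 1)) one_pos
  have hk0 : ∀ k : ℕ, (0 : ℝ) < k + 1 := fun k => by positivity
  have hχk : ∀ k : ℕ, ContDiff ℝ ∞ fun ξ => χ ((k + 1 : ℝ) • ξ) := fun k =>
    hχ.comp (contDiff_const_smul _)
  have hφc := hφ.contDiff.continuous
  have hXφ := continuous_fieldDeriv hX.continuous hφ.contDiff
  have hXφs : HasCompactSupport (fieldDeriv X φ) :=
    HasCompactSupport.intro hφ.hasCompactSupport fun ξ hξ => fieldDeriv_eq_zero hξ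
  have htest : ∀ k : ℕ, IsTestFunction {0}ᶜ fun ξ => (1 - χ ((k + 1 : ℝ) • ξ)) * φ ξ := by
    intro k
    refine ⟨(contDiff_const.sub (hχk k)).mul hφ.contDiff, hφ.hasCompactSupport.mul_left, ?_⟩
    rw [subset_compl_singleton_iff, notMem_tsupport_iff_eventuallyEq]
    filter_upwards [Metric.closedBall_mem_nhds (0 : Rn (m + 1)) (inv_pos.2 (hk0 k))] with ξ hξ
    rw [mem_closedBall_zero_iff] at hξ
    have : (k + 1 : ℝ) • ξ ∈ Metric.closedBall (0 : Rn (m + 1)) 1 := by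
      rw [mem_closedBall_zero_iff, norm_smul, Real.norm_of_nonneg (hk0 k).le]
      calc (k + 1 : ℝ) * ‖ξ‖ ≤ (k + 1 : ℝ) * (k + 1 : ℝ)⁻¹ :=
            mul_le_mul_of_nonneg_left hξ (hk0 k).le
        _ = 1 := mul_inv_cancel₀ (hk0 k).ne'
    simp [hχ1 _ this]
  have hlimχ : ∀ ξ : Rn (m + 1), ξ ≠ 0 →
      Tendsto (fun k : ℕ => 1 - χ ((k + 1 : ℝ) • ξ)) atTop (𝓝 1) := by
    intro ξ hξ
    refine tendsto_const_nhds.congr' ?_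
    filter_upwards [tendsto_inv_natCast_add_one.eventually_lt_const
      (show (0 : ℝ) < ‖ξ‖ / 2 by positivity)] with k hk
    rw [hχ0, sub_zero]
    rw [mem_ball_zero_iff, norm_smul, Real.norm_of_nonneg (hk0 k).le, not_lt, mul_one]
    rw [inv_lt_iff_one_lt_mul₀ (hk0 k)] at hk
    linarith
  have hne : ∀ᵐ ξ : Rn (m + 1), ξ ≠ 0 := by
    simp [ae_iff]
  have hχb : ∀ (k : ℕ) (ξ : Rn (m + 1)), ‖1 - χ ((k + 1 : ℝ) • ξ)‖ ≤ 1 := by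
    intro k ξ
    have := hχI ((k + 1 : ℝ) • ξ)
    rw [Real.norm_of_nonneg (by linarith [this.2])]
    linarith [this.1]
  have hdom : ∀ {F : Rn (m + 1) → ℝ}, Integrable F →
      Tendsto (fun k : ℕ => ∫ ξ, (1 - χ ((k + 1 : ℝ) • ξ)) * F ξ) atTop (𝓝 (∫ ξ, F ξ)) := by
    intro F hF
    refine tendsto_integral_of_dominated_convergence (fun ξ => ‖F ξ‖)
      (fun k => (continuous_const.sub (hχk k).continuous).aestronglyMeasurable.mul hF.1) hF.norm
      (fun k => Eventually.of_forall fun ξ => ?_) ?_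
    · rw [norm_mul]
      exact mul_le_of_le_one_left (norm_nonneg _) (hχb k ξ)
    · filter_upwards [hne] with ξ hξ
      simpa using (hlimχ ξ hξ).mul_const (F ξ)
  have i1 : Integrable fun ξ => u ξ * fieldDeriv X φ ξ :=
    (hu.mul hXφ).integrable_of_hasCompactSupport hXφs.mul_left
  have i2 : Integrable fun ξ => g ξ * φ ξ := by
    have := hgi.integrable_smul_left_of_hasCompactSupport hφc hφ.hasCompactSupport
    simpa [mul_comm] using this
  have hcut := tendsto_integral_mul_fieldDeriv_cutoff hX.continuous hX.divFree (hu.mul hφc) hχ hχc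
  -- This is the weak identity tested against (1 - χ_k) φ, whose support avoids the origin. The term
  -- containing the derivative of χ_k disappears in the limit.
  have hk : ∀ k : ℕ, (∫ ξ, (1 - χ ((k + 1 : ℝ) • ξ)) * (u ξ * fieldDeriv X φ ξ)) -
      ∫ ξ, (u ξ * φ ξ) * fieldDeriv X (fun ξ => χ ((k + 1 : ℝ) • ξ)) ξ =
      -∫ ξ, (1 - χ ((k + 1 : ℝ) • ξ)) * (g ξ * φ ξ) := by
    intro k
    have h1 := h.integral_eq _ (htest k)
    have h2 : ∀ ξ, u ξ * fieldDeriv X (fun ξ => (1 - χ ((k + 1 : ℝ) • ξ)) * φ ξ) ξ =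
        (1 - χ ((k + 1 : ℝ) • ξ)) * (u ξ * fieldDeriv X φ ξ) -
          (u ξ * φ ξ) * fieldDeriv X (fun ξ => χ ((k + 1 : ℝ) • ξ)) ξ := by
      intro ξ
      have d1 := ((((hχk k).differentiable (by simp)) ξ).hasFDerivAt.const_sub 1).mul
        (hφ.contDiff.differentiable (by simp) ξ).hasFDerivAt
      have d2 : fderiv ℝ (fun ξ => (1 - χ ((k + 1 : ℝ) • ξ)) * φ ξ) ξ = _ := d1.fderiv
      simp only [fieldDeriv, d2]
      simp
      ring
    simp_rw [h2] at h1
    rw [← integral_sub, h1]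
    · refine congrArg Neg.neg (integral_congr_ae (Eventually.of_forall fun ξ => ?_))
      beta_reduce
      ring
    · exact i1.bdd_mul (continuous_const.sub (hχk k).continuous).aestronglyMeasurable
        (Eventually.of_forall (hχb k))
    · refine ((hu.mul hφc).mul
        (continuous_fieldDeriv hX.continuous (hχk k))).integrable_of_hasCompactSupport ?_
      exact hφ.hasCompactSupport.mul_left.mul_right
  have hL := (hdom i1).sub hcut
  rw [sub_zero] at hL
  exact tendsto_nhds_unique hL (((hdom i2).neg).congr fun k => (hk k).symm)

/-! ### Auxiliary one-variable functions -/

/-- A smooth positive function which is the identity on `[1, ∞)`. -/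
lemma exists_smooth_positive_id : ∃ θ : ℝ → ℝ, ContDiff ℝ ∞ θ ∧ (∀ t, 0 < θ t) ∧
    (∀ t, 1 ≤ t → θ t = t ∧ deriv θ t = 1) ∧ ∀ t, 0 ≤ t → t ≤ 1 → t ≤ θ t ∧ θ t ≤ 1 := by
  -- ζ is 0 for t ≤ 1/2 and 1 for t ≥ 3/4, so the combination ζ t · t + (1 - ζ t) is the constant 1
  -- wherever t could be nonpositive.
  let ζ : ℝ → ℝ := fun t => Real.smoothTransition (4 * t - 2)
  have hζ : ContDiff ℝ ∞ ζ := Real.smoothTransition.contDiff.comp (by fun_prop)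
  have h0 : ∀ t, 0 ≤ ζ t := fun t => Real.smoothTransition.nonneg _
  have h1 : ∀ t, ζ t ≤ 1 := fun t => Real.smoothTransition.le_one _
  have hid : ∀ t, 3 / 4 < t → ζ t * t + (1 - ζ t) = t := by
    intro t ht
    have : ζ t = 1 := Real.smoothTransition.one_of_one_le (by linarith)
    rw [this]
    ring
  refine ⟨fun t => ζ t * t + (1 - ζ t), (hζ.mul contDiff_id).add (contDiff_const.sub hζ),
    fun t => ?_, fun t ht => ⟨hid t (by linarith), ?_⟩, fun t ht0 ht1 => ⟨?_, ?_⟩⟩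
  · rcases le_or_gt t (1 / 2) with ht | ht
    · have : ζ t = 0 := Real.smoothTransition.zero_of_nonpos (by linarith)
      simp [this]
    · nlinarith [h0 t, h1 t]
  · have : (fun t => ζ t * t + (1 - ζ t)) =ᶠ[𝓝 t] fun t => t := by
      filter_upwards [lt_mem_nhds (show 3 / 4 < t by linarith)] with s hs using hid s hs
    rw [this.deriv_eq]
    simp
  · nlinarith [h0 t, h1 t]
  · nlinarith [h0 t, h1 t]

/-- The profile `(1 + y² / K²)^{-α/2}`. -/
noncomputable def decayProfile (α K y : ℝ) : ℝ := (1 + y ^ 2 / K ^ 2) ^ (-α / 2)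

lemma decayProfile_base_pos (K y : ℝ) : 0 < 1 + y ^ 2 / K ^ 2 := by positivity

lemma decayProfile_pos (α K y : ℝ) : 0 < decayProfile α K y :=
  Real.rpow_pos_of_pos (decayProfile_base_pos K y) _

lemma decayProfile_le_one {α : ℝ} (hα : 0 < α) (K y : ℝ) : decayProfile α K y ≤ 1 :=
  Real.rpow_le_one_of_one_le_of_nonpos (by have : 0 ≤ y ^ 2 / K ^ 2 := by positivity
                                           linarith) (by linarith)

lemma contDiff_decayProfile (α K : ℝ) : ContDiff ℝ ∞ (decayProfile α K) :=
  ContDiff.rpow_const_of_ne (by fun_prop) fun y => (decayProfile_base_pos K y).ne'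

lemma hasDerivAt_decayProfile (α : ℝ) {K : ℝ} (hK : 0 < K) (y : ℝ) :
    HasDerivAt (decayProfile α K) (-(α * y / (K ^ 2 + y ^ 2) * decayProfile α K y)) y := by
  have h1 : HasDerivAt (fun y : ℝ => 1 + y ^ 2 / K ^ 2) (2 * y / K ^ 2) y := by
    simpa using! ((hasDerivAt_pow 2 y).div_const (K ^ 2)).const_add 1
  have h2 := h1.rpow_const (p := -α / 2) (Or.inl (decayProfile_base_pos K y).ne')
  convert h2 using 1
  · rfl
  rw [Real.rpow_sub_one (decayProfile_base_pos K y).ne', decayProfile]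
  have := decayProfile_base_pos K y
  field_simp

/-- The base y²/(1 + y²/K²) increases in y and saturates at K². Both the upper and the lower bound
below can be read off from this form. -/
lemma decayProfile_mul_rpow (α : ℝ) {K y : ℝ} (hy : 0 ≤ y) :
    decayProfile α K y * y ^ α = (y ^ 2 / (1 + y ^ 2 / K ^ 2)) ^ (α / 2) := by
  rw [Real.div_rpow (by positivity) (decayProfile_base_pos K y).le, decayProfile, neg_div,
    Real.rpow_neg (decayProfile_base_pos K y).le, ← Real.rpow_natCast_mul hy]
  rw [div_eq_mul_inv, mul_comm]
  congr 2
  push_cast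
  ring

lemma decayProfile_mul_rpow_le {α : ℝ} (hα : 0 < α) {K y : ℝ} (hK : 0 < K) (hy : 0 ≤ y) :
    decayProfile α K y * y ^ α ≤ K ^ α := by
  rw [decayProfile_mul_rpow α hy]
  have h : (K ^ 2) ^ (α / 2) = K ^ α := by
    rw [← Real.rpow_natCast_mul hK.le]
    congr 1
    push_cast
    ring
  rw [← h]
  refine Real.rpow_le_rpow (by positivity) ?_ (by positivity)
  rw [div_le_iff₀ (decayProfile_base_pos K y)]
  have : K ^ 2 * (1 + y ^ 2 / K ^ 2) = K ^ 2 + y ^ 2 := by field_simp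
  rw [this]
  linarith [sq_nonneg K]

/-- The lower bound does not depend on K ≥ 1. This lets `exists_balance` fix B before K. -/
lemma le_decayProfile_mul_rpow {α : ℝ} (hα : 0 < α) {K y y₀ : ℝ} (hK : 1 ≤ K) (hy₀ : 0 < y₀)
    (hy : y₀ ≤ y) : (y₀ ^ 2 / (1 + y₀ ^ 2)) ^ (α / 2) ≤ decayProfile α K y * y ^ α := by
  rw [decayProfile_mul_rpow α (hy₀.le.trans hy)]
  refine Real.rpow_le_rpow (by positivity) ?_ (by positivity)
  rw [div_le_div_iff₀ (by positivity) (decayProfile_base_pos K y)]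
  have h1 : y ^ 2 / K ^ 2 ≤ y ^ 2 := div_le_self (sq_nonneg y) (one_le_pow₀ hK)
  have h2 : y₀ ^ 2 ≤ y ^ 2 := pow_le_pow_left₀ hy₀.le hy 2
  nlinarith [mul_le_mul_of_nonneg_left h1 (sq_nonneg y₀)]

/-- Source of the small factor 1/K in the error that comes from differentiating `decayProfile`. -/
lemma rpow_mul_div_le (α : ℝ) {K y : ℝ} (hK : 1 ≤ K) (hy : 0 ≤ y) :
    y ^ α * (y / (K ^ 2 + y ^ 2)) ≤ (1 + (y ^ α) ^ 2) / K := by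
  have hK0 : 0 < K := by linarith
  have hP : 0 ≤ y ^ α := Real.rpow_nonneg hy α
  have h1 : y / (K ^ 2 + y ^ 2) ≤ 1 / K := by
    rw [div_le_div_iff₀ (by positivity) hK0]
    nlinarith [sq_nonneg (K - y), sq_nonneg K]
  calc y ^ α * (y / (K ^ 2 + y ^ 2)) ≤ y ^ α * (1 / K) := mul_le_mul_of_nonneg_left h1 hP
    _ ≤ (1 + (y ^ α) ^ 2) * (1 / K) := by
        refine mul_le_mul_of_nonneg_right ?_ (by positivity)
        nlinarith [sq_nonneg (y ^ α - 1)]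
    _ = _ := by ring

/-- The profile `y / √(1 + y²)`. -/
noncomputable def satProfile (y : ℝ) : ℝ := y * decayProfile 1 1 y

lemma contDiff_satProfile : ContDiff ℝ ∞ satProfile := contDiff_id.mul (contDiff_decayProfile 1 1)

/-- The derivative of `satProfile`. -/
noncomputable def satProfileDeriv (y : ℝ) : ℝ := decayProfile 1 1 y / (1 + y ^ 2)

lemma hasDerivAt_satProfile (y : ℝ) : HasDerivAt satProfile (satProfileDeriv y) y := by
  have h := (hasDerivAt_id y).mul (hasDerivAt_decayProfile 1 one_pos y)
  refine h.congr_deriv ?_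
  rw [satProfileDeriv]
  have : (0 : ℝ) < 1 + y ^ 2 := by positivity
  simp only [id]
  field_simp
  ring

lemma satProfileDeriv_nonneg (y : ℝ) : 0 ≤ satProfileDeriv y :=
  div_nonneg (decayProfile_pos 1 1 y).le (by positivity)

lemma satProfile_abs (y : ℝ) : |satProfile y| = satProfile |y| := by
  simp only [satProfile, decayProfile, abs_mul, sq_abs]
  rw [abs_of_pos (Real.rpow_pos_of_pos (decayProfile_base_pos 1 y) _)]

lemma satProfileDeriv_abs (y : ℝ) : satProfileDeriv |y| = satProfileDeriv y := by
  simp only [satProfileDeriv, decayProfile, sq_abs]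

lemma satProfile_nonneg {y : ℝ} (hy : 0 ≤ y) : 0 ≤ satProfile y :=
  mul_nonneg hy (decayProfile_pos 1 1 y).le

lemma satProfile_le_one {y : ℝ} (hy : 0 ≤ y) : satProfile y ≤ 1 := by
  have h := decayProfile_mul_rpow_le one_pos one_pos hy
  simpa [satProfile, mul_comm] using h

lemma satProfile_le_self {y : ℝ} (hy : 0 ≤ y) : satProfile y ≤ y :=
  mul_le_of_le_one_right hy (decayProfile_le_one one_pos 1 y)

/-- Lets the error from differentiating N^κ inside the saturating profile be absorbed by the error
from differentiating e^{-N^p}. -/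
lemma mul_satProfileDeriv_le {y : ℝ} (hy : 0 ≤ y) : y * satProfileDeriv y ≤ satProfile y := by
  rw [satProfileDeriv, satProfile]
  exact mul_le_mul_of_nonneg_left
    (div_le_self (decayProfile_pos 1 1 y).le (by linarith [sq_nonneg y])) hy

lemma satProfileDeriv_ge {y : ℝ} (hy : 0 ≤ y) (hy1 : y ≤ 1) : 1 / 4 ≤ satProfileDeriv y := by
  have hy2 : y ^ 2 ≤ 1 := pow_le_one₀ hy hy1
  have h1 : 1 / 2 ≤ decayProfile 1 1 y := by
    have h2 : (2 : ℝ) ^ (-(1 : ℝ)) ≤ (1 + y ^ 2 / 1 ^ 2) ^ (-(1 : ℝ) / 2) :=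
      calc (2 : ℝ) ^ (-(1 : ℝ)) ≤ (2 : ℝ) ^ (-(1 : ℝ) / 2) :=
            Real.rpow_le_rpow_of_exponent_le one_le_two (by norm_num)
        _ ≤ (1 + y ^ 2 / 1 ^ 2) ^ (-(1 : ℝ) / 2) :=
            Real.rpow_le_rpow_of_nonpos (by positivity) (by simpa using by linarith) (by norm_num)
    rw [Real.rpow_neg_one] at h2
    simpa [decayProfile] using h2
  rw [satProfileDeriv, le_div_iff₀ (by positivity)]
  nlinarith

/-- The balance between the two vector fields, in the scale invariant variable `y`. -/
lemma exists_balance {α c C₂ C₃ C₄ : ℝ} (hα : 0 < α) (hc : 0 < c) (hC₂ : 0 ≤ C₂) (hC₃ : 0 ≤ C₃)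
    (hC₄ : 0 < C₄) : ∃ B K ν₀ : ℝ, 0 < B ∧ 1 ≤ K ∧ 0 < ν₀ ∧ ∀ y ν : ℝ, 0 ≤ y → ν ≤ ν₀ →
      B * (C₂ * (y ^ α) ^ 2 * decayProfile α K y * ν - c * (y ^ α) ^ 2 * decayProfile α K y +
        C₃ * decayProfile α K y * (1 + (y ^ α) ^ 2) / K) - satProfileDeriv y +
        C₄ * satProfile y * y ^ α ≤ -(1 / 8) := by
  -- the threshold below which the first layer field dominates
  obtain ⟨y₀, hy₀, hy₀1, hy₀C⟩ : ∃ y₀ : ℝ, 0 < y₀ ∧ y₀ ≤ 1 ∧ C₄ * (y₀ * y₀ ^ α) ≤ 1 / 16 := by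
    refine ⟨min 1 (1 / (16 * C₄)), by positivity, min_le_left _ _, ?_⟩
    set z := min 1 (1 / (16 * C₄)) with hz
    have hz0 : 0 < z := by positivity
    have h1 : z ^ α ≤ 1 := Real.rpow_le_one hz0.le (min_le_left _ _) hα.le
    calc C₄ * (z * z ^ α) ≤ C₄ * (1 / (16 * C₄) * 1) := by
          gcongr
          exact min_le_right _ _
      _ = 1 / 16 := by field_simp
  set m₀ : ℝ := (y₀ ^ 2 / (1 + y₀ ^ 2)) ^ (α / 2) with hm₀
  have hm₀pos : 0 < m₀ := Real.rpow_pos_of_pos (by positivity) _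
  have hq₀ : 0 < y₀ ^ α := Real.rpow_pos_of_pos hy₀ α
  -- The first summand makes half of the gain of the ∇N field absorb the error C₄ φ(y) y^α for y ≥
  -- y₀; the second leaves at least 1/4 from the other half. m₀ does not involve K.
  set B : ℝ := 4 * C₄ / (c * m₀) + 1 / (c * m₀ * y₀ ^ α) with hB
  have hBpos : 0 < B := by positivity
  have hB1 : C₄ ≤ B * c / 4 * m₀ := by
    have : B * c / 4 * m₀ = C₄ + 1 / (4 * y₀ ^ α) := by
      rw [hB]; field_simp
    rw [this]
    linarith [show 0 < 1 / (4 * y₀ ^ α) by positivity]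
  have hB2 : 1 / 4 ≤ B * c / 4 * (m₀ * y₀ ^ α) := by
    have : B * c / 4 * (m₀ * y₀ ^ α) = C₄ * y₀ ^ α + 1 / 4 := by
      rw [hB]; field_simp
    rw [this]
    linarith [show 0 < C₄ * y₀ ^ α by positivity]
  -- Chosen after B, so that the errors carrying 1/K cost at most a quarter of the gain, plus a
  -- constant 1/16.
  set K : ℝ := 1 + 4 * C₃ / c + 16 * B * C₃ with hK
  have hK1 : 1 ≤ K := by
    have : 0 ≤ 4 * C₃ / c + 16 * B * C₃ := by positivity
    linarith
  have hK0 : 0 < K := by linarith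
  have hKc : C₃ / K ≤ c / 4 := by
    rw [div_le_iff₀ hK0]
    have : c / 4 * K = c / 4 + C₃ + 4 * c * B * C₃ := by rw [hK]; field_simp; ring
    rw [this]
    linarith [show 0 ≤ 4 * c * B * C₃ by positivity]
  have hKB : B * (C₃ / K) ≤ 1 / 16 := by
    rw [mul_div_assoc', div_le_iff₀ hK0]
    have : (0 : ℝ) ≤ 4 * C₃ / c := by positivity
    nlinarith
  refine ⟨B, K, c / (4 * (C₂ + 1)), hBpos, hK1, by positivity, fun y ν hy hν => ?_⟩
  set P := y ^ α with hP
  set E := decayProfile α K y with hE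
  have hP0 : 0 ≤ P := Real.rpow_nonneg hy α
  have hE0 : 0 < E := decayProfile_pos α K y
  have hE1 : E ≤ 1 := decayProfile_le_one hα K y
  have hν' : C₂ * ν ≤ c / 4 := by
    calc C₂ * ν ≤ C₂ * (c / (4 * (C₂ + 1))) := mul_le_mul_of_nonneg_left hν hC₂
      _ ≤ c / 4 := by
          rw [mul_div_assoc', div_le_div_iff₀ (by positivity) (by norm_num)]
          nlinarith
  have hPE : 0 ≤ P ^ 2 * E := by positivity
  have main : B * (C₂ * P ^ 2 * E * ν - c * P ^ 2 * E + C₃ * E * (1 + P ^ 2) / K) ≤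
      -(B * c / 2 * (P ^ 2 * E)) + 1 / 16 := by
    have e1 : C₂ * P ^ 2 * E * ν - c * P ^ 2 * E + C₃ * E * (1 + P ^ 2) / K =
        (C₂ * ν) * (P ^ 2 * E) - c * (P ^ 2 * E) + C₃ / K * (P ^ 2 * E) + C₃ / K * E := by ring
    have h1 : (C₂ * ν) * (P ^ 2 * E) ≤ c / 4 * (P ^ 2 * E) := mul_le_mul_of_nonneg_right hν' hPE
    have h2 : C₃ / K * (P ^ 2 * E) ≤ c / 4 * (P ^ 2 * E) := mul_le_mul_of_nonneg_right hKc hPE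
    have h3 : C₃ / K * E ≤ C₃ / K := mul_le_of_le_one_right (by positivity) hE1
    have h4 : C₂ * P ^ 2 * E * ν - c * P ^ 2 * E + C₃ * E * (1 + P ^ 2) / K ≤
        -(c / 2 * (P ^ 2 * E)) + C₃ / K := by rw [e1]; linarith
    have h5 := mul_le_mul_of_nonneg_left h4 hBpos.le
    have h6 : B * (-(c / 2 * (P ^ 2 * E)) + C₃ / K) =
        -(B * c / 2 * (P ^ 2 * E)) + B * (C₃ / K) := by ring
    linarith
  have hφ0 : 0 ≤ satProfile y := satProfile_nonneg hy
  -- For y ≤ y₀ the derivative φ'(y) ≥ 1/4 pays for two errors of size 1/16. For y > y₀ that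
  -- derivative is only known to be nonnegative, and the gain y^{2α} E of the ∇N field pays for
  -- everything.
  rcases le_or_gt y y₀ with hyy | hyy
  · have h1 := satProfileDeriv_ge hy (hyy.trans hy₀1)
    have h2 : C₄ * satProfile y * P ≤ 1 / 16 := by
      refine le_trans ?_ hy₀C
      rw [mul_assoc]
      have : P ≤ y₀ ^ α := Real.rpow_le_rpow hy hyy hα.le
      have h3 : satProfile y ≤ y₀ := (satProfile_le_self hy).trans hyy
      gcongr
    have h3 : 0 ≤ B * c / 2 * (P ^ 2 * E) := by positivity
    linarith
  · have h1 := satProfileDeriv_nonneg y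
    have hm : m₀ ≤ E * P := le_decayProfile_mul_rpow hα hK1 hy₀ hyy.le
    have hPy : y₀ ^ α ≤ P := Real.rpow_le_rpow hy₀.le hyy.le hα.le
    have h2 : C₄ * satProfile y * P ≤ B * c / 4 * (P ^ 2 * E) := by
      calc C₄ * satProfile y * P ≤ C₄ * 1 * P := by
            gcongr
            exact satProfile_le_one hy
        _ ≤ (B * c / 4 * m₀) * P := by rw [mul_one]; gcongr
        _ ≤ (B * c / 4 * (E * P)) * P := by gcongr
        _ = _ := by ring
    have h3 : 1 / 4 ≤ B * c / 4 * (P ^ 2 * E) := by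
      refine hB2.trans ?_
      have : m₀ * y₀ ^ α ≤ (E * P) * P := mul_le_mul hm hPy hq₀.le (by positivity)
      calc B * c / 4 * (m₀ * y₀ ^ α) ≤ B * c / 4 * ((E * P) * P) := by gcongr
        _ = _ := by ring
    linarith

/-! ### The pointwise estimate behind the U-bound. -/

lemma Rn.abs_sum_mul_le {l : ℕ} (a b : Rn l) : |∑ i, a i * b i| ≤ ‖a‖ * ‖b‖ := by
  have h := abs_real_inner_le_norm a b
  rw [PiLp.inner_apply] at h
  simpa [mul_comm] using h

lemma Rn.sum_mul_self {l : ℕ} (a : Rn l) : ∑ i, a i * a i = ‖a‖ ^ 2 := by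
  rw [EuclideanSpace.real_norm_sq_eq]
  exact Finset.sum_congr rfl fun i _ => by ring

lemma Rn.abs_apply_le {l : ℕ} (a : Rn l) (i : Fin l) : |a i| ≤ ‖a‖ := PiLp.norm_apply_le a i

set_option maxHeartbeats 1000000 in
/-- The pointwise estimate behind the `U`-bound: `a`, `g`, `h` are the values of the gradients of
`N`, `f` and `|x|`, and `t`, `s`, `z` those of `N`, `x` and `|x|`. -/
lemma pointwise_bound {l : ℕ} {a g h : Rn l} (j : Fin l) {α κ p C K B t s z f : ℝ}
    (hα : 0 < α) (hκ : 0 ≤ κ) (hp : p = (α + 1) * (κ + 1)) (hC : 1 ≤ C) (hK : 1 ≤ K) (hB : 0 ≤ B)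
    (ht : 1 ≤ t) (hz : z = |s|) (hf : 0 ≤ f) (ha1 : z ^ α / t ^ α ≤ C * ‖a‖)
    (ha2 : ‖a‖ ≤ C * (z ^ α / t ^ α)) (hh : ‖h‖ ≤ C) :
    B * (C * (z ^ (2 * α) / t ^ (2 * α + 1) * (f * (t ^ (α * (1 + κ)) *
        decayProfile α K (z * t ^ κ)))) +
      ∑ i, a i * ((t ^ (α * (1 + κ)) * decayProfile α K (z * t ^ κ)) * g i +
        f * (decayProfile α K (z * t ^ κ) * (α * (1 + κ) * t ^ (α * (1 + κ) - 1) -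
            p * t ^ (p - 1) * t ^ (α * (1 + κ))) * a i +
          t ^ (α * (1 + κ)) * (-(α * (z * t ^ κ) / (K ^ 2 + (z * t ^ κ) ^ 2) *
            decayProfile α K (z * t ^ κ)) * (t ^ κ * h i + z * (κ * t ^ (κ - 1)) * a i))))) -
      (satProfile (s * t ^ κ) * g j + f * (satProfile (s * t ^ κ) * (-(p * t ^ (p - 1))) * a j +
        satProfileDeriv (s * t ^ κ) * (t ^ κ * 1 + s * (κ * t ^ (κ - 1)) * a j))) ≤
    (B * C * K ^ α + 1) * ‖g‖ + f * t ^ κ *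
      (B * ((C + α * (1 + κ) * C ^ 2) * ((z * t ^ κ) ^ α) ^ 2 * decayProfile α K (z * t ^ κ) *
          t ^ (-p) - p / C ^ 2 * ((z * t ^ κ) ^ α) ^ 2 * decayProfile α K (z * t ^ κ) +
        C ^ 2 * α * decayProfile α K (z * t ^ κ) * (1 + ((z * t ^ κ) ^ α) ^ 2) / K) -
        satProfileDeriv (z * t ^ κ) + (p + κ) * C * satProfile (z * t ^ κ) * (z * t ^ κ) ^ α) := by
  have ht0 : 0 < t := by linarith
  have hz0 : 0 ≤ z := hz ▸ abs_nonneg s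
  have hp0 : 0 < p := by rw [hp]; positivity
  set S := t ^ κ with hS
  have hS0 : 0 < S := Real.rpow_pos_of_pos ht0 _
  set y := z * S with hy
  have hy0 : 0 ≤ y := mul_nonneg hz0 hS0.le
  set P := y ^ α with hP
  have hP0 : 0 ≤ P := Real.rpow_nonneg hy0 _
  set E := decayProfile α K y with hE
  have hE0 : 0 < E := decayProfile_pos _ _ _
  set b := z ^ α / t ^ α with hb
  have hb0 : 0 ≤ b := div_nonneg (Real.rpow_nonneg hz0 _) (Real.rpow_nonneg ht0.le _)
  set A := t ^ (α * (1 + κ)) with hA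
  have hA0 : 0 < A := Real.rpow_pos_of_pos ht0 _
  set ν := t ^ (-p) with hν
  have hν0 : 0 < ν := Real.rpow_pos_of_pos ht0 _
  have hν1 : ν ≤ 1 := Real.rpow_le_one_of_one_le_of_nonpos ht (by linarith)
  set T := t ^ (p - 1) with hT
  have hT0 : 0 < T := Real.rpow_pos_of_pos ht0 _
  have hPz : P = z ^ α * t ^ (κ * α) := by
    rw [hP, hy, Real.mul_rpow hz0 hS0.le, hS, ← Real.rpow_mul ht0.le]
  -- Here b is the size of |∇N|. The exponents are tuned so that every product reduces to P = y^α,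
  -- to S = N^κ and to ν = N^{-p}. The second and third identities are where p = (α + 1)(κ + 1) is
  -- needed.
  have I1 : A * b = P := by
    rw [hA, hb, hPz, mul_add, mul_one, Real.rpow_add ht0, mul_comm κ α]
    have := Real.rpow_pos_of_pos ht0 α
    field_simp
  have I2 : b * T = P * S := by
    rw [hb, hT, hPz, hS, div_eq_mul_inv, ← Real.rpow_neg ht0.le, mul_assoc, mul_assoc,
      ← Real.rpow_add ht0, ← Real.rpow_add ht0]
    congr 2
    rw [hp]; ring
  have I3 : b / t = P * S * ν := by
    rw [hb, hν, hPz, hS, div_eq_mul_inv, div_eq_mul_inv, ← Real.rpow_neg ht0.le,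
      ← Real.rpow_neg_one t, mul_assoc, mul_assoc, mul_assoc, ← Real.rpow_add ht0,
      ← Real.rpow_add ht0, ← Real.rpow_add ht0]
    congr 2
    rw [hp]; ring
  have I4 : z ^ (2 * α) / t ^ (2 * α + 1) = b * (b / t) := by
    rw [hb, Real.rpow_add ht0, Real.rpow_one, mul_comm 2 α, Real.rpow_mul hz0,
      Real.rpow_mul ht0.le]
    simp only [Real.rpow_two]
    field_simp
  have I5 : t ^ (α * (1 + κ) - 1) = A / t := by rw [Real.rpow_sub_one ht0.ne']
  have I6 : t ^ (κ - 1) = S / t := by rw [Real.rpow_sub_one ht0.ne']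
  have hna := norm_nonneg a
  have hng := norm_nonneg g
  have hAa : A * ‖a‖ ≤ C * P := by
    calc A * ‖a‖ ≤ A * (C * b) := by gcongr
      _ = C * (A * b) := by ring
      _ = C * P := by rw [I1]
  have hφ0 : 0 ≤ satProfile y := satProfile_nonneg hy0
  have hφabs : |satProfile (s * S)| = satProfile y := by
    rw [satProfile_abs, abs_mul, abs_of_pos hS0, ← hz]
  have hφd : satProfileDeriv (s * S) = satProfileDeriv y := by
    rw [← satProfileDeriv_abs, abs_mul, abs_of_pos hS0, ← hz]
  have hφd0 := satProfileDeriv_nonneg y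
  have haj : |a j| ≤ C * b := (Rn.abs_apply_le a j).trans ha2
  have hag := le_of_abs_le (Rn.abs_sum_mul_le a g)
  have hah := (Rn.abs_sum_mul_le a h)
  rw [I4, I5, I6, hφd]
  have esum : ∑ i, a i * (A * E * g i + f * (E * (α * (1 + κ) * (A / t) - p * T * A) * a i +
      A * (-(α * y / (K ^ 2 + y ^ 2) * E) * (S * h i + z * (κ * (S / t)) * a i)))) =
      A * E * (∑ i, a i * g i) + f * (E * (α * (1 + κ) * (A / t) - p * T * A) * ‖a‖ ^ 2 +
        A * (-(α * y / (K ^ 2 + y ^ 2) * E) * (S * (∑ i, a i * h i) +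
          z * (κ * (S / t)) * ‖a‖ ^ 2))) := by
    rw [← Rn.sum_mul_self]
    simp only [Finset.mul_sum, ← Finset.sum_add_distrib]
    exact Finset.sum_congr rfl fun i _ => by ring
  rw [esum]
  -- first order terms
  have t1 : A * E * (∑ i, a i * g i) ≤ C * K ^ α * ‖g‖ := by
    calc A * E * (∑ i, a i * g i) ≤ A * E * (‖a‖ * ‖g‖) := by gcongr
      _ = (A * ‖a‖) * E * ‖g‖ := by ring
      _ ≤ (C * P) * E * ‖g‖ := by gcongr
      _ = C * (E * P) * ‖g‖ := by ring
      _ ≤ C * K ^ α * ‖g‖ := by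
          gcongr
          exact decayProfile_mul_rpow_le hα (by linarith) hy0
  have t1' : -(satProfile (s * S) * g j) ≤ ‖g‖ := by
    refine (neg_le_abs _).trans ?_
    rw [abs_mul, hφabs]
    calc satProfile y * |g j| ≤ 1 * ‖g‖ :=
          mul_le_mul (satProfile_le_one hy0) (Rn.abs_apply_le g j) (abs_nonneg _) zero_le_one
      _ = ‖g‖ := one_mul _
  -- zeroth order terms
  have t0 : b * (b / t) * A = P ^ 2 * S * ν := by
    calc b * (b / t) * A = (A * b) * (b / t) := by ring
      _ = _ := by rw [I1, I3]; ring
  have hCb : b ^ 2 ≤ C ^ 2 * ‖a‖ ^ 2 := by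
    rw [← mul_pow]
    exact pow_le_pow_left₀ hb0 ha1 2
  have hCa : ‖a‖ ^ 2 ≤ C ^ 2 * b ^ 2 := by
    rw [← mul_pow]
    exact pow_le_pow_left₀ hna ha2 2
  have t2 : (A / t) * ‖a‖ ^ 2 ≤ C ^ 2 * (P ^ 2 * S * ν) := by
    calc (A / t) * ‖a‖ ^ 2 ≤ (A / t) * (C ^ 2 * b ^ 2) := by gcongr
      _ = C ^ 2 * (b * (b / t) * A) := by ring
      _ = _ := by rw [t0]
  have t3 : P ^ 2 * S / C ^ 2 ≤ T * A * ‖a‖ ^ 2 := by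
    rw [div_le_iff₀ (by positivity)]
    calc P ^ 2 * S = T * A * b ^ 2 := by
          rw [show T * A * b ^ 2 = (A * b) * (b * T) by ring, I1, I2]; ring
      _ ≤ T * A * (C ^ 2 * ‖a‖ ^ 2) := by gcongr
      _ = _ := by ring
  have t23 : E * (α * (1 + κ) * (A / t) - p * T * A) * ‖a‖ ^ 2 ≤
      S * (α * (1 + κ) * C ^ 2 * P ^ 2 * E * ν - p / C ^ 2 * P ^ 2 * E) := by
    have e1 : E * (α * (1 + κ) * (A / t) - p * T * A) * ‖a‖ ^ 2 =
        E * (α * (1 + κ)) * ((A / t) * ‖a‖ ^ 2) - E * p * (T * A * ‖a‖ ^ 2) := by ring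
    have e2 : S * (α * (1 + κ) * C ^ 2 * P ^ 2 * E * ν - p / C ^ 2 * P ^ 2 * E) =
        E * (α * (1 + κ)) * (C ^ 2 * (P ^ 2 * S * ν)) - E * p * (P ^ 2 * S / C ^ 2) := by ring
    rw [e1, e2]
    gcongr
  -- `decayProfile` decreases, so the part containing ‖a‖² has the good sign and is dropped. The
  -- part containing a · h is bounded by Cauchy–Schwarz and gains the factor 1/K.
  have t4 : A * (-(α * y / (K ^ 2 + y ^ 2) * E) * (S * (∑ i, a i * h i) +
      z * (κ * (S / t)) * ‖a‖ ^ 2)) ≤ S * (C ^ 2 * α * E * (1 + P ^ 2) / K) := by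
    have h1 : 0 ≤ α * y / (K ^ 2 + y ^ 2) * E := by positivity
    have h2 : 0 ≤ z * (κ * (S / t)) * ‖a‖ ^ 2 := by positivity
    have h3 : A * -(∑ i, a i * h i) ≤ C * P * C := by
      calc A * -(∑ i, a i * h i) ≤ A * (‖a‖ * ‖h‖) := by
            gcongr
            exact (neg_le_abs _).trans hah
        _ = (A * ‖a‖) * ‖h‖ := by ring
        _ ≤ C * P * C := by gcongr
    calc A * (-(α * y / (K ^ 2 + y ^ 2) * E) * (S * (∑ i, a i * h i) +
          z * (κ * (S / t)) * ‖a‖ ^ 2))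
        = (α * y / (K ^ 2 + y ^ 2) * E) * S * (A * -(∑ i, a i * h i)) -
          A * (α * y / (K ^ 2 + y ^ 2) * E) * (z * (κ * (S / t)) * ‖a‖ ^ 2) := by ring
      _ ≤ (α * y / (K ^ 2 + y ^ 2) * E) * S * (C * P * C) - 0 := by
          gcongr
          positivity
      _ = S * C ^ 2 * α * E * (P * (y / (K ^ 2 + y ^ 2))) := by ring
      _ ≤ S * C ^ 2 * α * E * ((1 + P ^ 2) / K) := by
          gcongr
          exact rpow_mul_div_le α hK hy0
      _ = _ := by ring
  have t5 : satProfile (s * S) * (p * T) * a j ≤ p * C * satProfile y * P * S := by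
    calc satProfile (s * S) * (p * T) * a j ≤ |satProfile (s * S) * (p * T) * a j| := le_abs_self _
      _ = satProfile y * (p * T) * |a j| := by
          rw [abs_mul, abs_mul, hφabs, abs_of_pos (mul_pos hp0 hT0)]
      _ ≤ satProfile y * (p * T) * (C * b) := by gcongr
      _ = p * C * satProfile y * (b * T) := by ring
      _ = _ := by rw [I2]; ring
  -- Using ν ≤ 1 and y φ'(y) ≤ φ(y), this error takes the same form as the preceding one; together
  -- they give the coefficient p + κ.
  have t6 : -(satProfileDeriv y * (s * (κ * (S / t)) * a j)) ≤ κ * C * satProfile y * P * S := by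
    calc -(satProfileDeriv y * (s * (κ * (S / t)) * a j))
        ≤ |satProfileDeriv y * (s * (κ * (S / t)) * a j)| := neg_le_abs _
      _ = satProfileDeriv y * (z * (κ * (S / t)) * |a j|) := by
          have h0 : 0 ≤ κ * (S / t) := by positivity
          rw [abs_mul, abs_mul, abs_mul, abs_of_nonneg hφd0, ← hz, abs_of_nonneg h0]
      _ ≤ satProfileDeriv y * (z * (κ * (S / t)) * (C * b)) := by gcongr
      _ = κ * C * (y * satProfileDeriv y) * (b / t) := by rw [hy]; ring
      _ = κ * C * (y * satProfileDeriv y) * (P * S) * ν := by rw [I3]; ring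
      _ ≤ κ * C * (y * satProfileDeriv y) * (P * S) * 1 := by gcongr
      _ ≤ κ * C * satProfile y * (P * S) * 1 := by
          have := mul_satProfileDeriv_le hy0
          gcongr
      _ = _ := by ring
  have z1 : E * (α * (1 + κ) * (A / t) - p * T * A) * ‖a‖ ^ 2 +
      A * (-(α * y / (K ^ 2 + y ^ 2) * E) * (S * (∑ i, a i * h i) +
        z * (κ * (S / t)) * ‖a‖ ^ 2)) + C * (b * (b / t) * A) * E ≤
      S * ((C + α * (1 + κ) * C ^ 2) * P ^ 2 * E * ν - p / C ^ 2 * P ^ 2 * E +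
        C ^ 2 * α * E * (1 + P ^ 2) / K) := by
    rw [t0]
    have : S * ((C + α * (1 + κ) * C ^ 2) * P ^ 2 * E * ν - p / C ^ 2 * P ^ 2 * E +
        C ^ 2 * α * E * (1 + P ^ 2) / K) =
        S * (α * (1 + κ) * C ^ 2 * P ^ 2 * E * ν - p / C ^ 2 * P ^ 2 * E) +
        S * (C ^ 2 * α * E * (1 + P ^ 2) / K) + C * (P ^ 2 * S * ν) * E := by ring
    linarith
  have z2 := mul_le_mul_of_nonneg_left z1 (mul_nonneg hf hB)
  have z3 := mul_le_mul_of_nonneg_left (add_le_add t5 t6) hf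
  have z4 := mul_le_mul_of_nonneg_left t1 hB
  clear_value P E A S T ν y b
  generalize (∑ i, a i * h i) = ah at *
  generalize (∑ i, a i * g i) = ag at *
  linarith [z2, z3, z4, t1']

/-! ### Functions with locally bounded weak subgradient. -/

lemma IsLocBdd.integrable_of_closedBall {F : Rn n → ℝ} (h : IsLocBdd F)
    (hm : AEStronglyMeasurable F volume) {R : ℝ}
    (hR : ∀ᵐ ξ, ξ ∉ Metric.closedBall (0 : Rn n) R → F ξ = 0) : Integrable F :=
  ((h.locallyIntegrable hm).integrableOn_isCompact
    (isCompact_closedBall (0 : Rn n) R)).integrable_of_ae_notMem_eq_zero hR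

/-- `f` is continuous with the locally bounded weak subgradient `G`. -/
def HasLipGrad {l : ℕ} (X : Fin l → Rn n → Rn n) (f : Rn n → ℝ) (G : Rn n → Rn l) : Prop :=
  ∀ i, HasLipDeriv (X i) f fun ξ => G ξ i

namespace HasLipGrad

variable {l : ℕ} {X : Fin l → Rn n → Rn n} {f : Rn n → ℝ} {G : Rn n → Rn l}

lemma aestronglyMeasurable (h : HasLipGrad X f G) : AEStronglyMeasurable G volume := by
  have h1 : G = fun ξ => ∑ i, G ξ i • EuclideanSpace.single i (1 : ℝ) := by
    ext1 ξ
    rw [Rn.sum_single]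
  rw [h1]
  exact Finset.aestronglyMeasurable_fun_sum _ fun i _ =>
    (h i).aestronglyMeasurable.smul_const _

lemma isLocBdd_norm (h : HasLipGrad X f G) : IsLocBdd fun ξ => ‖G ξ‖ := by
  intro R
  choose M hM using fun i => (h i).locBdd R
  refine ⟨∑ i, M i, ?_⟩
  filter_upwards [eventually_all.2 hM] with ξ h1 hR
  rw [abs_of_nonneg (norm_nonneg _)]
  conv_lhs => rw [← Rn.sum_single (G ξ)]
  refine (norm_sum_le _ _).trans (Finset.sum_le_sum fun i _ => ?_)
  rw [norm_smul]
  simpa using h1 i hR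

lemma ae_eq_zero (h : HasLipGrad X f G) {O : Set (Rn n)} (hO : IsOpen O)
    (hf : ∀ ξ ∈ O, f ξ = 0) : ∀ᵐ ξ, ξ ∈ O → G ξ = 0 := by
  filter_upwards [eventually_all.2 fun i => (h i).weak.ae_eq_zero hO hf] with ξ h1 hξ
  ext i
  exact h1 i hξ

lemma integrable_norm_mul (h : HasLipGrad X f G) (hc : HasCompactSupport f) {w : Rn n → ℝ}
    (hw : Continuous w) : Integrable fun ξ => ‖G ξ‖ * w ξ := by
  obtain ⟨R, hR⟩ := hc.exists_closedBall
  refine (h.isLocBdd_norm.mul hw.isLocBdd).integrable_of_closedBall (R := R)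
    (h.aestronglyMeasurable.norm.mul hw.aestronglyMeasurable) ?_
  filter_upwards [h.ae_eq_zero Metric.isClosed_closedBall.isOpen_compl fun ξ hξ =>
    image_eq_zero_of_notMem_tsupport (hR ξ hξ)] with ξ h1 hξ
  simp [h1 hξ]

lemma mul (hX : ∀ i, IsRegularField (X i)) (hf : HasLipGrad X f G) {g : Rn n → ℝ}
    {H : Rn n → Rn l} (hg : HasLipGrad X g H) :
    HasLipGrad X (fun ξ => f ξ * g ξ) fun ξ => g ξ • G ξ + f ξ • H ξ :=
  fun i => by simpa using (hf i).mul (hX i) (hg i)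

lemma comp (hX : ∀ i, IsRegularField (X i)) (hf : HasLipGrad X f G) {ψ ψ' : ℝ → ℝ}
    (hψ : ContDiff ℝ ∞ ψ) (hψ' : ∀ t, HasDerivAt ψ (ψ' t) t) :
    HasLipGrad X (fun ξ => ψ (f ξ)) fun ξ => ψ' (f ξ) • G ξ :=
  fun i => by simpa using (hf i).comp (hX i) hψ hψ'

end HasLipGrad

/-! ### The gauge and its U-bound. -/

/-- The standing assumptions on the gauge `N` and on the first coordinate, with one constant. -/
structure IsGauge {m l : ℕ} (X : Fin l → Rn (m + 1) → Rn (m + 1)) (N : Rn (m + 1) → ℝ)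
    (α p C : ℝ) (GN Gx : Rn (m + 1) → Rn l) (j : Fin l) : Prop where
  regular : ∀ i, IsRegularField (X i)
  alpha_pos : 0 < α
  le_p : α + 1 ≤ p
  one_le : 1 ≤ C
  nonneg : ∀ ξ, 0 ≤ N ξ
  pos : ∀ ξ, ξ ≠ 0 → 0 < N ξ
  zero : N 0 = 0
  continuous : Continuous N
  abs_le : ∀ ξ, |ξ 0| ≤ C * N ξ
  gradN : HasLipGrad X N GN
  gradx : HasLipGrad X (fun ξ => |ξ 0|) Gx
  deriv_x : HasLipDeriv (X j) (fun ξ => ξ 0) fun _ => 1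
  lower : ∀ᵐ ξ, |ξ 0| ^ α / N ξ ^ α ≤ C * ‖GN ξ‖
  upper : ∀ᵐ ξ, ‖GN ξ‖ ≤ C * (|ξ 0| ^ α / N ξ ^ α)
  gradx_le : ∀ᵐ ξ, ‖Gx ξ‖ ≤ C
  laplacian : ∀ φ, IsTestFunction {0}ᶜ φ → (∀ ξ, 0 ≤ φ ξ) →
    -∫ ξ, ∑ i, GN ξ i * fieldDeriv (X i) φ ξ ≤
      C * ∫ ξ, |ξ 0| ^ (2 * α) / N ξ ^ (2 * α + 1) * φ ξ

/-- The exponent of the `U`-bound. -/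
noncomputable def gaugeExp (α p : ℝ) : ℝ := (p - 1 - α) / (α + 1)

/-- The unnormalized density `e^{-N^p}`. -/
noncomputable def gaugeWeight (N : Rn n → ℝ) (p : ℝ) (ξ : Rn n) : ℝ := Real.exp (-(N ξ) ^ p)

lemma gaugeWeight_pos (N : Rn n → ℝ) (p : ℝ) (ξ : Rn n) : 0 < gaugeWeight N p ξ := Real.exp_pos _

/-- The zeroth order coefficient in the pointwise estimate is negative for large gauge. -/
lemma exists_coefficient_bound {α κ p C : ℝ} (hα : 0 < α) (hκ : 0 ≤ κ)
    (hp : p = (α + 1) * (κ + 1)) (hC : 1 ≤ C) : ∃ B K R M : ℝ, 0 < B ∧ 1 ≤ K ∧ 1 ≤ R ∧ 0 ≤ M ∧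
    ∀ t z : ℝ, 1 ≤ t → 0 ≤ z → z ≤ C * t →
      (B * ((C + α * (1 + κ) * C ^ 2) * ((z * t ^ κ) ^ α) ^ 2 * decayProfile α K (z * t ^ κ) *
          t ^ (-p) - p / C ^ 2 * ((z * t ^ κ) ^ α) ^ 2 * decayProfile α K (z * t ^ κ) +
        C ^ 2 * α * decayProfile α K (z * t ^ κ) * (1 + ((z * t ^ κ) ^ α) ^ 2) / K) -
        satProfileDeriv (z * t ^ κ) + (p + κ) * C * satProfile (z * t ^ κ) * (z * t ^ κ) ^ α) ≤
      -(1 / 8) + (if t ≤ R then M else 0) := by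
  have hp0 : 0 < p := by rw [hp]; positivity
  have hC0 : 0 < C := by linarith
  obtain ⟨B, K, ν₀, hB, hK, hν₀, hbal⟩ := exists_balance (α := α) (c := p / C ^ 2)
    (C₂ := C + α * (1 + κ) * C ^ 2) (C₃ := C ^ 2 * α) (C₄ := (p + κ) * C) hα (by positivity)
    (by positivity) (by positivity) (by positivity)
  -- The balance needs ν = t^{-p} to be small, which holds beyond R₀. Below, only a crude bound is
  -- available and M records it.
  obtain ⟨R₀, hR₀⟩ := ((tendsto_rpow_neg_atTop hp0).eventually_le_const hν₀).exists_forall_of_atTop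
  set R := max 1 R₀ with hR
  set Y := (C * R * R ^ κ) ^ α with hY
  have hR1 : 1 ≤ R := le_max_left _ _
  have hY0 : 0 ≤ Y := by positivity
  have hK0 : 0 < K := by linarith
  -- For t ≤ R the condition z ≤ C t gives y^α ≤ Y. M is the sum of the resulting bounds, and its
  -- final 1/8 cancels the -1/8.
  refine ⟨B, K, R, B * ((C + α * (1 + κ) * C ^ 2) * Y ^ 2 + C ^ 2 * α * (1 + Y ^ 2)) +
    (p + κ) * C * Y + 1 / 8, hB, hK, hR1, by positivity, fun t z ht hz hzt => ?_⟩
  have ht0 : 0 < t := by linarith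
  have hy0 : 0 ≤ z * t ^ κ := mul_nonneg hz (Real.rpow_nonneg ht0.le _)
  split_ifs with htR
  · set y := z * t ^ κ with hy
    have hP : y ^ α ≤ Y := by
      refine Real.rpow_le_rpow hy0 ?_ hα.le
      have h1 : t ^ κ ≤ R ^ κ := Real.rpow_le_rpow ht0.le htR hκ
      have h2 : z ≤ C * R := hzt.trans (mul_le_mul_of_nonneg_left htR hC0.le)
      exact mul_le_mul h2 h1 (Real.rpow_nonneg ht0.le _) (by positivity)
    have hP0 : 0 ≤ y ^ α := Real.rpow_nonneg hy0 _
    have hP2 : (y ^ α) ^ 2 ≤ Y ^ 2 := pow_le_pow_left₀ hP0 hP 2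
    have hE0 := decayProfile_pos α K y
    have hE1 := decayProfile_le_one hα K y
    have hν : t ^ (-p) ≤ 1 := Real.rpow_le_one_of_one_le_of_nonpos ht (by linarith)
    have hν0 : 0 < t ^ (-p) := Real.rpow_pos_of_pos ht0 _
    have b1 : (C + α * (1 + κ) * C ^ 2) * (y ^ α) ^ 2 * decayProfile α K y * t ^ (-p) ≤
        (C + α * (1 + κ) * C ^ 2) * Y ^ 2 * 1 * 1 := by gcongr
    have b2 : 0 ≤ p / C ^ 2 * (y ^ α) ^ 2 * decayProfile α K y := by positivity
    have b3 : C ^ 2 * α * decayProfile α K y * (1 + (y ^ α) ^ 2) / K ≤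
        C ^ 2 * α * 1 * (1 + Y ^ 2) / 1 := by gcongr
    have b4 : (p + κ) * C * satProfile y * y ^ α ≤ (p + κ) * C * 1 * Y := by
      have h1 := satProfile_le_one hy0
      have h2 := satProfile_nonneg hy0
      gcongr
    have b5 := satProfileDeriv_nonneg y
    have b6 := mul_le_mul_of_nonneg_left (add_le_add (sub_le_sub b1 b2) b3) hB.le
    linarith
  · have h1 := hbal (z * t ^ κ) (t ^ (-p)) hy0
      (hR₀ t ((le_max_right 1 R₀).trans (not_le.1 htR).le))
    rw [add_zero]
    exact h1

/-- The `U`-bound, for functions supported away from the origin. -/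
theorem IsGauge.exists_uBound_of_support {m l : ℕ} {X : Fin l → Rn (m + 1) → Rn (m + 1)}
    {N : Rn (m + 1) → ℝ} {α p C : ℝ} {GN Gx : Rn (m + 1) → Rn l} {j : Fin l}
    (hg : IsGauge X N α p C GN Gx j) : ∃ C₁ R : ℝ, 0 < C₁ ∧ 1 ≤ R ∧
    ∀ (f : Rn (m + 1) → ℝ) (G : Rn (m + 1) → Rn l), HasLipGrad X f G → HasCompactSupport f →
      (∀ ξ, 0 ≤ f ξ) → (∀ ξ, N ξ < 1 → f ξ = 0) →
      ∫ ξ, f ξ * N ξ ^ gaugeExp α p * gaugeWeight N p ξ ≤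
        C₁ * (∫ ξ, ‖G ξ‖ * gaugeWeight N p ξ) +
        C₁ * ∫ ξ in {ξ | N ξ ≤ R}, f ξ * gaugeWeight N p ξ := by
  have hα := hg.alpha_pos
  set κ := gaugeExp α p with hκdef
  have hκ : 0 ≤ κ := div_nonneg (by linarith [hg.le_p]) (by linarith)
  have hp : p = (α + 1) * (κ + 1) := by
    rw [hκdef, gaugeExp]
    field_simp
    ring
  have hp0 : 0 < p := by linarith [hg.le_p]
  have hC := hg.one_le
  obtain ⟨B, K, R, M, hB, hK, hR, hM, hcoef⟩ := exists_coefficient_bound hα hκ hp hC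
  -- Replacing N by θ(N) makes all powers smooth functions of N, as the chain rule requires. Nothing
  -- changes where N ≥ 1, which is where f lives.
  obtain ⟨θ, hθ, hθpos, hθ1, -⟩ := exists_smooth_positive_id
  have hK0 : 0 < K := by linarith
  have hθd : ∀ t, HasDerivAt θ (deriv θ t) t := fun t =>
    (hθ.differentiable (by simp) t).hasDerivAt
  have hθpow : ∀ q : ℝ, ContDiff ℝ ∞ fun t => θ t ^ q := fun q =>
    hθ.rpow_const_of_ne fun t => (hθpos t).ne'
  have hθpowd : ∀ q t : ℝ, HasDerivAt (fun t => θ t ^ q) (deriv θ t * q * θ t ^ (q - 1)) t :=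
    fun q t => (hθd t).rpow_const (Or.inl (hθpos t).ne')
  have hD : ContDiff ℝ ∞ fun t => Real.exp (-θ t ^ p) := ((hθpow p).neg).exp
  have hDd : ∀ t, HasDerivAt (fun t => Real.exp (-θ t ^ p))
      (Real.exp (-θ t ^ p) * -(deriv θ t * p * θ t ^ (p - 1))) t := fun t => (hθpowd p t).neg.exp
  -- With this power N^q |∇N| is at most a multiple of y^α, so multiplication by `decayProfile`
  -- makes the field bounded.
  set q := α * (1 + κ) with hq
  have hA : ContDiff ℝ ∞ fun t => θ t ^ q * Real.exp (-θ t ^ p) := (hθpow q).mul hD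
  have hAd : ∀ t, HasDerivAt (fun t => θ t ^ q * Real.exp (-θ t ^ p))
      (deriv θ t * q * θ t ^ (q - 1) * Real.exp (-θ t ^ p) +
        θ t ^ q * (Real.exp (-θ t ^ p) * -(deriv θ t * p * θ t ^ (p - 1)))) t := fun t =>
    (hθpowd q t).mul (hDd t)
  -- The factor 8 inverts the coefficient 1/8 gained in the pointwise estimate.
  set C₀ := 8 * (B * C * K ^ α + 1) with hC₀
  have hC₀pos : 0 < C₀ := by positivity
  set C₁ := C₀ + 8 * (R ^ κ * M) with hC₁
  have hRκ : 0 ≤ R ^ κ * M := by positivity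
  refine ⟨C₁, R, by positivity, hR, fun f G hf hfc hf0 hfN => ?_⟩
  have hreg := hg.regular
  have hfcont : Continuous f := (hf j).continuous
  have hNc := hg.continuous
  have hwc : Continuous (gaugeWeight N p) :=
    Real.continuous_exp.comp (hNc.rpow_const fun ξ => Or.inr hp0.le).neg
  have hNκ : Continuous fun ξ => N ξ ^ κ := hNc.rpow_const fun ξ => Or.inr hκ
  obtain ⟨r, hr⟩ := hfc.exists_closedBall
  have hr0 : ∀ ξ ∉ Metric.closedBall (0 : Rn (m + 1)) r, f ξ = 0 := fun ξ hξ =>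
    image_eq_zero_of_notMem_tsupport (hr ξ hξ)
  -- the first vector field
  have hAN : ∀ i, HasLipDeriv (X i) _ _ := fun i => (hg.gradN i).comp (hreg i) hA hAd
  have hBN : ∀ i, HasLipDeriv (X i) _ _ := fun i => (hg.gradN i).comp (hreg i) (hθpow κ) (hθpowd κ)
  have hy : ∀ i, HasLipDeriv (X i) _ _ := fun i => (hg.gradx i).mul (hreg i) (hBN i)
  have hEy : ∀ i, HasLipDeriv (X i) _ _ := fun i =>
    (hy i).comp (hreg i) (contDiff_decayProfile α K) (hasDerivAt_decayProfile α hK0)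
  have hAE : ∀ i, HasLipDeriv (X i) _ _ := fun i => (hAN i).mul (hreg i) (hEy i)
  have hΦ : ∀ i, HasLipDeriv (X i) _ _ := fun i => (hf i).mul (hreg i) (hAE i)
  -- the second vector field
  have hDN := (hg.gradN j).comp (hreg j) hD hDd
  have hxB := hg.deriv_x.mul (hreg j) (hBN j)
  have hφ := hxB.comp (hreg j) contDiff_satProfile hasDerivAt_satProfile
  have hDφ := hDN.mul (hreg j) hφ
  have hg2 := (hf j).mul (hreg j) hDφ
  have hΦc : HasCompactSupport fun ξ => f ξ * (θ (N ξ) ^ q * Real.exp (-θ (N ξ) ^ p) *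
    decayProfile α K (|ξ 0| * θ (N ξ) ^ κ)) := hfc.mul_right
  have hg2c : HasCompactSupport fun ξ => f ξ * (Real.exp (-θ (N ξ) ^ p) *
    satProfile (ξ 0 * θ (N ξ) ^ κ)) := hfc.mul_right
  -- The X_j field contributes a pure derivative of a compactly supported function, whose integral
  -- vanishes.
  have hint2 := hg2.integral_eq_zero hg2c
  have hV : ContinuousOn (fun ξ : Rn (m + 1) => |ξ 0| ^ (2 * α) / N ξ ^ (2 * α + 1)) {0}ᶜ := by
    intro ξ hξ
    have h1 : 0 < N ξ ^ (2 * α + 1) := Real.rpow_pos_of_pos (hg.pos ξ hξ) _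
    refine ContinuousAt.continuousWithinAt (ContinuousAt.div ?_ ?_ h1.ne')
    · exact ((by fun_prop : Continuous fun ξ : Rn (m + 1) => |ξ 0|).rpow_const
        fun _ => Or.inr (by positivity)).continuousAt
    · exact (hNc.rpow_const fun _ => Or.inr (by positivity)).continuousAt
  have hnear : ∀ ξ, N ξ < 1 → f ξ * (θ (N ξ) ^ q * Real.exp (-θ (N ξ) ^ p) *
      decayProfile α K (|ξ 0| * θ (N ξ) ^ κ)) = 0 := fun ξ hξ => by rw [hfN ξ hξ, zero_mul]
  have hsub : IsOpen {ξ | N ξ < 1} := isOpen_lt hNc continuous_const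
  have h0mem : (0 : Rn (m + 1)) ∈ {ξ | N ξ < 1} := by simp [hg.zero]
  -- The set {N < 1} is a neighbourhood of the origin on which f vanishes, so the product is
  -- admissible in the Laplacian inequality.
  have h0supp : (0 : Rn (m + 1)) ∉ tsupport fun ξ => f ξ * (θ (N ξ) ^ q *
      Real.exp (-θ (N ξ) ^ p) * decayProfile α K (|ξ 0| * θ (N ξ) ^ κ)) := by
    rw [notMem_tsupport_iff_eventuallyEq]
    filter_upwards [hsub.mem_nhds h0mem] with ξ hξ using hnear ξ hξ
  have hlap := laplacian_le_of_hasLipDeriv hreg (fun i => (hg.gradN i).locBdd)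
    (fun i => (hg.gradN i).aestronglyMeasurable) hV hg.laplacian (hΦ j).continuous hΦ
    (fun ξ => mul_nonneg (hf0 ξ) (mul_nonneg (mul_nonneg (Real.rpow_nonneg (hθpos _).le _)
      (Real.exp_pos _).le) (decayProfile_pos _ _ _).le)) hΦc h0supp
  -- integrability of all the terms
  have iV : Integrable fun ξ : Rn (m + 1) => |ξ 0| ^ (2 * α) / N ξ ^ (2 * α + 1) *
      (f ξ * (θ (N ξ) ^ q * Real.exp (-θ (N ξ) ^ p) *
        decayProfile α K (|ξ 0| * θ (N ξ) ^ κ))) := by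
    have h1 := (hV.mono (subset_compl_singleton_iff.2 h0supp)).mul
      (hΦ j).continuous.continuousOn |>.integrableOn_compact (μ := volume) hΦc
    refine h1.integrable_of_forall_notMem_eq_zero fun ξ hξ => ?_
    have h2 := image_eq_zero_of_notMem_tsupport hξ
    exact mul_eq_zero_of_right _ h2
  have hΦr := fun ξ (hξ : ξ ∉ Metric.closedBall (0 : Rn (m + 1)) r) =>
    show f ξ * (θ (N ξ) ^ q * Real.exp (-θ (N ξ) ^ p) *
      decayProfile α K (|ξ 0| * θ (N ξ) ^ κ)) = 0 by rw [hr0 ξ hξ, zero_mul]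
  have iG := fun i => ((hg.gradN i).locBdd.mul (hΦ i).locBdd).integrable_of_closedBall (R := r)
    ((hg.gradN i).aestronglyMeasurable.mul (hΦ i).aestronglyMeasurable) (by
      filter_upwards [(hΦ i).ae_eq_zero_of_notMem_closedBall hΦr] with ξ h1 hξ
      rw [h1 hξ, mul_zero])
  have ig2 := hg2.integrable_of_closedBall (R := r) fun ξ hξ => by rw [hr0 ξ hξ, zero_mul]
  have iGw := hf.integrable_norm_mul hfc hwc
  have ifκ : Integrable fun ξ => f ξ * N ξ ^ κ * gaugeWeight N p ξ :=
    ((hfcont.mul hNκ).mul hwc).integrable_of_hasCompactSupport hfc.mul_right.mul_right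
  have ifw : Integrable fun ξ => f ξ * gaugeWeight N p ξ :=
    (hfcont.mul hwc).integrable_of_hasCompactSupport hfc.mul_right
  have hms : MeasurableSet {ξ | N ξ ≤ R} := (isClosed_le hNc continuous_const).measurableSet
  have ifR : Integrable ({ξ | N ξ ≤ R}.indicator fun ξ => f ξ * gaugeWeight N p ξ) :=
    ifw.indicator hms
  -- integration of the pointwise inequality
  have key := integral_mono_ae (((iV.const_mul C).add
      (integrable_finsetSum Finset.univ fun i _ => iG i)).const_mul B |>.sub ig2)
    (((iGw.const_mul (B * C * K ^ α + 1)).sub (ifκ.const_mul (1 / 8))).add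
      (ifR.const_mul (R ^ κ * M))) (by
    filter_upwards [hg.lower, hg.upper, hg.gradx_le, hf.ae_eq_zero hsub fun ξ hξ => hfN ξ hξ]
      with ξ h1 h2 h3 h4
    -- Where N < 1 both f and, almost everywhere, its subgradient vanish. Elsewhere θ(N) = N with
    -- derivative 1, and the pointwise estimate applies literally.
    by_cases hN1 : N ξ < 1
    · simp [hfN ξ hN1, h4 hN1, indicator]
    · rw [not_lt] at hN1
      obtain ⟨e1, e2⟩ := hθ1 _ hN1
      have hw0 := gaugeWeight_pos N p ξ
      have hpt := pointwise_bound (g := G ξ) j hα hκ hp hC hK hB.le hN1 (s := ξ 0) rfl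
        (hf0 ξ) h1 h2 h3
      have hcf := hcoef (N ξ) |ξ 0| hN1 (abs_nonneg _) (hg.abs_le ξ)
      have hfN0 : 0 ≤ f ξ * N ξ ^ κ := mul_nonneg (hf0 ξ) (Real.rpow_nonneg (hg.nonneg ξ) _)
      have h5 := hpt.trans (add_le_add_right (mul_le_mul_of_nonneg_left hcf hfN0) _)
      have h6 : f ξ * N ξ ^ κ * (if N ξ ≤ R then M else 0) ≤
          R ^ κ * M * {ξ | N ξ ≤ R}.indicator f ξ := by
        by_cases hNR : N ξ ≤ R
        · rw [if_pos hNR, indicator_of_mem (show ξ ∈ {ξ | N ξ ≤ R} from hNR)]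
          have h7 : N ξ ^ κ ≤ R ^ κ := Real.rpow_le_rpow (hg.nonneg ξ) hNR hκ
          have := mul_le_mul_of_nonneg_left h7 (mul_nonneg (hf0 ξ) hM)
          linarith
        · rw [if_neg hNR, indicator_of_notMem (show ξ ∉ {ξ | N ξ ≤ R} from hNR)]
          simp
      have h8 : ({ξ | N ξ ≤ R}.indicator (fun ξ => f ξ * gaugeWeight N p ξ) ξ) =
          {ξ | N ξ ≤ R}.indicator f ξ * gaugeWeight N p ξ := by
        by_cases hNR : ξ ∈ {ξ | N ξ ≤ R} <;> simp [hNR]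
      have h9 := mul_le_mul_of_nonneg_right (h5.trans (add_le_add_right
        (show f ξ * N ξ ^ κ * (-(1 / 8) + if N ξ ≤ R then M else 0) ≤
          -(1 / 8) * (f ξ * N ξ ^ κ) + R ^ κ * M * {ξ | N ξ ≤ R}.indicator f ξ by linarith) _))
          hw0.le
      simp only [Pi.add_apply, Pi.sub_apply, h8]
      have hwθ : Real.exp (-(N ξ) ^ p) = gaugeWeight N p ξ := rfl
      simp only [e1, e2, hwθ, one_mul, ← hq] at h9 ⊢
      refine le_of_eq_of_le ?_ (h9.trans_eq ?_)
      · rw [sub_mul, mul_assoc B, add_mul, Finset.sum_mul]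
        congr 1
        · congr 2
          · ring
          · exact Finset.sum_congr rfl fun i _ => by ring
        · ring
      · ring)
  have e1 := integral_sub (((iV.const_mul C).add
      (integrable_finsetSum Finset.univ fun i _ => iG i)).const_mul B) ig2
  have e2 := integral_add (iV.const_mul C) (integrable_finsetSum Finset.univ fun i _ => iG i)
  have e3 := integral_add ((iGw.const_mul (B * C * K ^ α + 1)).sub (ifκ.const_mul (1 / 8)))
    (ifR.const_mul (R ^ κ * M))
  have e4 := integral_sub (iGw.const_mul (B * C * K ^ α + 1)) (ifκ.const_mul (1 / 8))
  simp only [Pi.add_apply, Pi.sub_apply] at key e1 e2 e3 e4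
  rw [e1, e3, integral_const_mul B, e2, e4, hint2, integral_const_mul, integral_const_mul,
    integral_const_mul, integral_const_mul, integral_finsetSum _ fun i _ => iG i,
    integral_indicator hms, sub_zero] at key
  -- The Laplacian inequality says that the integrated left side is nonnegative; hence so is the
  -- right side, which contains -1/8 of the wanted integral.
  have h0 : 0 ≤ B * (C * (∫ ξ : Rn (m + 1), |ξ 0| ^ (2 * α) / N ξ ^ (2 * α + 1) *
      (f ξ * (θ (N ξ) ^ q * Real.exp (-θ (N ξ) ^ p) *
        decayProfile α K (|ξ 0| * θ (N ξ) ^ κ)))) + _) :=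
    mul_nonneg hB.le (neg_le_iff_add_nonneg.1 hlap)
  have hL0 : 0 ≤ ∫ ξ, ‖G ξ‖ * gaugeWeight N p ξ :=
    integral_nonneg fun ξ => mul_nonneg (norm_nonneg _) (gaugeWeight_pos N p ξ).le
  have hR0 : 0 ≤ ∫ ξ in {ξ | N ξ ≤ R}, f ξ * gaugeWeight N p ξ :=
    integral_nonneg fun ξ => mul_nonneg (hf0 ξ) (gaugeWeight_pos N p ξ).le
  have h10 := h0.trans key
  have h11 : 8 * (R ^ κ * M) * (∫ ξ, ‖G ξ‖ * gaugeWeight N p ξ) ≥ 0 := by positivity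
  have h12 : C₀ * (∫ ξ in {ξ | N ξ ≤ R}, f ξ * gaugeWeight N p ξ) ≥ 0 :=
    mul_nonneg hC₀pos.le hR0
  rw [hC₁, add_mul, add_mul]
  rw [hC₀] at h12 ⊢
  linarith

/-- The `U`-bound. -/
theorem IsGauge.exists_uBound {m l : ℕ} {X : Fin l → Rn (m + 1) → Rn (m + 1)}
    {N : Rn (m + 1) → ℝ} {α p C : ℝ} {GN Gx : Rn (m + 1) → Rn l} {j : Fin l}
    (hg : IsGauge X N α p C GN Gx j) : ∃ C₁ R : ℝ, 0 < C₁ ∧ 1 ≤ R ∧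
    ∀ (f : Rn (m + 1) → ℝ) (G : Rn (m + 1) → Rn l), HasLipGrad X f G → HasCompactSupport f →
      (∀ ξ, 0 ≤ f ξ) →
      ∫ ξ, f ξ * (1 + N ξ ^ gaugeExp α p) * gaugeWeight N p ξ ≤
        C₁ * (∫ ξ, ‖G ξ‖ * gaugeWeight N p ξ) +
        C₁ * ∫ ξ in {ξ | N ξ ≤ R}, f ξ * gaugeWeight N p ξ := by
  obtain ⟨C₁, R, hC₁, hR, hU⟩ := hg.exists_uBound_of_support
  have hα := hg.alpha_pos
  have hκ : 0 ≤ gaugeExp α p := div_nonneg (by linarith [hg.le_p]) (by linarith)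
  set κ := gaugeExp α p with hκdef
  have hC := hg.one_le
  have hC0 : 0 < C := by linarith
  -- The previous bound is applied to f ζ(N), which vanishes for N ≤ 1 and equals f for N ≥ 2. All
  -- corrections are supported in {N ≤ 2}.
  set ζ : ℝ → ℝ := fun t => Real.smoothTransition (t - 1) with hζdef
  have hζ : ContDiff ℝ ∞ ζ := Real.smoothTransition.contDiff.comp (contDiff_id.sub contDiff_const)
  have hζd : ∀ t, HasDerivAt ζ (deriv ζ t) t := fun t =>
    (hζ.differentiable (by simp) t).hasDerivAt
  have hζ0 : ∀ t, t ≤ 1 → ζ t = 0 := fun t ht =>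
    Real.smoothTransition.zero_of_nonpos (by linarith)
  have hζ1 : ∀ t, 2 ≤ t → ζ t = 1 := fun t ht =>
    Real.smoothTransition.one_of_one_le (by linarith)
  have hζnn : ∀ t, 0 ≤ ζ t := fun t => Real.smoothTransition.nonneg _
  have hζle : ∀ t, ζ t ≤ 1 := fun t => Real.smoothTransition.le_one _
  have hζ2 : ∀ t, 2 < t → deriv ζ t = 0 := fun t ht => by
    have : ζ =ᶠ[𝓝 t] fun _ => 1 := by
      filter_upwards [lt_mem_nhds ht] with s hs using hζ1 s hs.le
    rw [this.deriv_eq, deriv_const]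
  obtain ⟨M, hM⟩ := (isCompact_Icc (a := (0 : ℝ)) (b := 2)).exists_bound_of_continuousOn
    (hζ.continuous_deriv (by simp)).continuousOn
  have hM0 : 0 ≤ M := (norm_nonneg _).trans (hM 0 (by norm_num))
  -- R' ≥ 2 collects the corrections in {N ≤ R'} and ensures N^κ ≥ 1 outside, so that ∫ f is
  -- controlled as well.
  set R' := max 2 R with hR'
  -- From |x| ≤ C N the gradient of N is bounded by C · C^α, hence that of ζ(N) by D.
  set D := M * (C * C ^ α) with hD
  have hD0 : 0 ≤ D := by positivity
  set C₂ := 2 * (C₁ + C₁ * D + 2 ^ κ) + 1 with hC₂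
  have hC₂pos : 0 < C₂ := by positivity
  refine ⟨C₂, R', hC₂pos, le_max_of_le_left (by norm_num), fun f G hf hfc hf0 => ?_⟩
  have hreg := hg.regular
  have hNc := hg.continuous
  have hp0 : 0 < p := by linarith [hg.le_p]
  have hwc : Continuous (gaugeWeight N p) :=
    Real.continuous_exp.comp (hNc.rpow_const fun ξ => Or.inr hp0.le).neg
  have hNκ : Continuous fun ξ => N ξ ^ κ := hNc.rpow_const fun ξ => Or.inr hκ
  have h1 : HasLipGrad X (fun ξ => ζ (N ξ)) fun ξ => deriv ζ (N ξ) • GN ξ :=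
    HasLipGrad.comp hreg hg.gradN hζ hζd
  have h2 := HasLipGrad.mul hreg hf h1
  have hfcont : Continuous f := (hf j).continuous
  have hζN : Continuous fun ξ => ζ (N ξ) := hζ.continuous.comp hNc
  have h2c : HasCompactSupport fun ξ => f ξ * ζ (N ξ) := hfc.mul_right
  have h3 := hU _ _ h2 h2c (fun ξ => mul_nonneg (hf0 ξ) (hζnn _)) fun ξ hξ => by
    rw [hζ0 _ hξ.le, mul_zero]
  have hms : ∀ r, MeasurableSet {ξ | N ξ ≤ r} := fun r =>
    (isClosed_le hNc continuous_const).measurableSet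
  have ifw : Integrable fun ξ => f ξ * gaugeWeight N p ξ :=
    (hfcont.mul hwc).integrable_of_hasCompactSupport hfc.mul_right
  have ifκ : Integrable fun ξ => f ξ * N ξ ^ κ * gaugeWeight N p ξ :=
    ((hfcont.mul hNκ).mul hwc).integrable_of_hasCompactSupport hfc.mul_right.mul_right
  have iζκ : Integrable fun ξ => f ξ * ζ (N ξ) * N ξ ^ κ * gaugeWeight N p ξ :=
    (((hfcont.mul hζN).mul hNκ).mul hwc).integrable_of_hasCompactSupport
      hfc.mul_right.mul_right.mul_right
  have iζw : Integrable fun ξ => f ξ * ζ (N ξ) * gaugeWeight N p ξ :=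
    ((hfcont.mul hζN).mul hwc).integrable_of_hasCompactSupport hfc.mul_right.mul_right
  have iGw := hf.integrable_norm_mul hfc hwc
  have iG2 := h2.integrable_norm_mul h2c hwc
  have hw0 := gaugeWeight_pos N p
  have hind : ∀ ξ, {ξ | N ξ ≤ R'}.indicator (fun ξ => f ξ * gaugeWeight N p ξ) ξ =
      if N ξ ≤ R' then f ξ * gaugeWeight N p ξ else 0 := fun ξ => by
    simp [indicator]
  have iR : Integrable ({ξ | N ξ ≤ R'}.indicator fun ξ => f ξ * gaugeWeight N p ξ) :=
    ifw.indicator (hms _)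
  have s0 : 0 ≤ ∫ ξ in {ξ | N ξ ≤ R'}, f ξ * gaugeWeight N p ξ :=
    integral_nonneg fun ξ => mul_nonneg (hf0 ξ) (hw0 ξ).le
  have g0 : 0 ≤ ∫ ξ, ‖G ξ‖ * gaugeWeight N p ξ :=
    integral_nonneg fun ξ => mul_nonneg (norm_nonneg _) (hw0 ξ).le
  -- the localized term
  have k1 : ∫ ξ in {ξ | N ξ ≤ R}, f ξ * ζ (N ξ) * gaugeWeight N p ξ ≤
      ∫ ξ in {ξ | N ξ ≤ R'}, f ξ * gaugeWeight N p ξ := by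
    have hRR : {ξ | N ξ ≤ R} ⊆ {ξ | N ξ ≤ R'} := fun ξ (hξ : N ξ ≤ R) => le_max_of_le_right hξ
    refine (setIntegral_mono_set iζw.integrableOn (ae_of_all _ fun ξ =>
      mul_nonneg (mul_nonneg (hf0 ξ) (hζnn _)) (hw0 ξ).le) (ae_of_all _ hRR)).trans ?_
    refine setIntegral_mono iζw.integrableOn ifw.integrableOn fun ξ => ?_
    exact mul_le_mul_of_nonneg_right (mul_le_of_le_one_right (hf0 ξ) (hζle _)) (hw0 ξ).le
  -- the gradient term
  have k2 : ∫ ξ, ‖ζ (N ξ) • G ξ + f ξ • deriv ζ (N ξ) • GN ξ‖ * gaugeWeight N p ξ ≤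
      (∫ ξ, ‖G ξ‖ * gaugeWeight N p ξ) +
        D * ∫ ξ in {ξ | N ξ ≤ R'}, f ξ * gaugeWeight N p ξ := by
    rw [← integral_indicator (hms _), ← integral_const_mul, ← integral_add iGw (iR.const_mul D)]
    refine integral_mono_ae iG2 (iGw.add (iR.const_mul D)) ?_
    filter_upwards [hg.upper] with ξ hξ
    have hGN : ‖GN ξ‖ ≤ C * C ^ α := by
      refine hξ.trans (mul_le_mul_of_nonneg_left ?_ hC0.le)
      rw [← Real.div_rpow (abs_nonneg _) (hg.nonneg ξ)]
      exact Real.rpow_le_rpow (div_nonneg (abs_nonneg _) (hg.nonneg ξ))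
        (div_le_of_le_mul₀ (hg.nonneg ξ) hC0.le (hg.abs_le ξ)) hα.le
    have b1 : ‖ζ (N ξ) • G ξ‖ ≤ ‖G ξ‖ := by
      rw [norm_smul, Real.norm_of_nonneg (hζnn _)]
      exact mul_le_of_le_one_left (norm_nonneg _) (hζle _)
    have b2 : ‖f ξ • deriv ζ (N ξ) • GN ξ‖ ≤ D * if N ξ ≤ R' then f ξ else 0 := by
      rw [norm_smul, norm_smul, Real.norm_of_nonneg (hf0 ξ)]
      split_ifs with h
      · by_cases h2 : N ξ ≤ 2
        · have := mul_le_mul (hM (N ξ) ⟨hg.nonneg ξ, h2⟩) hGN (norm_nonneg _) hM0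
          rw [mul_comm D]
          exact mul_le_mul_of_nonneg_left this (hf0 ξ)
        · rw [hζ2 _ (not_le.1 h2)]
          simpa using mul_nonneg hD0 (hf0 ξ)
      · rw [hζ2 _ ((le_max_left 2 R).trans_lt (not_le.1 h))]
        simp
    have b3 := mul_le_mul_of_nonneg_right ((norm_add_le _ _).trans (add_le_add b1 b2)) (hw0 ξ).le
    refine b3.trans_eq ?_
    simp only [hind]
    split_ifs <;> ring
  -- comparison of the left hand sides
  have k3 : ∫ ξ, f ξ * N ξ ^ κ * gaugeWeight N p ξ ≤
      (∫ ξ, f ξ * ζ (N ξ) * N ξ ^ κ * gaugeWeight N p ξ) +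
        2 ^ κ * ∫ ξ in {ξ | N ξ ≤ R'}, f ξ * gaugeWeight N p ξ := by
    rw [← integral_indicator (hms _), ← integral_const_mul, ← integral_add iζκ (iR.const_mul _)]
    refine integral_mono ifκ (iζκ.add (iR.const_mul _)) fun ξ => ?_
    simp only [hind]
    have hN0 := Real.rpow_nonneg (hg.nonneg ξ) κ
    by_cases h2 : N ξ ≤ 2
    · rw [if_pos (le_max_of_le_left h2)]
      have a1 : N ξ ^ κ ≤ 2 ^ κ := Real.rpow_le_rpow (hg.nonneg ξ) h2 hκ
      have a2 := mul_le_mul_of_nonneg_left a1 (mul_nonneg (hf0 ξ) (hw0 ξ).le)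
      have a3 : 0 ≤ f ξ * ζ (N ξ) * N ξ ^ κ * gaugeWeight N p ξ :=
        mul_nonneg (mul_nonneg (mul_nonneg (hf0 ξ) (hζnn _)) hN0) (hw0 ξ).le
      linarith
    · rw [hζ1 _ (not_le.1 h2).le, mul_one]
      have : 0 ≤ (2 : ℝ) ^ κ * if N ξ ≤ R' then f ξ * gaugeWeight N p ξ else 0 := by
        split_ifs
        · exact mul_nonneg (by positivity) (mul_nonneg (hf0 ξ) (hw0 ξ).le)
        · simp
      linarith
  have k4 : ∫ ξ, f ξ * gaugeWeight N p ξ ≤ (∫ ξ, f ξ * N ξ ^ κ * gaugeWeight N p ξ) +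
      ∫ ξ in {ξ | N ξ ≤ R'}, f ξ * gaugeWeight N p ξ := by
    rw [← integral_indicator (hms _), ← integral_add ifκ iR]
    refine integral_mono ifw (ifκ.add iR) fun ξ => ?_
    simp only [hind]
    have hN0 := Real.rpow_nonneg (hg.nonneg ξ) κ
    split_ifs with h
    · have : 0 ≤ f ξ * N ξ ^ κ * gaugeWeight N p ξ :=
        mul_nonneg (mul_nonneg (hf0 ξ) hN0) (hw0 ξ).le
      linarith
    · have h1N : (1 : ℝ) ≤ N ξ ^ κ := Real.one_le_rpow
        ((by norm_num : (1 : ℝ) ≤ 2).trans ((le_max_left 2 R).trans (not_le.1 h).le)) hκ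
      have := mul_le_mul_of_nonneg_left h1N (mul_nonneg (hf0 ξ) (hw0 ξ).le)
      linarith
  have k5 : ∫ ξ, f ξ * (1 + N ξ ^ κ) * gaugeWeight N p ξ =
      (∫ ξ, f ξ * gaugeWeight N p ξ) + ∫ ξ, f ξ * N ξ ^ κ * gaugeWeight N p ξ := by
    rw [← integral_add ifw ifκ]
    congr 1
    ext ξ
    ring
  have k6 := mul_le_mul_of_nonneg_left k1 hC₁.le
  have k7 := mul_le_mul_of_nonneg_left k2 hC₁.le
  rw [k5]
  set S := ∫ ξ in {ξ | N ξ ≤ R'}, f ξ * gaugeWeight N p ξ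
  set T := ∫ ξ, ‖G ξ‖ * gaugeWeight N p ξ
  have k8 : C₂ * T + C₂ * S - (2 * (C₁ * (T + D * S) + C₁ * S + 2 ^ κ * S) + S) =
      2 * (C₁ * D + 2 ^ κ) * T + T := by rw [hC₂]; ring
  have k9 : 0 ≤ 2 * (C₁ * D + 2 ^ κ) * T + T := by positivity
  linarith

/-! ### Proper metrics -/

namespace IsProperMetric

variable {d : Rn n → Rn n → ℝ}

lemma self (hd : IsProperMetric d) (ξ : Rn n) : d ξ ξ = 0 := (hd.eq_zero_iff ξ ξ).2 rfl

lemma nonneg (hd : IsProperMetric d) (ξ η : Rn n) : 0 ≤ d ξ η := by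
  have h1 := hd.triangle ξ η ξ
  rw [hd.self, hd.symm η ξ] at h1
  linarith

lemma abs_sub_le (hd : IsProperMetric d) (ζ ξ η : Rn n) : |d ζ ξ - d ζ η| ≤ d ξ η := by
  rw [abs_le]
  have h1 := hd.triangle ζ ξ η
  have h2 := hd.triangle ζ η ξ
  rw [hd.symm η ξ] at h2
  constructor <;> linarith

lemma continuous_of_lipschitz (hd : IsProperMetric d) {f : Rn n → ℝ} {K : ℝ} (hf : ∀ ξ η, |f ξ - f η| ≤ K * d ξ η) :
    Continuous f := by
  refine continuous_iff_continuousAt.2 fun ξ => Metric.tendsto_nhds.2 fun ε hε => ?_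
  have hK : 0 < |K| + 1 := by positivity
  filter_upwards [(hd.nhds_basis ξ).mem_of_mem (div_pos hε hK)] with η hη
  rw [Real.dist_eq, abs_sub_comm]
  have h1 : d ξ η < ε / (|K| + 1) := hη
  rw [lt_div_iff₀ hK] at h1
  have h2 := mul_le_mul_of_nonneg_right (le_abs_self K) (hd.nonneg ξ η)
  have h3 := hd.nonneg ξ η
  linarith [hf ξ η]

lemma continuous_left (hd : IsProperMetric d) (ζ : Rn n) : Continuous (d ζ) :=
  hd.continuous_of_lipschitz (K := 1) fun ξ η => by
    rw [one_mul]
    exact hd.abs_sub_le ζ ξ η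

lemma isOpen_ball (hd : IsProperMetric d) (ζ : Rn n) (r : ℝ) : IsOpen {η | d ζ η < r} :=
  isOpen_lt (hd.continuous_left ζ) continuous_const

end IsProperMetric

/-! ### Sobolev functions -/

lemma HasWeakFieldDeriv.mono_set {X : Rn n → Rn n} {Ω Ω' : Set (Rn n)} {f g : Rn n → ℝ}
    (h : HasWeakFieldDeriv X Ω f g) (hs : Ω' ⊆ Ω) : HasWeakFieldDeriv X Ω' f g where
  locallyIntegrableOn := h.locallyIntegrableOn.mono_set hs
  locallyIntegrableOn_deriv := h.locallyIntegrableOn_deriv.mono_set hs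
  integral_eq φ hφ := h.integral_eq φ ⟨hφ.contDiff, hφ.hasCompactSupport,
    hφ.tsupport_subset.trans hs⟩

lemma HasLipGrad.hasSobolevGrad {l : ℕ} {X : Fin l → Rn n → Rn n} {f : Rn n → ℝ}
    {G : Rn n → Rn l} (h : HasLipGrad X f G) (hf : Continuous f) (hc : HasCompactSupport f)
    {Ω : Set (Rn n)} {ν : Measure (Rn n)} [IsFiniteMeasure (ν.restrict Ω)] (hν : ν ≪ volume) :
    HasSobolevGrad X Ω ν f G where
  hasWeakGrad i := (h i).weak.mono_set (subset_univ _)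
  memLp := by
    obtain ⟨M, hM⟩ := hf.bounded_above_of_compact_support hc
    exact MemLp.of_bound hf.aestronglyMeasurable M (ae_of_all _ hM)
  memLp_grad := by
    have hν' : ν.restrict Ω ≪ volume := Measure.restrict_le_self.absolutelyContinuous.trans hν
    obtain ⟨R, hR⟩ := hc.exists_closedBall
    obtain ⟨M, hM⟩ := h.isLocBdd_norm R
    refine MemLp.of_bound (h.aestronglyMeasurable.mono_ac hν') (max M 0) (hν'.ae_le ?_)
    filter_upwards [hM, h.ae_eq_zero Metric.isClosed_closedBall.isOpen_compl fun ξ hξ =>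
      image_eq_zero_of_notMem_tsupport (hR ξ hξ)] with ξ h1 h2
    by_cases hξ : ξ ∈ Metric.closedBall (0 : Rn n) R
    · have := h1 (mem_closedBall_zero_iff.1 hξ)
      rw [abs_of_nonneg (norm_nonneg _)] at this
      exact le_max_of_le_left this
    · rw [h2 hξ, norm_zero]
      exact le_max_right _ _

lemma powerMeasure_absolutelyContinuous (N : Rn n → ℝ) (p : ℝ) :
    powerMeasure N p ≪ volume := tilted_absolutelyContinuous _ _

lemma isProbabilityMeasure_powerMeasure {N : Rn n → ℝ} {p : ℝ}
    (hZ : Integrable (gaugeWeight N p)) : IsProbabilityMeasure (powerMeasure N p) :=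
  isProbabilityMeasure_tilted hZ

lemma integral_gaugeWeight_pos {N : Rn n → ℝ} {p : ℝ} (hZ : Integrable (gaugeWeight N p)) :
    0 < ∫ ξ, gaugeWeight N p ξ := integral_exp_pos hZ

lemma integral_powerMeasure (N : Rn n → ℝ) (p : ℝ) (F : Rn n → ℝ) :
    ∫ ξ, F ξ ∂(powerMeasure N p) =
      (∫ ξ, gaugeWeight N p ξ)⁻¹ * ∫ ξ, F ξ * gaugeWeight N p ξ := by
  rw [powerMeasure, integral_tilted, ← integral_const_mul]
  congr 1
  ext ξ
  rw [smul_eq_mul, gaugeWeight, div_eq_inv_mul]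
  simp only [gaugeWeight]
  ring

/-! ### A weighted Cheeger inequality from the U-bound and the local Poincaré inequality. -/

/-- The Cheeger type inequality for functions that vanish on a set of measure at least `1/4`. -/
theorem IsGauge.exists_cheeger {m l : ℕ} {X : Fin l → Rn (m + 1) → Rn (m + 1)}
    {N : Rn (m + 1) → ℝ} {α p C : ℝ} {GN Gx : Rn (m + 1) → Rn l} {j : Fin l}
    (hg : IsGauge X N α p C GN Gx j) {d : Rn (m + 1) → Rn (m + 1) → ℝ} (hd : IsProperMetric d)
    (hdN : ∀ ξ, d 0 ξ ≤ C * N ξ) (hNd : ∀ ξ, N ξ ≤ C * d 0 ξ)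
    (hZ : Integrable (gaugeWeight N p)) (hP : LocalPoincare d X) : ∃ C₂ : ℝ, 0 < C₂ ∧
    ∀ (f : Rn (m + 1) → ℝ) (G : Rn (m + 1) → Rn l), HasLipGrad X f G → HasCompactSupport f →
      (∀ ξ, 0 ≤ f ξ) → 1 / 4 ≤ (powerMeasure N p).real {ξ | f ξ = 0} →
      ∫ ξ, f ξ * (1 + N ξ ^ gaugeExp α p) ∂(powerMeasure N p) ≤
        C₂ * ∫ ξ, ‖G ξ‖ ∂(powerMeasure N p) := by
  have := isProbabilityMeasure_powerMeasure hZ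
  set μ := powerMeasure N p with hμ
  set Z := ∫ ξ, gaugeWeight N p ξ with hZdef
  have hZ0 : 0 < Z := integral_gaugeWeight_pos hZ
  obtain ⟨C₁, R, hC₁, hR, hU⟩ := hg.exists_uBound
  have hC0 : 0 < C := by linarith [hg.one_le]
  have hp0 : 0 < p := by linarith [hg.le_p, hg.alpha_pos]
  have hw0 := gaugeWeight_pos N p
  have hw1 : ∀ ξ, gaugeWeight N p ξ ≤ 1 := fun ξ => by
    rw [gaugeWeight, Real.exp_le_one_iff, neg_nonpos]
    exact Real.rpow_nonneg (hg.nonneg ξ) _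
  have hwc : Continuous (gaugeWeight N p) :=
    Real.continuous_exp.comp (hg.continuous.rpow_const fun ξ => Or.inr hp0.le).neg
  -- a large ball
  have hlim : Tendsto (fun k : ℕ => μ {ξ | d 0 ξ < (k : ℝ)}) atTop (𝓝 1) := by
    have h1 := tendsto_measure_iUnion_atTop (μ := μ) (s := fun k : ℕ => {ξ | d 0 ξ < (k : ℝ)})
      fun a b hab ξ (hξ : d 0 ξ < a) => hξ.trans_le (by exact_mod_cast hab)
    have h2 : ⋃ k : ℕ, {ξ | d 0 ξ < (k : ℝ)} = univ := by
      refine eq_univ_of_forall fun ξ => mem_iUnion.2 ?_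
      exact exists_nat_gt (d 0 ξ)
    rwa [h2, measure_univ] at h1
  have hev := (tendsto_order.1 hlim).1 (ENNReal.ofReal (7 / 8)) (by
    rw [← ENNReal.ofReal_one]
    exact (ENNReal.ofReal_lt_ofReal_iff (by norm_num)).2 (by norm_num))
  -- The ball must carry mass at least 7/8 and contain {N ≤ R}; the latter follows from d(0, ·) ≤ C
  -- N ≤ C R < k.
  obtain ⟨k, hk1, hk2⟩ := (hev.and (eventually_gt_atTop ⌈C * R⌉₊)).exists
  have hkR : C * R < k := (Nat.le_ceil _).trans_lt (by exact_mod_cast hk2)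
  have hk0 : (0 : ℝ) < k := lt_trans (by positivity) hkR
  set b := {ξ | d 0 ξ < (k : ℝ)} with hb
  have hbo : IsOpen b := hd.isOpen_ball 0 k
  have hbb : Bornology.IsBounded b := hd.isBounded_ball 0 k
  have hbm : MeasurableSet b := hbo.measurableSet
  have hbf : volume b ≠ ⊤ := hbb.measure_lt_top.ne
  have hμb : 7 / 8 ≤ μ.real b :=
    (ENNReal.ofReal_le_iff_le_toReal (measure_ne_top _ _)).1 hk1.le
  have : IsFiniteMeasure (volume.restrict b) := ⟨by simpa using hbb.measure_lt_top⟩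
  obtain ⟨Cb, hCb, hPb⟩ := hP k hk0
  set w₀ := Real.exp (-(C * k) ^ p) with hw₀
  have hw₀pos : 0 < w₀ := Real.exp_pos _
  have hwb : ∀ ξ ∈ b, w₀ ≤ gaugeWeight N p ξ := fun ξ hξ => by
    refine Real.exp_le_exp.2 (neg_le_neg (Real.rpow_le_rpow (hg.nonneg ξ) ?_ hp0.le))
    exact (hNd ξ).trans (mul_le_mul_of_nonneg_left (le_of_lt hξ) hC0.le)
  set C₃ := volume.real b * (8 * Cb / Z / w₀) with hC₃
  have hC₃0 : 0 ≤ C₃ := by positivity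
  refine ⟨C₁ * (1 + C₃), by positivity, fun f G hf hfc hf0 hfz => ?_⟩
  have hfcont : Continuous f := (hf j).continuous
  have iG : Integrable fun ξ => ‖G ξ‖ := by
    simpa using hf.integrable_norm_mul hfc (continuous_const (y := (1 : ℝ)))
  have iGv : Integrable G := (integrable_norm_iff hf.aestronglyMeasurable).1 iG
  have iGw := hf.integrable_norm_mul hfc hwc
  have iff : Integrable f := hfcont.integrable_of_hasCompactSupport hfc
  have h1 := hU f G hf hfc hf0
  have hzm : MeasurableSet {ξ | f ξ = 0} := (isClosed_eq hfcont continuous_const).measurableSet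
  set s := b ∩ {ξ | f ξ = 0} with hs
  have hsm : MeasurableSet s := hbm.inter hzm
  -- Inclusion and exclusion: 7/8 + 1/4 - 1 = 1/8.
  have hμs : 1 / 8 ≤ μ.real s := by
    have h2 := measureReal_union_add_inter (μ := μ) (s := b) hzm
    have h3 : μ.real (b ∪ {ξ | f ξ = 0}) ≤ 1 := measureReal_le_one
    linarith
  -- The density e^{-N^p} is at most 1, so μ-measure bounds Lebesgue measure from below, up to Z.
  have hvs : Z / 8 ≤ volume.real s := by
    have hsf : volume s ≠ ⊤ := measure_ne_top_of_subset inter_subset_left hbf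
    have h2 : μ.real s = Z⁻¹ * ∫ ξ in s, gaugeWeight N p ξ := by
      have h3 := integral_powerMeasure N p (s.indicator 1)
      rw [integral_indicator_one hsm] at h3
      rw [h3, ← integral_indicator hsm]
      congr 2
      ext ξ
      by_cases hξ : ξ ∈ s <;> simp [hξ]
    have h4 : ∫ ξ in s, gaugeWeight N p ξ ≤ volume.real s := by
      have := setIntegral_mono_on hZ.integrableOn (integrableOn_const hsf) hsm
        fun ξ _ => hw1 ξ
      simpa using this
    have h5 := mul_le_mul_of_nonneg_left h4 (inv_pos.2 hZ0).le
    rw [← h2] at h5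
    have h6 := mul_le_mul_of_nonneg_left (hμs.trans h5) hZ0.le
    rw [mul_inv_cancel_left₀ hZ0.ne'] at h6
    linarith
  -- the mean value
  set a := ⨍ η in b, f η with ha
  have ha' : volume.real b * a = ∫ η in b, f η := by
    rw [ha, setAverage_eq, smul_eq_mul]
    have : 0 < volume.real b := (lt_of_lt_of_le (by positivity) hvs).trans_le
      (measureReal_mono inter_subset_left hbf)
    field_simp
  have ha0 : 0 ≤ a := by
    rw [ha, setAverage_eq, smul_eq_mul]
    exact mul_nonneg (by positivity) (setIntegral_nonneg hbm fun ξ _ => hf0 ξ)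
  have h2 := hPb f G (hf.hasSobolevGrad hfcont hfc Measure.AbsolutelyContinuous.rfl)
  -- On s the function vanishes, so |f - a| = a there, and the Poincaré inequality controls the mean
  -- a itself.
  have h3 : ENNReal.ofReal (a * (Z / 8)) ≤ ENNReal.ofReal (Cb * ∫ ξ in b, ‖G ξ‖) := by
    rw [ENNReal.ofReal_mul hCb.le, ofReal_integral_norm_eq_lintegral_enorm iGv.integrableOn]
    refine le_trans ?_ h2
    refine le_trans ?_ (lintegral_mono_set (inter_subset_left : s ⊆ b))
    have h4 : ∫⁻ ξ in s, ‖f ξ - a‖ₑ = ENNReal.ofReal a * volume s := by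
      rw [setLIntegral_congr_fun hsm (g := fun _ => ENNReal.ofReal a) fun ξ hξ => ?_,
        setLIntegral_const]
      have : f ξ = 0 := hξ.2
      rw [this, zero_sub, enorm_neg, Real.enorm_of_nonneg ha0]
    rw [h4, ENNReal.ofReal_mul ha0]
    gcongr
    exact ENNReal.ofReal_le_of_le_toReal hvs
  have h5 : a * (Z / 8) ≤ Cb * ∫ ξ in b, ‖G ξ‖ :=
    (ENNReal.ofReal_le_ofReal_iff (mul_nonneg hCb.le (integral_nonneg fun _ => norm_nonneg _))).1 h3
  -- On the ball the density is bounded below by w₀, which brings the Lebesgue gradient integral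
  -- back to the weighted one.
  have h6 : w₀ * ∫ ξ in b, ‖G ξ‖ ≤ ∫ ξ, ‖G ξ‖ * gaugeWeight N p ξ := by
    rw [← integral_const_mul]
    refine le_trans ?_ (setIntegral_le_integral iGw (s := b) (ae_of_all _ fun ξ =>
      mul_nonneg (norm_nonneg _) (hw0 ξ).le))
    refine setIntegral_mono_on (iG.integrableOn.const_mul _) iGw.integrableOn hbm fun ξ hξ => ?_
    rw [mul_comm]
    exact mul_le_mul_of_nonneg_left (hwb ξ hξ) (norm_nonneg _)
  have h7 : ∫ ξ in {ξ | N ξ ≤ R}, f ξ * gaugeWeight N p ξ ≤ ∫ ξ in b, f ξ := by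
    have ifw : Integrable fun ξ => f ξ * gaugeWeight N p ξ :=
      (hfcont.mul hwc).integrable_of_hasCompactSupport hfc.mul_right
    have hsub : {ξ | N ξ ≤ R} ⊆ b := fun ξ (hξ : N ξ ≤ R) =>
      ((hdN ξ).trans (mul_le_mul_of_nonneg_left hξ hC0.le)).trans_lt hkR
    refine (setIntegral_mono_set ifw.integrableOn (ae_of_all _ fun ξ =>
      mul_nonneg (hf0 ξ) (hw0 ξ).le) (ae_of_all _ hsub)).trans ?_
    exact setIntegral_mono ifw.integrableOn iff.integrableOn fun ξ =>
      mul_le_of_le_one_right (hf0 ξ) (hw1 ξ)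
  have h8 : ∫ ξ in {ξ | N ξ ≤ R}, f ξ * gaugeWeight N p ξ ≤
      C₃ * ∫ ξ, ‖G ξ‖ * gaugeWeight N p ξ := by
    have k1 : a ≤ 8 * Cb / Z * ∫ ξ in b, ‖G ξ‖ := by
      have := mul_le_mul_of_nonneg_left h5 (by positivity : 0 ≤ 8 / Z)
      calc a = 8 / Z * (a * (Z / 8)) := by field_simp
        _ ≤ _ := this
        _ = _ := by ring
    have k2 : ∫ ξ in b, ‖G ξ‖ ≤ w₀⁻¹ * ∫ ξ, ‖G ξ‖ * gaugeWeight N p ξ := by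
      rw [inv_mul_eq_div, le_div_iff₀ hw₀pos, mul_comm]
      exact h6
    refine h7.trans (ha' ▸ ?_)
    rw [hC₃, mul_assoc]
    refine mul_le_mul_of_nonneg_left (k1.trans ?_) measureReal_nonneg
    rw [div_eq_mul_inv (8 * Cb / Z), mul_assoc]
    exact mul_le_mul_of_nonneg_left k2 (by positivity)
  rw [integral_powerMeasure, integral_powerMeasure, ← hZdef]
  rw [mul_left_comm]
  refine mul_le_mul_of_nonneg_left ?_ (inv_pos.2 hZ0).le
  have h9 := mul_le_mul_of_nonneg_left h8 hC₁.le
  refine h1.trans ?_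
  linarith

/-! ### The super-Poincaré inequality and the logarithmic gain. -/

lemma exists_one_add_rpow_le_exp {q η : ℝ} (hq : 0 ≤ q) (hη : 0 < η) : ∃ K : ℝ, 0 < K ∧
    ∀ L : ℝ, 0 ≤ L → (1 + L) ^ q ≤ K * Real.exp (η * L) := by
  -- a ≤ 1 gives 1 + L ≤ a⁻¹ e^{aL}, and a q ≤ η keeps the exponent under control after raising to
  -- the power q.
  set a := min 1 (η / (q + 1)) with ha
  have ha0 : 0 < a := lt_min one_pos (by positivity)
  have haq : a * q ≤ η := by
    have h1 : a ≤ η / (q + 1) := min_le_right _ _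
    rw [le_div_iff₀ (by positivity)] at h1
    linarith
  refine ⟨(a⁻¹) ^ q, by positivity, fun L hL => ?_⟩
  have h1 : 1 + L ≤ a⁻¹ * Real.exp (a * L) := by
    rw [inv_mul_eq_div, le_div_iff₀ ha0]
    have h2 := Real.add_one_le_exp (a * L)
    have h3 : a ≤ 1 := min_le_left _ _
    linarith
  refine (Real.rpow_le_rpow (by positivity) h1 hq).trans ?_
  rw [Real.mul_rpow (by positivity) (Real.exp_pos _).le, ← Real.exp_mul]
  refine mul_le_mul_of_nonneg_left (Real.exp_le_exp.2 ?_) (by positivity)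
  have := mul_le_mul_of_nonneg_right haq hL
  linarith

/-- A smooth substitute for `e^{-2 t^p}` on `t ≥ 0`. -/
lemma exists_smooth_weight {p : ℝ} (hp : 1 ≤ p) : ∃ (D : ℝ → ℝ) (M : ℝ), ContDiff ℝ ∞ D ∧ 0 ≤ M ∧
    ∀ t, 0 ≤ t → Real.exp (-2) * Real.exp (-t ^ p) ^ 2 ≤ D t ∧ D t ≤ Real.exp (-t ^ p) ^ 2 ∧
      |deriv D t| ≤ M * Real.exp (-t ^ p) := by
  obtain ⟨θ, hθ, hθpos, hθ1, hθ2⟩ := exists_smooth_positive_id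
  have hp0 : 0 < p := by linarith
  obtain ⟨M, hM⟩ := (isCompact_Icc (a := (0 : ℝ)) (b := 1)).exists_bound_of_continuousOn
    (hθ.continuous_deriv (by simp)).continuousOn
  have hθle : ∀ t, 0 ≤ t → t ≤ θ t := fun t ht => by
    rcases le_total t 1 with h | h
    · exact (hθ2 t ht h).1
    · exact (hθ1 t h).1.ge
  have hθp : ∀ t, 0 ≤ t → θ t ^ p ≤ 1 + t ^ p := fun t ht => by
    have h0 := Real.rpow_nonneg ht p
    rcases le_total t 1 with h | h
    · have := Real.rpow_le_one (hθpos t).le (hθ2 t ht h).2 hp0.le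
      linarith
    · rw [(hθ1 t h).1]
      linarith
  have hθd : ∀ t, 0 ≤ t → |deriv θ t| ≤ max M 1 := fun t ht => by
    rcases le_total t 1 with h | h
    · exact le_max_of_le_left (hM t ⟨ht, h⟩)
    · rw [(hθ1 t h).2]
      simp
  have hpow : ∀ t, θ t ^ (p - 1) ≤ Real.exp (θ t ^ p) := fun t => by
    have h0 := Real.rpow_nonneg (hθpos t).le p
    rcases le_total (θ t) 1 with h | h
    · exact (Real.rpow_le_one (hθpos t).le h (by linarith)).trans (Real.one_le_exp h0)
    · have h1 : θ t ^ (p - 1) ≤ θ t ^ p := Real.rpow_le_rpow_of_exponent_le h (by linarith)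
      linarith [Real.add_one_le_exp (θ t ^ p)]
  have hD : ContDiff ℝ ∞ fun t => Real.exp (-(2 * θ t ^ p)) :=
    (contDiff_const.mul (hθ.rpow_const_of_ne fun t => (hθpos t).ne')).neg.exp
  refine ⟨fun t => Real.exp (-(2 * θ t ^ p)), 2 * p * max M 1, hD, by positivity,
    fun t ht => ⟨?_, ?_, ?_⟩⟩
  · rw [← Real.exp_nat_mul, ← Real.exp_add]
    refine Real.exp_le_exp.2 ?_
    push_cast
    linarith [hθp t ht]
  · rw [← Real.exp_nat_mul]
    refine Real.exp_le_exp.2 ?_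
    push_cast
    linarith [Real.rpow_le_rpow ht (hθle t ht) hp0.le]
  · have h1 : HasDerivAt (fun t => Real.exp (-(2 * θ t ^ p)))
        (Real.exp (-(2 * θ t ^ p)) * -(2 * (deriv θ t * p * θ t ^ (p - 1)))) t :=
      ((((hθ.differentiable (by simp) t).hasDerivAt).rpow_const
        (Or.inl (hθpos t).ne')).const_mul 2).neg.exp
    rw [h1.deriv, abs_mul, abs_neg, abs_mul, abs_mul, abs_mul, Real.abs_exp, abs_of_pos hp0,
      abs_of_pos (Real.rpow_pos_of_pos (hθpos t) _), abs_two]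
    have h2 : Real.exp (-(2 * θ t ^ p)) * θ t ^ (p - 1) ≤ Real.exp (-t ^ p) := by
      refine (mul_le_mul_of_nonneg_left (hpow t) (Real.exp_pos _).le).trans ?_
      rw [← Real.exp_add]
      exact Real.exp_le_exp.2 (by linarith [Real.rpow_le_rpow ht (hθle t ht) hp0.le])
    have h3 := mul_le_mul h2 (hθd t ht) (abs_nonneg _) (Real.exp_pos _).le
    have h4 := mul_le_mul_of_nonneg_left h3 (by positivity : 0 ≤ 2 * p)
    linarith

/-- The super-Poincaré inequality, applied to a function weighted by the square of the density. -/
theorem IsGauge.exists_superPoincare {m l : ℕ} {X : Fin l → Rn (m + 1) → Rn (m + 1)}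
    {N : Rn (m + 1) → ℝ} {α p C : ℝ} {GN Gx : Rn (m + 1) → Rn l} {j : Fin l}
    (hg : IsGauge X N α p C GN Gx j) (hZ : Integrable (gaugeWeight N p)) {Q : ℝ}
    (hS : LocalSuperPoincare X (powerMeasure N p) Q) : ∃ C₄ : ℝ, 0 < C₄ ∧
    ∀ (f : Rn (m + 1) → ℝ) (G : Rn (m + 1) → Rn l), HasLipGrad X f G → HasCompactSupport f →
      (∀ ξ, 0 ≤ f ξ) → (∀ ξ, f ξ ≤ 1) → ∀ δ, 0 < δ →
      ∫ ξ, f ξ * gaugeWeight N p ξ ∂(powerMeasure N p) ≤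
        C₄ * (δ * (∫ ξ, ‖G ξ‖ ∂(powerMeasure N p)) + δ * (∫ ξ, f ξ ∂(powerMeasure N p)) +
          (1 + δ ^ (-Q)) * (powerMeasure N p).real {ξ | f ξ ≠ 0} ^ 2) := by
  have := isProbabilityMeasure_powerMeasure hZ
  set μ := powerMeasure N p with hμ
  set Z := ∫ ξ, gaugeWeight N p ξ with hZdef
  have hZ0 : 0 < Z := integral_gaugeWeight_pos hZ
  have hα := hg.alpha_pos
  have hp1 : 1 ≤ p := by linarith [hg.le_p, hg.alpha_pos]
  have hp0 : 0 < p := by linarith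
  have hC0 : 0 < C := by linarith [hg.one_le]
  have hw0 := gaugeWeight_pos N p
  have hwc : Continuous (gaugeWeight N p) :=
    Real.continuous_exp.comp (hg.continuous.rpow_const fun ξ => Or.inr hp0.le).neg
  obtain ⟨D, M, hD, hM, hDt⟩ := exists_smooth_weight hp1
  obtain ⟨β, Cβ, hβ, hS⟩ := hS
  have hDd : ∀ t, HasDerivAt D (deriv D t) t := fun t =>
    (hD.differentiable (by simp) t).hasDerivAt
  set M' := M * (C * C ^ α) with hM'
  have hM'0 : 0 ≤ M' := by positivity
  set C₄ := Real.exp 2 * (1 + M' + |Cβ| * Z) with hC₄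
  refine ⟨C₄, by positivity, fun f G hf hfc hf0 hf1 δ hδ => ?_⟩
  have hfcont : Continuous f := (hf j).continuous
  have hw1 : ∀ ξ, gaugeWeight N p ξ ≤ 1 := fun ξ => by
    rw [gaugeWeight, Real.exp_le_one_iff, neg_nonpos]
    exact Real.rpow_nonneg (hg.nonneg ξ) _
  have hDN : HasLipGrad X (fun ξ => D (N ξ)) fun ξ => deriv D (N ξ) • GN ξ :=
    HasLipGrad.comp hg.regular hg.gradN hD hDd
  have hDl : ∀ ξ, Real.exp (-2) * gaugeWeight N p ξ ^ 2 ≤ D (N ξ) := fun ξ =>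
    (hDt (N ξ) (hg.nonneg ξ)).1
  have hDu : ∀ ξ, D (N ξ) ≤ gaugeWeight N p ξ ^ 2 := fun ξ => (hDt (N ξ) (hg.nonneg ξ)).2.1
  have hDd' : ∀ ξ, |deriv D (N ξ)| ≤ M * gaugeWeight N p ξ := fun ξ =>
    (hDt (N ξ) (hg.nonneg ξ)).2.2
  have hD0 : ∀ ξ, 0 ≤ D (N ξ) := fun ξ =>
    (mul_nonneg (Real.exp_pos _).le (sq_nonneg _)).trans (hDl ξ)
  -- D(N) is comparable to the square of the density: the square root in the super-Poincaré
  -- inequality then produces μ itself, while the gradient terms still carry one full density.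
  have hh := HasLipGrad.mul hg.regular hf hDN
  have hhc : HasCompactSupport fun ξ => f ξ * D (N ξ) := hfc.mul_right
  have hhcont : Continuous fun ξ => f ξ * D (N ξ) := hfcont.mul (hD.continuous.comp hg.continuous)
  have h1 := hS δ hδ _ _ (hh.hasSobolevGrad hhcont hhc (powerMeasure_absolutelyContinuous N p))
  have ih : Integrable fun ξ => f ξ * D (N ξ) := hhcont.integrable_of_hasCompactSupport hhc
  have iGw := hf.integrable_norm_mul hfc hwc
  have ifw : Integrable fun ξ => f ξ * gaugeWeight N p ξ :=
    (hfcont.mul hwc).integrable_of_hasCompactSupport hfc.mul_right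
  have ifww : Integrable fun ξ => f ξ * gaugeWeight N p ξ * gaugeWeight N p ξ :=
    ((hfcont.mul hwc).mul hwc).integrable_of_hasCompactSupport hfc.mul_right.mul_right
  have iH : Integrable fun ξ => ‖D (N ξ) • G ξ + f ξ • deriv D (N ξ) • GN ξ‖ := by
    simpa using hh.integrable_norm_mul hhc (continuous_const (y := (1 : ℝ)))
  have iHv := (integrable_norm_iff hh.aestronglyMeasurable).1 iH
  set T := ∫ ξ, ‖G ξ‖ * gaugeWeight N p ξ with hT
  set S := ∫ ξ, f ξ * gaugeWeight N p ξ with hSdef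
  set P := ∫ ξ in {ξ | f ξ ≠ 0}, gaugeWeight N p ξ with hPdef
  have hT0 : 0 ≤ T := integral_nonneg fun ξ => mul_nonneg (norm_nonneg _) (hw0 ξ).le
  have hS0 : 0 ≤ S := integral_nonneg fun ξ => mul_nonneg (hf0 ξ) (hw0 ξ).le
  have hP0 : 0 ≤ P := integral_nonneg fun ξ => (hw0 ξ).le
  have hnm : MeasurableSet {ξ | f ξ ≠ 0} := (isOpen_ne_fun hfcont continuous_const).measurableSet
  have e1 : ∫⁻ ξ, ‖f ξ * D (N ξ)‖ₑ = ENNReal.ofReal (∫ ξ, f ξ * D (N ξ)) := by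
    rw [ofReal_integral_eq_lintegral_ofReal ih (ae_of_all _ fun ξ => mul_nonneg (hf0 ξ) (hD0 ξ))]
    exact lintegral_congr fun ξ => Real.enorm_of_nonneg (mul_nonneg (hf0 ξ) (hD0 ξ))
  have e2 : ∫⁻ ξ, ‖D (N ξ) • G ξ + f ξ • deriv D (N ξ) • GN ξ‖ₑ ≤
      ENNReal.ofReal (T + M' * S) := by
    rw [← ofReal_integral_norm_eq_lintegral_enorm iHv]
    refine ENNReal.ofReal_le_ofReal ?_
    rw [hT, hSdef, ← integral_const_mul, ← integral_add iGw (ifw.const_mul M')]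
    refine integral_mono_ae iH (iGw.add (ifw.const_mul M')) ?_
    filter_upwards [hg.upper] with ξ hξ
    have hGN : ‖GN ξ‖ ≤ C * C ^ α := by
      refine hξ.trans (mul_le_mul_of_nonneg_left ?_ hC0.le)
      rw [← Real.div_rpow (abs_nonneg _) (hg.nonneg ξ)]
      exact Real.rpow_le_rpow (div_nonneg (abs_nonneg _) (hg.nonneg ξ))
        (div_le_of_le_mul₀ (hg.nonneg ξ) hC0.le (hg.abs_le ξ)) hα.le
    refine (norm_add_le _ _).trans (add_le_add ?_ ?_)
    · rw [norm_smul, Real.norm_of_nonneg (hD0 ξ), mul_comm]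
      refine mul_le_mul_of_nonneg_left ((hDu ξ).trans ?_) (norm_nonneg _)
      rw [sq]
      exact mul_le_of_le_one_left (hw0 ξ).le (hw1 ξ)
    · rw [norm_smul, norm_smul, Real.norm_of_nonneg (hf0 ξ), Real.norm_eq_abs]
      have h2 := mul_le_mul (hDd' ξ) hGN (norm_nonneg _) (mul_nonneg hM (hw0 ξ).le)
      refine (mul_le_mul_of_nonneg_left h2 (hf0 ξ)).trans_eq ?_
      rw [hM']
      ring
  -- As f ≤ 1 and D(N) ≤ w², the square root is at most w on {f ≠ 0}, so the integral is at most Z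
  -- μ(f ≠ 0).
  have e3 : ∫⁻ ξ, ‖f ξ * D (N ξ)‖ₑ ^ (1 / 2 : ℝ) ≤ ENNReal.ofReal P := by
    rw [hPdef, ofReal_integral_eq_lintegral_ofReal hZ.integrableOn (ae_of_all _ fun ξ => (hw0 ξ).le),
      ← lintegral_indicator hnm]
    refine lintegral_mono fun ξ => ?_
    by_cases hξ : f ξ = 0
    · rw [hξ, zero_mul, enorm_zero, ENNReal.zero_rpow_of_pos (by norm_num)]
      exact zero_le
    · rw [indicator_of_mem (show ξ ∈ {ξ | f ξ ≠ 0} from hξ),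
        Real.enorm_of_nonneg (mul_nonneg (hf0 ξ) (hD0 ξ)),
        ENNReal.ofReal_rpow_of_nonneg (mul_nonneg (hf0 ξ) (hD0 ξ)) (by norm_num)]
      refine ENNReal.ofReal_le_ofReal ?_
      rw [← Real.sqrt_eq_rpow]
      refine Real.sqrt_le_iff.2 ⟨(hw0 ξ).le, ?_⟩
      exact (mul_le_of_le_one_left (hD0 ξ) (hf1 ξ)).trans (hDu ξ)
  have hδQ : 0 ≤ 1 + δ ^ (-Q) := by positivity
  have e4 : ENNReal.ofReal (∫ ξ, f ξ * D (N ξ)) ≤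
      ENNReal.ofReal (δ * (T + M' * S) + |Cβ| * (1 + δ ^ (-Q)) * P ^ 2) := by
    rw [← e1]
    refine h1.trans ?_
    rw [ENNReal.ofReal_add (by positivity) (by positivity), ENNReal.ofReal_mul hδ.le,
      ENNReal.ofReal_mul (by positivity), ENNReal.ofReal_pow hP0]
    refine add_le_add (mul_le_mul_right e2 _) (mul_le_mul' (ENNReal.ofReal_le_ofReal ?_) ?_)
    · exact (hβ δ hδ).trans (mul_le_mul_of_nonneg_right (le_abs_self _) hδQ)
    · exact pow_le_pow_left' e3 2
  have e5 := (ENNReal.ofReal_le_ofReal_iff (by positivity)).1 e4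
  have e6 : Real.exp (-2) * ∫ ξ, f ξ * gaugeWeight N p ξ * gaugeWeight N p ξ ≤
      ∫ ξ, f ξ * D (N ξ) := by
    rw [← integral_const_mul]
    refine integral_mono (ifww.const_mul _) ih fun ξ => ?_
    have := mul_le_mul_of_nonneg_left (hDl ξ) (hf0 ξ)
    refine le_trans (le_of_eq ?_) this
    ring
  have e7 : μ.real {ξ | f ξ ≠ 0} = Z⁻¹ * P := by
    have h3 := integral_powerMeasure N p ({ξ | f ξ ≠ 0}.indicator 1)
    rw [integral_indicator_one hnm] at h3
    rw [hμ, h3, hPdef, ← integral_indicator hnm]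
    congr 2
    ext ξ
    by_cases hξ : ξ ∈ {ξ | f ξ ≠ 0} <;> simp [hξ]
  rw [e7, integral_powerMeasure, integral_powerMeasure, integral_powerMeasure, ← hZdef, ← hT,
    ← hSdef]
  have e8 := e6.trans e5
  have e9 : ∫ ξ, f ξ * gaugeWeight N p ξ * gaugeWeight N p ξ ≤
      Real.exp 2 * (δ * (T + M' * S) + |Cβ| * (1 + δ ^ (-Q)) * P ^ 2) := by
    have := mul_le_mul_of_nonneg_left e8 (Real.exp_pos 2).le
    rwa [← mul_assoc, ← Real.exp_add, add_neg_cancel, Real.exp_zero, one_mul] at this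
  rw [inv_mul_le_iff₀ hZ0]
  refine e9.trans ?_
  have e10 : Z * (C₄ * (δ * (Z⁻¹ * T) + δ * (Z⁻¹ * S) + (1 + δ ^ (-Q)) * (Z⁻¹ * P) ^ 2)) =
      Real.exp 2 * ((1 + M' + |Cβ| * Z) * (δ * T + δ * S) +
        (1 + M' + |Cβ| * Z) * ((1 + δ ^ (-Q)) * P ^ 2 * Z⁻¹)) := by
    rw [hC₄]
    field_simp
  rw [e10]
  refine mul_le_mul_of_nonneg_left (add_le_add ?_ ?_) (Real.exp_pos 2).le
  · have : 0 ≤ (M' + |Cβ| * Z) * (δ * T) + (1 + |Cβ| * Z) * (δ * S) := by positivity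
    linarith
  · have h3 : |Cβ| * (1 + δ ^ (-Q)) * P ^ 2 = |Cβ| * Z * ((1 + δ ^ (-Q)) * P ^ 2 * Z⁻¹) := by
      field_simp
    rw [h3]
    exact mul_le_mul_of_nonneg_right (by linarith) (by positivity)

/-- The functional form of the isoperimetric inequality with a logarithmic factor. -/
theorem IsGauge.exists_log_cheeger {m l : ℕ} {X : Fin l → Rn (m + 1) → Rn (m + 1)}
    {N : Rn (m + 1) → ℝ} {α p C : ℝ} {GN Gx : Rn (m + 1) → Rn l} {j : Fin l}
    (hg : IsGauge X N α p C GN Gx j) {d : Rn (m + 1) → Rn (m + 1) → ℝ} (hd : IsProperMetric d)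
    (hdN : ∀ ξ, d 0 ξ ≤ C * N ξ) (hNd : ∀ ξ, N ξ ≤ C * d 0 ξ)
    (hZ : Integrable (gaugeWeight N p)) (hP : LocalPoincare d X) {Q : ℝ} (hQ : 0 < Q)
    (hS : LocalSuperPoincare X (powerMeasure N p) Q) : ∃ C₅ : ℝ, 0 < C₅ ∧
    ∀ (f : Rn (m + 1) → ℝ) (G : Rn (m + 1) → Rn l), HasLipGrad X f G → HasCompactSupport f →
      (∀ ξ, 0 ≤ f ξ) → (∀ ξ, f ξ ≤ 1) → ∀ s, 0 < s → s ≤ 1 / 2 →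
      (powerMeasure N p).real {ξ | f ξ ≠ 0} ≤ 3 / 2 * s →
      s / 2 ≤ ∫ ξ, f ξ ∂(powerMeasure N p) →
      s * (1 - Real.log s) ^ (gaugeExp α p / p) ≤ C₅ * ∫ ξ, ‖G ξ‖ ∂(powerMeasure N p) := by
  have := isProbabilityMeasure_powerMeasure hZ
  obtain ⟨C₂, hC₂, hche⟩ := hg.exists_cheeger hd hdN hNd hZ hP
  obtain ⟨C₄, hC₄, hsup⟩ := hg.exists_superPoincare hZ hS
  have hα := hg.alpha_pos
  have hp0 : 0 < p := by linarith [hg.le_p]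
  have hκ : 0 ≤ gaugeExp α p := div_nonneg (by linarith [hg.le_p]) (by linarith)
  set κ := gaugeExp α p with hκdef
  set q := κ / p with hq
  have hq0 : 0 ≤ q := by positivity
  -- With δ = s^σ the growth δ^{-Q} costs s^{-σQ}; since 1 - σQ = 1/2 + σ, one factor s pays for it
  -- and leaves at most s^σ.
  set σ := 1 / (2 * Q + 2) with hσ
  have hσ0 : 0 < σ := by positivity
  have hσQ : σ * Q + σ = 1 / 2 := by rw [hσ]; field_simp
  obtain ⟨K, hK, hKL⟩ := exists_one_add_rpow_le_exp hq0 (half_pos hσ0)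
  -- Chosen so that 1 + L ≤ A · (σ/2) L whenever L ≥ log 2, that is s ≤ 1/2.
  set A := (1 + 2 / σ * (1 + 1 / Real.log 2)) with hA
  have hlog2 : 0 < Real.log 2 := Real.log_pos one_lt_two
  have hA0 : 0 < A := by positivity
  refine ⟨4 * C₂ * A ^ q + K * (4 * C₄ * (1 + 10 * C₂)), by positivity,
    fun f G hf hfc hf0 hf1 s hs hs2 hfs hfi => ?_⟩
  set μ := powerMeasure N p with hμ
  set T := ∫ ξ, ‖G ξ‖ ∂μ with hT
  have hT0 : 0 ≤ T := integral_nonneg fun ξ => norm_nonneg _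
  have hfcont : Continuous f := (hf j).continuous
  have hNc := hg.continuous
  have hNκ : Continuous fun ξ => N ξ ^ κ := hNc.rpow_const fun ξ => Or.inr hκ
  have hNp : Continuous fun ξ => N ξ ^ p := hNc.rpow_const fun ξ => Or.inr hp0.le
  have hwc : Continuous (gaugeWeight N p) := Real.continuous_exp.comp hNp.neg
  have hw0 := gaugeWeight_pos N p
  have icc : ∀ F : Rn (m + 1) → ℝ, Continuous F → HasCompactSupport F → Integrable F μ :=
    fun F h1 h2 => h1.integrable_of_hasCompactSupport h2
  have if' : Integrable f μ := icc f hfcont hfc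
  have ifκ : Integrable (fun ξ => f ξ * (1 + N ξ ^ κ)) μ :=
    icc _ (hfcont.mul (continuous_const.add hNκ)) hfc.mul_right
  have ifw : Integrable (fun ξ => f ξ * gaugeWeight N p ξ) μ :=
    icc _ (hfcont.mul hwc) hfc.mul_right
  have hL : Real.log 2 ≤ -Real.log s := by
    rw [← Real.log_inv]
    refine Real.log_le_log two_pos ?_
    rw [le_inv_comm₀ two_pos hs, ← one_div]
    exact hs2
  set L := -Real.log s with hLdef
  have hL0 : 0 < L := hlog2.trans_le hL
  -- The support of f has measure at most 3s/2 ≤ 3/4, so the Cheeger inequality applies.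
  have hzero : 1 / 4 ≤ μ.real {ξ | f ξ = 0} := by
    have hm : MeasurableSet {ξ | f ξ ≠ 0} := (isOpen_ne_fun hfcont continuous_const).measurableSet
    have h1 := probReal_compl_eq_one_sub (μ := μ) hm
    have h2 : {ξ | f ξ ≠ 0}ᶜ = {ξ | f ξ = 0} := by ext; simp
    rw [h2] at h1
    rw [h1]
    linarith
  have h1 := hche f G hf hfc hf0 hzero
  have hNκ0 : ∀ ξ, 0 ≤ N ξ ^ κ := fun ξ => Real.rpow_nonneg (hg.nonneg ξ) _
  have hfT : ∫ ξ, f ξ ∂μ ≤ C₂ * T := le_trans (integral_mono if' ifκ fun ξ =>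
    le_mul_of_one_le_right (hf0 ξ) (by linarith [hNκ0 ξ])) h1
  have hsT : s ≤ 2 * C₂ * T := by linarith
  have hAq : (0 : ℝ) ≤ A ^ q := by positivity
  have hgoal : (1 - Real.log s) = 1 + L := by rw [hLdef]; ring
  rw [hgoal]
  -- On E the weight satisfies N^κ ≥ (σL/2)^{κ/p}; off E the density is at least e^{-σL/2} =
  -- s^{σ/2}. One of the two parts carries at least s/4 of the integral of f.
  set E := {ξ | σ / 2 * L ≤ N ξ ^ p} with hE
  have hEm : MeasurableSet E := (isClosed_le continuous_const hNp).measurableSet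
  have hsplit := integral_add_compl hEm if'
  rcases le_total (s / 4) (∫ ξ in E, f ξ ∂μ) with hcase | hcase
  · have h2 : (σ / 2 * L) ^ q * (s / 4) ≤ C₂ * T := by
      refine le_trans ?_ h1
      refine le_trans (mul_le_mul_of_nonneg_left hcase (by positivity)) ?_
      rw [← integral_const_mul]
      refine le_trans (setIntegral_mono_on (if'.integrableOn.const_mul _) ifκ.integrableOn hEm
        fun ξ hξ => ?_) (setIntegral_le_integral ifκ (ae_of_all _ fun ξ =>
          mul_nonneg (hf0 ξ) (by linarith [hNκ0 ξ])))
      have h3 := Real.rpow_le_rpow (by positivity) hξ hq0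
      rw [← Real.rpow_mul (hg.nonneg ξ), hq, mul_div_cancel₀ _ hp0.ne'] at h3
      rw [mul_comm]
      exact mul_le_mul_of_nonneg_left (by linarith) (hf0 ξ)
    have h3 : (1 + L) ^ q ≤ A ^ q * (σ / 2 * L) ^ q := by
      rw [← Real.mul_rpow (by positivity) (by positivity)]
      refine Real.rpow_le_rpow (by positivity) ?_ hq0
      have h4 : 1 ≤ 1 / Real.log 2 * L := by
        rw [one_div, inv_mul_eq_div, le_div_iff₀ hlog2]
        linarith
      have h5 : A * (σ / 2 * L) = σ / 2 * L + (L + 1 / Real.log 2 * L) := by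
        rw [hA]
        field_simp
      rw [h5]
      have : 0 < σ / 2 * L := by positivity
      linarith
    have h4 := mul_le_mul_of_nonneg_left h3 hs.le
    have h5 := mul_le_mul_of_nonneg_left h2 (mul_nonneg zero_le_four hAq)
    have h6 : 0 ≤ K * (4 * C₄ * (1 + 10 * C₂)) * T := by positivity
    linarith
  · have hcase' : s / 4 ≤ ∫ ξ in Eᶜ, f ξ ∂μ := by linarith
    have hexp : Real.exp (-(σ / 2 * L)) = s ^ (σ / 2) := by
      rw [Real.rpow_def_of_pos hs, hLdef]
      congr 1
      ring
    have h2 : s ^ (σ / 2) * (s / 4) ≤ ∫ ξ, f ξ * gaugeWeight N p ξ ∂μ := by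
      refine le_trans (mul_le_mul_of_nonneg_left hcase' (by positivity)) ?_
      rw [← integral_const_mul]
      refine le_trans (setIntegral_mono_on (if'.integrableOn.const_mul _) ifw.integrableOn
        hEm.compl fun ξ hξ => ?_) (setIntegral_le_integral ifw (ae_of_all _ fun ξ =>
          mul_nonneg (hf0 ξ) (hw0 ξ).le))
      rw [mul_comm, ← hexp]
      refine mul_le_mul_of_nonneg_left (Real.exp_le_exp.2 (neg_le_neg ?_)) (hf0 ξ)
      have hξ' : ¬ σ / 2 * L ≤ N ξ ^ p := hξ
      exact (not_le.1 hξ').le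
    -- Off E the super-Poincaré inequality is used with δ = s^σ. All its terms are then at most s^σ
    -- times a multiple of T, because ∫ f and s are themselves at most multiples of T.
    have h3 := h2.trans (hsup f G hf hfc hf0 hf1 (s ^ σ) (by positivity))
    rw [← hT] at h3
    have hsσ : 0 < s ^ σ := by positivity
    have h4 : (1 + (s ^ σ) ^ (-Q)) * μ.real {ξ | f ξ ≠ 0} ^ 2 ≤ s ^ σ * (9 * C₂ * T) := by
      have k1 : μ.real {ξ | f ξ ≠ 0} ^ 2 ≤ (3 / 2 * s) ^ 2 :=
        pow_le_pow_left₀ measureReal_nonneg hfs 2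
      have k2 : (s ^ σ) ^ (-Q) = s ^ (-(σ * Q)) := by
        rw [← Real.rpow_mul hs.le]
        congr 1
        ring
      have k3 : (1 : ℝ) ≤ s ^ (-(σ * Q)) := Real.one_le_rpow_of_pos_of_le_one_of_nonpos hs
        (by linarith) (by rw [neg_nonpos]; positivity)
      have k4 : s ^ (-(σ * Q)) * s ≤ s ^ σ := by
        have : s ^ (-(σ * Q)) * s = s ^ (-(σ * Q) + 1) := by
          rw [Real.rpow_add hs, Real.rpow_one]
        rw [this]
        exact Real.rpow_le_rpow_of_exponent_ge hs (by linarith) (by linarith)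
      rw [k2]
      calc (1 + s ^ (-(σ * Q))) * μ.real {ξ | f ξ ≠ 0} ^ 2
          ≤ (2 * s ^ (-(σ * Q))) * (3 / 2 * s) ^ 2 :=
            mul_le_mul (by linarith) k1 (by positivity) (by positivity)
        _ = 9 / 2 * (s ^ (-(σ * Q)) * s) * s := by ring
        _ ≤ 9 / 2 * s ^ σ * (2 * C₂ * T) := by gcongr
        _ = _ := by ring
    have h5 : s ^ (σ / 2) * (s / 4) ≤ s ^ σ * (C₄ * (1 + 10 * C₂) * T) := by
      refine h3.trans ?_
      have k1 := mul_le_mul_of_nonneg_left hfT hsσ.le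
      have k2 : s ^ σ * T + s ^ σ * ∫ ξ, f ξ ∂μ + (1 + (s ^ σ) ^ (-Q)) *
          μ.real {ξ | f ξ ≠ 0} ^ 2 ≤ s ^ σ * T + s ^ σ * (C₂ * T) + s ^ σ * (9 * C₂ * T) := by
        linarith
      have k3 := mul_le_mul_of_nonneg_left k2 hC₄.le
      linarith
    -- Cancelling s^{σ/2} leaves the gain s^{-σ/2} = e^{σL/2}, which beats every power of 1 + L.
    have h6 : s * Real.exp (σ / 2 * L) ≤ 4 * C₄ * (1 + 10 * C₂) * T := by
      have k1 : s ^ σ = s ^ (σ / 2) * s ^ (σ / 2) := by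
        rw [← Real.rpow_add hs, add_halves]
      have k2 : Real.exp (σ / 2 * L) * s ^ (σ / 2) = 1 := by
        rw [← hexp, ← Real.exp_add, add_neg_cancel, Real.exp_zero]
      rw [k1, mul_assoc] at h5
      have k3 := le_of_mul_le_mul_left h5 (by positivity)
      have k4 := mul_le_mul_of_nonneg_left k3 (Real.exp_pos (σ / 2 * L)).le
      rw [← mul_assoc, k2] at k4
      linarith
    have h7 := mul_le_mul_of_nonneg_left (hKL L hL0.le) hs.le
    have h8 := mul_le_mul_of_nonneg_left h6 hK.le
    have h9 : 0 ≤ 4 * C₂ * A ^ q * T := by positivity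
    linarith

/-! ### From the functional inequality to the isoperimetric profile. -/

section LocalSlope

variable {d : Rn n → Rn n → ℝ}

lemma localSlope_eq_zero {f : Rn n → ℝ} {ξ : Rn n} [(𝓝[≠] ξ).NeBot]
    (hf : f =ᶠ[𝓝 ξ] fun _ => f ξ) : localSlope d f ξ = 0 := by
  have h : (fun η => |f ξ - f η| / d ξ η) =ᶠ[𝓝[≠] ξ] fun _ => (0 : ℝ) := by
    filter_upwards [hf.filter_mono nhdsWithin_le_nhds] with η hη
    rw [hη, sub_self, abs_zero, zero_div]
  rw [localSlope, limsup_congr h, limsup_const]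

lemma localSlope_le (hd : IsProperMetric d) {f : Rn n → ℝ} {K : ℝ}
    (hf : ∀ ξ η, |f ξ - f η| ≤ K * d ξ η) (ξ : Rn n) [(𝓝[≠] ξ).NeBot] : localSlope d f ξ ≤ K := by
  refine limsup_le_of_le ?_ ?_
  -- A real `limsup` is meaningful only under a bound of this kind; here the quotients are
  -- nonnegative and the punctured neighbourhood filter is nontrivial.
  · exact IsCoboundedUnder.of_frequently_ge (a := 0) (Eventually.frequently
      (Eventually.of_forall fun η => div_nonneg (abs_nonneg _) (hd.nonneg ξ η)))
  · filter_upwards [self_mem_nhdsWithin] with η hη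
    have h0 : 0 < d ξ η := (hd.nonneg ξ η).lt_of_ne fun h =>
      hη ((hd.eq_zero_iff ξ η).1 h.symm).symm
    exact (div_le_iff₀ h0).2 (hf ξ η)

/-- A Lipschitz function has a weak subgradient that is bounded by the Lipschitz constant, and that
vanishes where the function is locally constant. -/
lemma MetricRelatedTo.exists_hasLipGrad {m l : ℕ} {d : Rn (m + 1) → Rn (m + 1) → ℝ}
    {X : Fin l → Rn (m + 1) → Rn (m + 1)} (h : MetricRelatedTo d X) (hd : IsProperMetric d)
    {f : Rn (m + 1) → ℝ} {K : ℝ} (hK : 0 ≤ K) (hf : ∀ ξ η, |f ξ - f η| ≤ K * d ξ η)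
    {W : Set (Rn (m + 1))} (hW : ∀ ξ ∉ W, f =ᶠ[𝓝 ξ] fun _ => f ξ) :
    ∃ G : Rn (m + 1) → Rn l, HasLipGrad X f G ∧ ∀ᵐ ξ, ‖G ξ‖ ≤ W.indicator (fun _ => K) ξ := by
  obtain ⟨G, hG, hs⟩ := h f ⟨K, hf⟩
  have hb : ∀ᵐ ξ, ‖G ξ‖ ≤ W.indicator (fun _ => K) ξ := by
    filter_upwards [hs] with ξ hξ
    rw [hξ]
    by_cases hw : ξ ∈ W
    · rw [indicator_of_mem hw]
      exact localSlope_le hd hf ξ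
    · rw [indicator_of_notMem hw, localSlope_eq_zero (hW ξ hw)]
  refine ⟨G, fun i => ⟨hd.continuous_of_lipschitz hf, hG i, fun R => ⟨K, ?_⟩⟩, hb⟩
  filter_upwards [hb] with ξ hξ _
  exact (Rn.abs_apply_le (G ξ) i).trans (hξ.trans (indicator_le_self' (fun _ _ => hK) ξ))

end LocalSlope

lemma abs_clamp_sub_clamp_le (a b : ℝ) : |max 0 (min 1 a) - max 0 (min 1 b)| ≤ |a - b| := by
  have h1 := abs_max_sub_max_le_max 0 (min 1 a) 0 (min 1 b)
  have h2 := abs_min_sub_min_le_max 1 a 1 b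
  rw [sub_self, abs_zero, max_eq_right (a := (0 : ℝ)) (b := |_|) (abs_nonneg _)] at h1 h2
  exact h1.trans h2

/-- Cutoff functions with small gradients. -/
lemma IsProperMetric.exists_cutoff {m l : ℕ} {d : Rn (m + 1) → Rn (m + 1) → ℝ}
    {X : Fin l → Rn (m + 1) → Rn (m + 1)} (hd : IsProperMetric d) (h : MetricRelatedTo d X) {k : ℝ}
    (hk : 0 < k) : ∃ (χ : Rn (m + 1) → ℝ) (H : Rn (m + 1) → Rn l), HasLipGrad X χ H ∧
      Continuous χ ∧ HasCompactSupport χ ∧ (∀ ξ, 0 ≤ χ ξ) ∧ (∀ ξ, χ ξ ≤ 1) ∧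
      (∀ ξ, d 0 ξ ≤ k → χ ξ = 1) ∧ ∀ᵐ ξ, ‖H ξ‖ ≤ k⁻¹ := by
  set χ : Rn (m + 1) → ℝ := fun ξ => max 0 (min 1 (2 - d 0 ξ / k)) with hχ
  have hlip : ∀ ξ η, |χ ξ - χ η| ≤ k⁻¹ * d ξ η := fun ξ η => by
    refine (abs_clamp_sub_clamp_le _ _).trans ?_
    rw [sub_sub_sub_cancel_left, ← sub_div, abs_div, abs_of_pos hk, div_eq_inv_mul, abs_sub_comm]
    exact mul_le_mul_of_nonneg_left (hd.abs_sub_le 0 ξ η) (inv_pos.2 hk).le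
  obtain ⟨H, hH, hHb⟩ := h.exists_hasLipGrad hd (inv_pos.2 hk).le hlip (W := univ) (by simp)
  refine ⟨χ, H, hH, hd.continuous_of_lipschitz hlip, ?_, fun ξ => le_max_left _ _,
    fun ξ => max_le zero_le_one (min_le_left _ _), fun ξ hξ => ?_, by simpa using hHb⟩
  · refine HasCompactSupport.of_support_subset_isCompact
      (hd.isBounded_ball 0 (2 * k)).isCompact_closure fun ξ hξ => subset_closure ?_
    by_contra hlt
    have h1 : 2 * k ≤ d 0 ξ := not_lt.1 hlt
    refine hξ (max_eq_left ((min_le_right _ _).trans ?_))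
    rw [sub_nonpos, le_div_iff₀ hk]
    exact h1
  · have h1 : d 0 ξ / k ≤ 1 := (div_le_one hk).2 hξ
    show max 0 (min 1 (2 - d 0 ξ / k)) = 1
    rw [min_eq_left (by linarith), max_eq_right zero_le_one]

/-- A functional inequality for compactly supported functions extends to Lipschitz functions. -/
lemma le_of_functional {m l : ℕ} {d : Rn (m + 1) → Rn (m + 1) → ℝ}
    {X : Fin l → Rn (m + 1) → Rn (m + 1)} (hX : ∀ i, IsRegularField (X i)) (hd : IsProperMetric d)
    (h : MetricRelatedTo d X) {μ : Measure (Rn (m + 1))} [IsProbabilityMeasure μ]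
    (hμ : μ ≪ volume) {a s C : ℝ} (hC : 0 < C)
    (hfun : ∀ (f : Rn (m + 1) → ℝ) (G : Rn (m + 1) → Rn l), HasLipGrad X f G →
      HasCompactSupport f → (∀ ξ, 0 ≤ f ξ) → (∀ ξ, f ξ ≤ 1) → μ.real {ξ | f ξ ≠ 0} ≤ 3 / 2 * s →
      s / 2 ≤ ∫ ξ, f ξ ∂μ → a ≤ C * ∫ ξ, ‖G ξ‖ ∂μ)
    {u : Rn (m + 1) → ℝ} {K : ℝ} (hK : 0 ≤ K) (hu : ∀ ξ η, |u ξ - u η| ≤ K * d ξ η)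
    (hu0 : ∀ ξ, 0 ≤ u ξ) (hu1 : ∀ ξ, u ξ ≤ 1) {W : Set (Rn (m + 1))} (hWm : MeasurableSet W)
    (hW : ∀ ξ ∉ W, u =ᶠ[𝓝 ξ] fun _ => u ξ) (hus : μ.real {ξ | u ξ ≠ 0} ≤ 3 / 2 * s)
    (hui : s / 2 < ∫ ξ, u ξ ∂μ) : a ≤ C * (K * μ.real W) := by
  obtain ⟨G, hG, hGb⟩ := h.exists_hasLipGrad hd hK hu hW
  have hk : ∀ k : ℕ, (0 : ℝ) < k + 1 := fun k => by positivity
  choose χ H hχ hχc hχs hχ0 hχ1 hχk hH using fun k : ℕ => hd.exists_cutoff h (hk k)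
  have huc : Continuous u := hd.continuous_of_lipschitz hu
  have hlim : Tendsto (fun k => ∫ ξ, u ξ * χ k ξ ∂μ) atTop (𝓝 (∫ ξ, u ξ ∂μ)) := by
    refine tendsto_integral_of_dominated_convergence (fun _ => 1)
      (fun k => (huc.mul (hχc k)).aestronglyMeasurable) (integrable_const _) (fun k =>
        ae_of_all _ fun ξ => ?_) (ae_of_all _ fun ξ => ?_)
    · rw [Real.norm_of_nonneg (mul_nonneg (hu0 ξ) (hχ0 k ξ))]
      exact mul_le_one₀ (hu1 ξ) (hχ0 k ξ) (hχ1 k ξ)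
    · refine tendsto_const_nhds.congr' ?_
      filter_upwards [eventually_ge_atTop ⌈d 0 ξ⌉₊] with k hk'
      have h1 : d 0 ξ ≤ k := (Nat.le_ceil _).trans (by exact_mod_cast hk')
      rw [hχk k ξ (by linarith), mul_one]
  -- The strict inequality leaves room for truncation: for large k the truncated function still has
  -- integral at least s/2.
  have hev := (tendsto_order.1 hlim).1 _ hui
  -- Each cutoff adds at most 1/(k+1) to the gradient, an error that disappears in the limit since μ
  -- is a probability measure.
  have hlim2 : Tendsto (fun k : ℕ => C * (K * μ.real W + ((k : ℝ) + 1)⁻¹)) atTop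
      (𝓝 (C * (K * μ.real W + 0))) :=
    ((tendsto_inv_natCast_add_one).const_add _).const_mul _
  rw [add_zero] at hlim2
  refine ge_of_tendsto hlim2 ?_
  filter_upwards [hev] with k hik
  have h1 := HasLipGrad.mul hX hG (hχ k)
  have h2 : HasCompactSupport fun ξ => u ξ * χ k ξ := (hχs k).mul_left
  have h3 := hfun _ _ h1 h2 (fun ξ => mul_nonneg (hu0 ξ) (hχ0 k ξ))
    (fun ξ => mul_le_one₀ (hu1 ξ) (hχ0 k ξ) (hχ1 k ξ))
    ((measureReal_mono fun ξ hξ => left_ne_zero_of_mul hξ).trans hus) hik.le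
  refine h3.trans (mul_le_mul_of_nonneg_left ?_ hC.le)
  have iW : Integrable (fun ξ => W.indicator (fun _ => K) ξ + ((k : ℝ) + 1)⁻¹) μ :=
    ((integrable_const K).indicator hWm).add (integrable_const _)
  refine (integral_mono_of_nonneg (ae_of_all _ fun ξ => norm_nonneg _) iW (hμ.ae_le ?_)).trans ?_
  · filter_upwards [hGb, hH k] with ξ b1 b2
    refine (norm_add_le _ _).trans (add_le_add ?_ ?_)
    · rw [norm_smul, Real.norm_of_nonneg (hχ0 k ξ)]
      exact (mul_le_of_le_one_left (norm_nonneg _) (hχ1 k ξ)).trans b1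
    · rw [norm_smul, Real.norm_of_nonneg (hu0 ξ)]
      exact (mul_le_of_le_one_left (norm_nonneg _) (hu1 ξ)).trans b2
  · rw [integral_add ((integrable_const K).indicator hWm) (integrable_const _),
      integral_indicator_const _ hWm, integral_const]
    simp [mul_comm]

/-- The distance from `A`. -/
noncomputable def setDist (d : Rn n → Rn n → ℝ) (A : Set (Rn n)) (ξ : Rn n) : ℝ := ⨅ a : A, d ξ a

namespace IsProperMetric

variable {d : Rn n → Rn n → ℝ} {A : Set (Rn n)}

lemma bddBelow_range_dist (hd : IsProperMetric d) (ξ : Rn n) :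
    BddBelow (range fun a : A => d ξ a) := ⟨0, by rintro _ ⟨_, rfl⟩; exact hd.nonneg _ _⟩

lemma setDist_eq_zero (hd : IsProperMetric d) {ξ : Rn n} (hξ : ξ ∈ A) : setDist d A ξ = 0 :=
  le_antisymm ((ciInf_le (hd.bddBelow_range_dist ξ) ⟨ξ, hξ⟩).trans_eq (hd.self ξ))
    (Real.iInf_nonneg fun _ => hd.nonneg _ _)

/-- The strict inequality makes the two sides agree although the infimum need not be attained. -/
lemma setDist_lt_iff (hd : IsProperMetric d) (hA : A.Nonempty) {ξ : Rn n} {ε : ℝ} :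
    setDist d A ξ < ε ↔ ξ ∈ enlargement d A ε := by
  have := hA.to_subtype
  rw [setDist, ciInf_lt_iff (hd.bddBelow_range_dist ξ)]
  simp [enlargement]

lemma abs_setDist_sub_le (hd : IsProperMetric d) (hA : A.Nonempty) (ξ η : Rn n) :
    |setDist d A ξ - setDist d A η| ≤ d ξ η := by
  have := hA.to_subtype
  have key : ∀ ξ η, setDist d A ξ ≤ setDist d A η + d ξ η := fun ξ η => by
    rw [← sub_le_iff_le_add]
    refine le_ciInf fun a => ?_
    rw [sub_le_iff_le_add]
    exact (ciInf_le (hd.bddBelow_range_dist ξ) a).trans (by linarith [hd.triangle ξ η a])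
  rw [abs_le]
  have h1 := key ξ η
  have h2 := key η ξ
  rw [hd.symm η ξ] at h2
  constructor <;> linarith

/-- A Lipschitz function that is `1` near `A` and `0` near the complement of `A_ε`. -/
lemma exists_indicator_approx (hd : IsProperMetric d) (hA : A.Nonempty) {ε : ℝ} (hε : 0 < ε) :
    ∃ f : Rn n → ℝ, (∀ ξ η, |f ξ - f η| ≤ 2 / ε * d ξ η) ∧ (∀ ξ, 0 ≤ f ξ) ∧ (∀ ξ, f ξ ≤ 1) ∧
      (∀ ξ ∈ A, f =ᶠ[𝓝 ξ] fun _ => 1) ∧ ∀ ξ ∉ enlargement d A ε, f =ᶠ[𝓝 ξ] fun _ => 0 := by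
  have hc : Continuous (setDist d A) :=
    hd.continuous_of_lipschitz (K := 1) fun ξ η => by
      rw [one_mul]
      exact hd.abs_setDist_sub_le hA ξ η
  -- The function is 1 up to distance ε/4 and 0 beyond 3ε/4. These margins make it locally constant
  -- on A and off A_ε, so its gradient is supported in A_ε \ A.
  refine ⟨fun ξ => max 0 (min 1 (3 / 2 - 2 / ε * setDist d A ξ)), fun ξ η => ?_,
    fun ξ => le_max_left _ _, fun ξ => max_le zero_le_one (min_le_left _ _), fun ξ hξ => ?_,
    fun ξ hξ => ?_⟩
  · refine (abs_clamp_sub_clamp_le _ _).trans ?_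
    rw [sub_sub_sub_cancel_left, ← mul_sub, abs_mul, abs_of_pos (by positivity : 0 < 2 / ε),
      abs_sub_comm]
    exact mul_le_mul_of_nonneg_left (hd.abs_setDist_sub_le hA ξ η) (by positivity)
  · have h1 : setDist d A ξ < ε / 4 := by
      rw [hd.setDist_eq_zero hξ]
      positivity
    filter_upwards [hc.continuousAt.eventually (gt_mem_nhds h1)] with η hη
    have h2 : 2 / ε * setDist d A η ≤ 1 / 2 := by
      rw [div_mul_eq_mul_div, div_le_iff₀ hε]
      linarith
    rw [min_eq_left (by linarith), max_eq_right zero_le_one]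
  · rw [← hd.setDist_lt_iff hA, not_lt] at hξ
    have h1 : 3 / 4 * ε < setDist d A ξ := by linarith
    filter_upwards [hc.continuousAt.eventually (lt_mem_nhds h1)] with η hη
    have h2 : 3 / 2 ≤ 2 / ε * setDist d A η := by
      rw [div_mul_eq_mul_div, le_div_iff₀ hε]
      linarith
    exact max_eq_left ((min_le_right _ _).trans (by linarith))

lemma isOpen_enlargement (hd : IsProperMetric d) (A : Set (Rn n)) (ε : ℝ) :
    IsOpen (enlargement d A ε) := by
  have : enlargement d A ε = ⋃ a ∈ A, {η | d a η < ε} := by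
    ext η
    simp [enlargement, hd.symm η]
  rw [this]
  exact isOpen_biUnion fun a _ => hd.isOpen_ball a ε

lemma subset_enlargement (hd : IsProperMetric d) (A : Set (Rn n)) {ε : ℝ} (hε : 0 < ε) :
    A ⊆ enlargement d A ε := fun ξ hξ => ⟨ξ, hξ, by rwa [hd.self]⟩

end IsProperMetric

/-- A functional inequality for compactly supported functions bounds the isoperimetric profile from
below. -/
theorem le_isoProfile_of_functional {m l : ℕ} {d : Rn (m + 1) → Rn (m + 1) → ℝ}
    {X : Fin l → Rn (m + 1) → Rn (m + 1)} (hX : ∀ i, IsRegularField (X i)) (hd : IsProperMetric d)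
    (h : MetricRelatedTo d X) {μ : Measure (Rn (m + 1))} [IsProbabilityMeasure μ]
    (hμ : μ ≪ volume) {a t C : ℝ} (hC : 0 < C) (ht0 : 0 < t) (ht1 : t < 1)
    (hfun : ∀ (f : Rn (m + 1) → ℝ) (G : Rn (m + 1) → Rn l), HasLipGrad X f G →
      HasCompactSupport f → (∀ ξ, 0 ≤ f ξ) → (∀ ξ, f ξ ≤ 1) →
      μ.real {ξ | f ξ ≠ 0} ≤ 3 / 2 * min t (1 - t) →
      min t (1 - t) / 2 ≤ ∫ ξ, f ξ ∂μ → a ≤ C * ∫ ξ, ‖G ξ‖ ∂μ) :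
    ENNReal.ofReal (a / (2 * C)) ≤ isoProfile d μ t := by
  refine le_iInf fun A => le_iInf fun hAm => le_iInf fun hAt => ?_
  set s := min t (1 - t) with hs
  have hs0 : 0 < s := lt_min ht0 (by linarith)
  have hAt' : μ.real A = t := by rw [measureReal_def, hAt, ENNReal.toReal_ofReal ht0.le]
  have hA : A.Nonempty := by
    rw [nonempty_iff_ne_empty]
    rintro rfl
    simp [ht0.ne] at hAt'
  -- Below this threshold s/(4ε) exceeds a/(2C), so the bound is immediate once the enlargement adds
  -- mass more than s/4.
  have hε₀ : 0 < s * C / (2 * (|a| + 1)) := by positivity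
  refine le_liminf_of_le (by isBoundedDefault) ?_
  filter_upwards [Ioo_mem_nhdsGT hε₀] with ε ⟨hε, hε'⟩
  set E := enlargement d A ε with hE
  have hEm : MeasurableSet E := (hd.isOpen_enlargement A ε).measurableSet
  have hAE : A ⊆ E := hd.subset_enlargement A hε
  have hW : μ.real (E \ A) = μ.real E - t := by
    rw [measureReal_sdiff hAE hAm, hAt']
  have hE1 : μ.real E ≤ 1 := measureReal_le_one
  have htE : t ≤ μ.real E := hAt' ▸ measureReal_mono hAE
  suffices hmain : a / (2 * C) ≤ (μ.real E - t) / ε by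
    refine (ENNReal.ofReal_le_ofReal hmain).trans_eq ?_
    rw [ENNReal.ofReal_div_of_pos hε, ENNReal.ofReal_sub _ ht0.le, ofReal_measureReal, hAt]
  by_cases hP : μ.real E - t ≤ s / 4
  · obtain ⟨f, hf, hf0, hf1, hfA, hfE⟩ := hd.exists_indicator_approx hA hε
    have hfc : Continuous f := hd.continuous_of_lipschitz hf
    have hfi : Integrable f μ := Integrable.of_bound hfc.aestronglyMeasurable 1
      (ae_of_all _ fun ξ => by
        rw [Real.norm_of_nonneg (hf0 ξ)]
        exact hf1 ξ)
    have hfA' : ∀ ξ ∈ A, f ξ = 1 := fun ξ hξ => (hfA ξ hξ).self_of_nhds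
    have hfE' : ∀ ξ ∉ E, f ξ = 0 := fun ξ hξ => (hfE ξ hξ).self_of_nhds
    have hloc : ∀ ξ ∉ E \ A, f =ᶠ[𝓝 ξ] fun _ => f ξ := fun ξ hξ => by
      by_cases hξE : ξ ∈ E
      · have hξA : ξ ∈ A := by
          by_contra hc
          exact hξ ⟨hξE, hc⟩
        rw [hfA' ξ hξA]
        exact hfA ξ hξA
      · rw [hfE' ξ hξE]
        exact hfE ξ hξE
    have hε2 : 0 ≤ 2 / ε := by positivity
    have h1 : a ≤ C * (2 / ε * μ.real (E \ A)) := by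
      -- The test function must resemble the indicator of the smaller of A and its complement: f
      -- when t ≤ 1/2, and 1 - f otherwise. The added mass is at most s/4, which keeps the support
      -- below 3s/2 and the integral above s/2.
      rcases le_total t (1 - t) with htt | htt
      · rw [min_eq_left htt] at hs
        refine le_of_functional hX hd h hμ hC hfun hε2 hf hf0 hf1 (hEm.diff hAm) hloc ?_ ?_
        · refine (measureReal_mono (show {ξ | f ξ ≠ 0} ⊆ E from fun ξ hξ => ?_)).trans
            (by linarith)
          by_contra hc
          exact hξ (hfE' ξ hc)
        · have h2 : t ≤ ∫ ξ, f ξ ∂μ := by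
            rw [← hAt', ← integral_indicator_one hAm]
            refine integral_mono ((integrable_const 1).indicator hAm) hfi fun ξ => ?_
            by_cases hξ : ξ ∈ A
            · simp [hξ, hfA' ξ hξ]
            · simpa [hξ] using hf0 ξ
          linarith
      · rw [min_eq_right htt] at hs
        refine le_of_functional hX hd h hμ hC hfun (u := fun ξ => 1 - f ξ) hε2 (fun ξ η => ?_)
          (fun ξ => sub_nonneg.2 (hf1 ξ)) (fun ξ => sub_le_self _ (hf0 ξ)) (hEm.diff hAm)
          (fun ξ hξ => ?_) ?_ ?_
        · rw [sub_sub_sub_cancel_left, abs_sub_comm]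
          exact hf ξ η
        · filter_upwards [hloc ξ hξ] with η hη
          rw [hη]
        · refine (measureReal_mono (show {ξ | 1 - f ξ ≠ 0} ⊆ Aᶜ from fun ξ hξ hc => ?_)).trans ?_
          · exact hξ (by rw [hfA' ξ hc, sub_self])
          · rw [probReal_compl_eq_one_sub hAm, hAt']
            linarith
        · have h2 : ∫ ξ, f ξ ∂μ ≤ μ.real E := by
            rw [← integral_indicator_one hEm]
            refine integral_mono hfi ((integrable_const 1).indicator hEm) fun ξ => ?_
            by_cases hξ : ξ ∈ E
            · simpa [hξ] using hf1 ξ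
            · simp [hξ, hfE' ξ hξ]
          rw [integral_sub (integrable_const _) hfi, integral_const]
          simp only [probReal_univ, smul_eq_mul, mul_one]
          linarith
    rw [hW] at h1
    rw [div_le_div_iff₀ (by positivity) hε]
    have h2 := mul_le_mul_of_nonneg_right h1 hε.le
    refine h2.trans_eq ?_
    field_simp
  · rw [not_le] at hP
    rw [lt_div_iff₀ (by positivity)] at hε'
    rw [div_le_div_iff₀ (by positivity) hε]
    have h2 := mul_le_mul_of_nonneg_right (le_abs_self a) hε.le
    have h3 := mul_le_mul_of_nonneg_right hP.le hC.le
    linarith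

/-! ### The model measure: radial densities, tails and an upper bound for its profile. -/

section Model

variable {m : ℕ} {r : ℝ}

lemma integrable_exp_neg_mul_norm_rpow {b : ℝ} (hr : 0 < r) (hb : 0 < b) :
    Integrable fun ξ : Rn (m + 1) => Real.exp (-b * ‖ξ‖ ^ r) := by
  refine (integrable_fun_norm_addHaar volume (f := fun y => Real.exp (-b * y ^ r))).2 ?_
  have h := integrableOn_rpow_mul_exp_neg_mul_rpow (s := m) (p := r) (b := b)
    (by have : (0 : ℝ) ≤ m := m.cast_nonneg
        linarith) hr hb
  simpa using h

lemma integrable_gaugeWeight_norm (hr : 0 < r) :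
    Integrable (gaugeWeight (fun ξ : Rn (m + 1) => ‖ξ‖) r) := by
  have h := integrable_exp_neg_mul_norm_rpow (m := m) hr one_pos
  simp only [neg_mul, one_mul] at h
  exact h

/-- The shape of the radial density. -/
noncomputable def radialShape (m : ℕ) (r y : ℝ) : ℝ := y ^ m * Real.exp (-|y| ^ r)

lemma continuous_radialShape (hr : 0 < r) : Continuous (radialShape m r) :=
  (continuous_pow m).mul (Real.continuous_exp.comp
    (continuous_abs.rpow_const fun _ => Or.inr hr.le).neg)

/-- The measure of balls centred at the origin. -/
lemma exists_measure_ball_eq (m : ℕ) (hr : 0 < r) : ∃ c : ℝ, 0 < c ∧ ∀ ρ : ℝ, 0 ≤ ρ →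
    (powerMeasure (fun ξ : Rn (m + 1) => ‖ξ‖) r).real {ξ | ‖ξ‖ < ρ} =
      ∫ y in (0 : ℝ)..ρ, c * radialShape m r y := by
  have hZ := integrable_gaugeWeight_norm (m := m) hr
  have hZ0 := integral_gaugeWeight_pos hZ
  set Z := ∫ ξ : Rn (m + 1), gaugeWeight (fun ξ => ‖ξ‖) r ξ with hZdef
  set V := (volume : Measure (Rn (m + 1))).real (Metric.ball 0 1) with hV
  have hV0 : 0 < V := ENNReal.toReal_pos (Metric.measure_ball_pos _ _ one_pos).ne'
    measure_ball_lt_top.ne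
  -- Polar coordinates: (m + 1) V is the area of the unit sphere.
  refine ⟨Z⁻¹ * ((m + 1) * V), by positivity, fun ρ hρ => ?_⟩
  have hm : MeasurableSet {ξ : Rn (m + 1) | ‖ξ‖ < ρ} :=
    (isOpen_lt continuous_norm continuous_const).measurableSet
  have h1 := integral_powerMeasure (fun ξ : Rn (m + 1) => ‖ξ‖) r ({ξ | ‖ξ‖ < ρ}.indicator 1)
  rw [integral_indicator_one hm] at h1
  rw [h1, intervalIntegral.integral_const_mul, mul_assoc, ← hZdef]
  congr 1
  have h2 := integral_fun_norm_addHaar (volume : Measure (Rn (m + 1)))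
    fun y => (Iio ρ).indicator (fun y => Real.exp (-y ^ r)) y
  have h3 : ∀ ξ : Rn (m + 1), ({ξ | ‖ξ‖ < ρ}.indicator 1 ξ : ℝ) * gaugeWeight (fun ξ => ‖ξ‖) r ξ =
      (Iio ρ).indicator (fun y => Real.exp (-y ^ r)) ‖ξ‖ := fun ξ => by
    by_cases hξ : ‖ξ‖ < ρ <;> simp [hξ, gaugeWeight, indicator]
  simp_rw [h3, h2]
  rw [finrank_euclideanSpace_fin, Nat.add_sub_cancel, nsmul_eq_mul, smul_eq_mul, ← hV,
    ← mul_assoc, intervalIntegral.integral_of_le hρ, integral_Ioc_eq_integral_Ioo]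
  push_cast
  congr 1
  rw [← integral_indicator measurableSet_Ioi, ← integral_indicator measurableSet_Ioo]
  congr 1
  ext y
  by_cases h0 : 0 < y
  · by_cases hy : y < ρ <;> simp [indicator, h0, hy, radialShape, abs_of_pos h0]
  · simp [indicator, h0]

/-- The tails decay exponentially. -/
lemma exists_tail_le (m : ℕ) (hr : 0 < r) : ∃ M : ℝ, 0 < M ∧ ∀ ρ : ℝ, 0 ≤ ρ →
    (powerMeasure (fun ξ : Rn (m + 1) => ‖ξ‖) r).real {ξ | ρ ≤ ‖ξ‖} ≤
      M * Real.exp (-(ρ ^ r / 2)) := by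
  have hZ := integrable_gaugeWeight_norm (m := m) hr
  have hZ0 := integral_gaugeWeight_pos hZ
  set Z := ∫ ξ : Rn (m + 1), gaugeWeight (fun ξ => ‖ξ‖) r ξ with hZdef
  -- Half of the exponent keeps the integral finite; the other half supplies the decay.
  have hi := integrable_exp_neg_mul_norm_rpow (m := m) hr (b := 1 / 2) (by norm_num)
  refine ⟨Z⁻¹ * ∫ ξ : Rn (m + 1), Real.exp (-(1 / 2) * ‖ξ‖ ^ r),
    mul_pos (inv_pos.2 hZ0) (integral_exp_pos hi), fun ρ hρ => ?_⟩
  have hm : MeasurableSet {ξ : Rn (m + 1) | ρ ≤ ‖ξ‖} :=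
    (isClosed_le continuous_const continuous_norm).measurableSet
  have h1 := integral_powerMeasure (fun ξ : Rn (m + 1) => ‖ξ‖) r ({ξ | ρ ≤ ‖ξ‖}.indicator 1)
  rw [integral_indicator_one hm] at h1
  rw [h1, ← hZdef, mul_assoc]
  refine mul_le_mul_of_nonneg_left ?_ (inv_pos.2 hZ0).le
  rw [← integral_mul_const]
  refine integral_mono_of_nonneg (ae_of_all _ fun ξ => mul_nonneg (indicator_nonneg
    (fun _ _ => zero_le_one) ξ) (gaugeWeight_pos _ _ _).le) (hi.mul_const _)
    (ae_of_all _ fun ξ => ?_)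
  by_cases hξ : ρ ≤ ‖ξ‖
  · simp only [indicator, mem_ofPred_eq, hξ, if_true, Pi.one_apply, one_mul, gaugeWeight]
    rw [← Real.exp_add]
    refine Real.exp_le_exp.2 ?_
    have := Real.rpow_le_rpow hρ hξ hr.le
    linarith
  · simp only [indicator, mem_ofPred_eq, hξ, if_false, zero_mul]
    positivity

/-- The density is controlled by the tail. -/
lemma exists_radialShape_le (m : ℕ) (hr : 0 < r) {ρ₀ : ℝ} (hρ₀ : 0 < ρ₀) : ∃ K : ℝ, 0 < K ∧
    ∀ ρ, ρ₀ ≤ ρ → radialShape m r ρ ≤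
      K * (ρ ^ (r - 1) * ∫ y in ρ..(ρ + ρ ^ (1 - r)), radialShape m r y) := by
  set x₀ := ρ₀ ^ (-r) with hx₀
  set A := r * Real.exp (r * x₀) with hA
  refine ⟨Real.exp A, Real.exp_pos _, fun ρ hρ => ?_⟩
  have hρ0 : 0 < ρ := hρ₀.trans_le hρ
  -- On an interval of this length y^r grows by at most the constant A when ρ ≥ ρ₀, so the density
  -- loses only a bounded factor and the integral is at least a multiple of h times the density.
  set h := ρ ^ (1 - r) with hh
  have hh0 : 0 < h := Real.rpow_pos_of_pos hρ0 _
  set x := ρ ^ (-r) with hx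
  have hx0 : 0 < x := Real.rpow_pos_of_pos hρ0 _
  have hxx : x ≤ x₀ := Real.rpow_le_rpow_of_nonpos hρ₀ hρ (by linarith)
  have hhx : h = ρ * x := by
    rw [hh, hx, sub_eq_add_neg, Real.rpow_add hρ0, Real.rpow_one]
  have hρx : ρ ^ r * x = 1 := by
    rw [hx, ← Real.rpow_add hρ0, add_neg_cancel, Real.rpow_zero]
  have hbound : (ρ + h) ^ r ≤ ρ ^ r + A := by
    have h1 : ρ + h = ρ * (1 + x) := by rw [hhx]; ring
    rw [h1, Real.mul_rpow hρ0.le (by positivity)]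
    have h2 : (1 + x) ^ r ≤ Real.exp (r * x) := by
      rw [mul_comm, Real.exp_mul]
      exact Real.rpow_le_rpow (by positivity) (by linarith [Real.add_one_le_exp x]) hr.le
    have h3 : Real.exp (r * x) ≤ 1 + r * x * Real.exp (r * x) := by
      have h4 := Real.add_one_le_exp (-(r * x))
      have h5 := mul_le_mul_of_nonneg_right h4 (Real.exp_pos (r * x)).le
      rw [← Real.exp_add, neg_add_cancel, Real.exp_zero] at h5
      linarith
    have h4 : r * x * Real.exp (r * x) ≤ x * A := by
      rw [hA]
      have : Real.exp (r * x) ≤ Real.exp (r * x₀) :=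
        Real.exp_le_exp.2 (mul_le_mul_of_nonneg_left hxx hr.le)
      have := mul_le_mul_of_nonneg_left this (by positivity : 0 ≤ r * x)
      linarith
    have h5 := mul_le_mul_of_nonneg_left ((h2.trans h3).trans (add_le_add_right h4 1))
      (Real.rpow_nonneg hρ0.le r)
    refine h5.trans_eq ?_
    rw [mul_add, mul_one, ← mul_assoc, hρx, one_mul]
  have hint : h * (Real.exp (-A) * radialShape m r ρ) ≤ ∫ y in ρ..(ρ + h), radialShape m r y := by
    have h1 := intervalIntegral.integral_mono_on (a := ρ) (b := ρ + h) (μ := volume)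
      (f := fun _ => Real.exp (-A) * radialShape m r ρ) (g := radialShape m r) (by linarith)
      (continuous_const.intervalIntegrable _ _) ((continuous_radialShape hr).intervalIntegrable _ _)
      fun y hy => by
        have hy0 : 0 < y := hρ0.trans_le hy.1
        rw [radialShape, radialShape, abs_of_pos hρ0, abs_of_pos hy0, mul_left_comm,
          ← Real.exp_add]
        refine mul_le_mul (pow_le_pow_left₀ hρ0.le hy.1 m) (Real.exp_le_exp.2 ?_)
          (Real.exp_pos _).le (by positivity)
        have := (Real.rpow_le_rpow hy0.le hy.2 hr.le).trans hbound
        linarith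
    rw [intervalIntegral.integral_const, smul_eq_mul, add_sub_cancel_left] at h1
    exact h1
  have h6 := mul_le_mul_of_nonneg_left hint (mul_nonneg (Real.exp_pos A).le
    (Real.rpow_nonneg hρ0.le (r - 1)))
  have h7 : Real.exp A * ρ ^ (r - 1) * (h * (Real.exp (-A) * radialShape m r ρ)) =
      radialShape m r ρ := by
    have k1 : ρ ^ (r - 1) * h = 1 := by
      rw [hh, ← Real.rpow_add hρ0]
      simp
    have k2 : Real.exp A * Real.exp (-A) = 1 := by
      rw [← Real.exp_add, add_neg_cancel, Real.exp_zero]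
    calc _ = (Real.exp A * Real.exp (-A)) * (ρ ^ (r - 1) * h) * radialShape m r ρ := by ring
      _ = _ := by rw [k1, k2, one_mul, one_mul]
  rw [h7, mul_assoc] at h6
  exact h6

end Model

/-- In use H ε is the mass of a ball, or of its complement, with the radius moved by ε, so that D is
the radial density at the boundary. -/
lemma surfaceMeasure_le_of_hasDerivAt {d : Rn n → Rn n → ℝ} {μ : Measure (Rn n)} {A : Set (Rn n)}
    {H : ℝ → ℝ} {D : ℝ} (hH : HasDerivAt H D 0) (h0 : 0 ≤ H 0) (hA : ENNReal.ofReal (H 0) ≤ μ A)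
    (h : ∀ᶠ ε in 𝓝[>] (0 : ℝ), μ (enlargement d A ε) ≤ ENNReal.ofReal (H ε)) :
    surfaceMeasure d μ A ≤ ENNReal.ofReal D := by
  have h1 := ENNReal.tendsto_ofReal hH.tendsto_slope_zero_right
  rw [← h1.liminf_eq]
  refine liminf_le_liminf ?_
  filter_upwards [h, self_mem_nhdsWithin] with ε hε hε0
  rw [zero_add, smul_eq_mul, inv_mul_eq_div, ENNReal.ofReal_div_of_pos hε0,
    ENNReal.ofReal_sub _ h0]
  exact ENNReal.div_le_div_right (tsub_le_tsub hε hA) _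

lemma isoProfile_le {d : Rn n → Rn n → ℝ} {μ : Measure (Rn n)} {A : Set (Rn n)} {t : ℝ}
    (hA : MeasurableSet A) (ht : μ A = ENNReal.ofReal t) :
    isoProfile d μ t ≤ surfaceMeasure d μ A :=
  iInf_le_of_le A (iInf_le_of_le hA (iInf_le_of_le ht le_rfl))

/-- The upper bound for the isoperimetric profile of the model measure. -/
theorem exists_modelProfile_le (m : ℕ) {r : ℝ} (hr : 1 ≤ r) : ∃ C : ℝ, 0 < C ∧
    ∀ t ∈ Ioo (0 : ℝ) 1, modelProfile (m + 1) r t ≤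
      ENNReal.ofReal (C * (min t (1 - t) * (1 - Real.log (min t (1 - t))) ^ (1 - 1 / r))) := by
  have hr0 : 0 < r := by linarith
  have := isProbabilityMeasure_powerMeasure (integrable_gaugeWeight_norm (m := m) hr0)
  set ν := powerMeasure (fun ξ : Rn (m + 1) => ‖ξ‖) r with hν
  obtain ⟨c, hc, hball⟩ := exists_measure_ball_eq m hr0
  obtain ⟨M, hM, htail⟩ := exists_tail_le m hr0
  set φ : ℝ → ℝ := fun y => c * radialShape m r y with hφ
  have hφc : Continuous φ := continuous_const.mul (continuous_radialShape hr0)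
  set G : ℝ → ℝ := fun ρ => ∫ y in (0 : ℝ)..ρ, φ y with hG
  have hGd : ∀ ρ, HasDerivAt G (φ ρ) ρ := fun ρ =>
    intervalIntegral.integral_hasDerivAt_right (hφc.intervalIntegrable _ _)
      hφc.aestronglyMeasurable.stronglyMeasurableAtFilter hφc.continuousAt
  have hGc : Continuous G := continuous_iff_continuousAt.2 fun ρ => (hGd ρ).continuousAt
  have hG0 : G 0 = 0 := intervalIntegral.integral_same
  have hm : ∀ ρ, MeasurableSet {ξ : Rn (m + 1) | ‖ξ‖ < ρ} := fun ρ =>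
    (isOpen_lt continuous_norm continuous_const).measurableSet
  have hcompl : ∀ ρ, {ξ : Rn (m + 1) | ‖ξ‖ < ρ}ᶜ = {ξ | ρ ≤ ‖ξ‖} := fun ρ => by
    ext ξ
    simp
  have hGle : ∀ ρ, 0 ≤ ρ → G ρ ≤ 1 := fun ρ hρ => by
    simp only [hG]
    rw [← hball ρ hρ]
    exact measureReal_le_one
  have htailG : ∀ ρ, 0 ≤ ρ → ν.real {ξ | ρ ≤ ‖ξ‖} = 1 - G ρ := fun ρ hρ => by
    rw [← hcompl, probReal_compl_eq_one_sub (hm ρ), hball ρ hρ]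
  have hGmono : ∀ ρ₁ ρ₂, 0 ≤ ρ₁ → ρ₁ ≤ ρ₂ → G ρ₁ ≤ G ρ₂ := fun ρ₁ ρ₂ h1 h2 => by
    simp only [hG]
    rw [← hball ρ₁ h1, ← hball ρ₂ (h1.trans h2)]
    exact measureReal_mono fun ξ hξ => lt_of_lt_of_le hξ h2
  -- The intermediate value theorem, the tail bound showing that the ball masses come arbitrarily
  -- close to 1.
  have hex : ∀ s, 0 < s → s < 1 → ∃ ρ, 0 < ρ ∧ G ρ = 1 - s := fun s hs hs1 => by
    have hlim : Tendsto (fun ρ : ℝ => M * Real.exp (-(ρ ^ r / 2))) atTop (𝓝 (M * 0)) :=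
      (Real.tendsto_exp_neg_atTop_nhds_zero.comp
        ((tendsto_rpow_atTop hr0).atTop_div_const two_pos)).const_mul M
    rw [mul_zero] at hlim
    obtain ⟨ρ₁, h1, h2⟩ := (((tendsto_order.1 hlim).2 s hs).and (eventually_ge_atTop 0)).exists
    have h3 := (htail ρ₁ h2).trans h1.le
    rw [htailG ρ₁ h2] at h3
    obtain ⟨ρ, hρ, hρs⟩ := intermediate_value_Icc h2 hGc.continuousOn
      (show 1 - s ∈ Icc (G 0) (G ρ₁) from ⟨by rw [hG0]; linarith, by linarith⟩)
    refine ⟨ρ, hρ.1.lt_of_ne ?_, hρs⟩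
    rintro rfl
    rw [hG0] at hρs
    linarith
  -- The ball of radius ρ₀ has mass 1/4. A tail s ≤ 1/2 therefore forces ρ ≥ ρ₀, where the
  -- comparison of density and tail holds.
  obtain ⟨ρ₀, hρ₀, hGρ₀⟩ := hex (3 / 4) (by norm_num) (by norm_num)
  obtain ⟨K, hK, hKρ⟩ := exists_radialShape_le m hr0 hρ₀
  set C₁ := 2 * |Real.log M| + 2 with hC₁
  have hC₁0 : 0 < C₁ := by positivity
  have he0 : 0 ≤ 1 - 1 / r := by
    rw [sub_nonneg, div_le_one hr0]
    exact hr
  -- the density in terms of the tail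
  have hdens : ∀ s ρ, 0 < s → s ≤ 1 / 2 → 0 < ρ → G ρ = 1 - s →
      φ ρ ≤ K * C₁ ^ (1 - 1 / r) * (s * (1 - Real.log s) ^ (1 - 1 / r)) := by
    intro s ρ hs hs2 hρ hGρ
    have hρρ : ρ₀ ≤ ρ := by
      by_contra hlt
      have := hGmono ρ ρ₀ hρ.le (not_le.1 hlt).le
      linarith
    have hh : 0 < ρ ^ (1 - r) := Real.rpow_pos_of_pos hρ _
    have h1 : φ ρ ≤ K * (ρ ^ (r - 1) * s) := by
      have h2 := mul_le_mul_of_nonneg_left (hKρ ρ hρρ) hc.le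
      refine h2.trans ?_
      have h3 : c * ∫ y in ρ..(ρ + ρ ^ (1 - r)), radialShape m r y ≤ s := by
        rw [← intervalIntegral.integral_const_mul,
          ← intervalIntegral.integral_interval_sub_left (a := 0) (hφc.intervalIntegrable _ _)
            (hφc.intervalIntegrable _ _)]
        have := hGle (ρ + ρ ^ (1 - r)) (by positivity)
        simp only [hG] at this hGρ
        linarith
      have h4 := mul_le_mul_of_nonneg_left h3 (mul_nonneg hK.le (Real.rpow_nonneg hρ.le (r - 1)))
      linarith
    have hs1 : Real.log s ≤ 0 := Real.log_nonpos hs.le (by linarith)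
    -- Taking logarithms in the exponential tail bound bounds the radius in terms of log(1/s), hence
    -- ρ^{r-1} by a power 1 - 1/r of it.
    have h2 : ρ ^ r ≤ C₁ * (1 - Real.log s) := by
      have h3 := htail ρ hρ.le
      rw [htailG ρ hρ.le, hGρ, sub_sub_cancel] at h3
      have h4 := Real.log_le_log hs h3
      rw [Real.log_mul hM.ne' (Real.exp_pos _).ne', Real.log_exp] at h4
      have h5 := le_abs_self (Real.log M)
      have h6 : 0 ≤ |Real.log M| * -Real.log s := mul_nonneg (abs_nonneg _) (by linarith)
      rw [hC₁]
      linarith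
    have h3 : ρ ^ (r - 1) ≤ C₁ ^ (1 - 1 / r) * (1 - Real.log s) ^ (1 - 1 / r) := by
      rw [← Real.mul_rpow hC₁0.le (by linarith)]
      have h4 : ρ ^ (r - 1) = (ρ ^ r) ^ (1 - 1 / r) := by
        rw [← Real.rpow_mul hρ.le]
        congr 1
        field_simp
      rw [h4]
      exact Real.rpow_le_rpow (Real.rpow_nonneg hρ.le _) h2 he0
    have h4 := mul_le_mul_of_nonneg_left (mul_le_mul_of_nonneg_right h3 hs.le) hK.le
    refine (h1.trans h4).trans_eq ?_
    ring
  refine ⟨K * C₁ ^ (1 - 1 / r), by positivity, fun t ⟨ht0, ht1⟩ => ?_⟩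
  -- The competitor is the complement of a ball for t ≤ 1/2 and a ball otherwise. In both cases the
  -- tail beyond the boundary sphere has mass s.
  rcases le_total t (1 - t) with htt | htt
  · rw [min_eq_left htt]
    obtain ⟨ρ, hρ, hGρ⟩ := hex t ht0 ht1
    have hA : ν {ξ | ρ ≤ ‖ξ‖} = ENNReal.ofReal t := by
      rw [← ofReal_measureReal, htailG ρ hρ.le, hGρ, sub_sub_cancel]
    have hAm : MeasurableSet {ξ : Rn (m + 1) | ρ ≤ ‖ξ‖} := by
      rw [← hcompl ρ]
      exact (hm ρ).compl
    refine ((isoProfile_le hAm hA).trans ?_).trans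
      (ENNReal.ofReal_le_ofReal (hdens t ρ ht0 (by linarith) hρ hGρ))
    have hH : HasDerivAt (fun ε => 1 - G (ρ - ε)) (φ ρ) 0 := by
      have h1 : HasDerivAt (fun ε : ℝ => ρ - ε) (-1) 0 := (hasDerivAt_id 0).const_sub ρ
      have h2 : HasDerivAt G (φ ρ) (ρ - 0) := by rw [sub_zero]; exact hGd ρ
      simpa using! (h2.comp 0 h1).const_sub 1
    refine surfaceMeasure_le_of_hasDerivAt hH ?_ ?_ ?_
    · rw [sub_zero, hGρ]
      linarith
    · rw [sub_zero, hGρ, hA, sub_sub_cancel]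
    · filter_upwards [Ioo_mem_nhdsGT hρ] with ε ⟨hε, hερ⟩
      rw [← htailG (ρ - ε) (by linarith), ofReal_measureReal]
      refine measure_mono fun η ⟨a, ha, hηa⟩ => ?_
      have h1 : ρ ≤ ‖a‖ := ha
      have h2 := norm_sub_norm_le a η
      have hd : dist η a < ε := hηa
      rw [dist_comm, dist_eq_norm] at hd
      show ρ - ε ≤ ‖η‖
      linarith
  · rw [min_eq_right htt]
    obtain ⟨ρ, hρ, hGρ⟩ := hex (1 - t) (by linarith) (by linarith)
    rw [sub_sub_cancel] at hGρ
    have hA : ν {ξ | ‖ξ‖ < ρ} = ENNReal.ofReal t := by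
      rw [← ofReal_measureReal, hball ρ hρ.le]
      exact congrArg _ hGρ
    refine ((isoProfile_le (hm ρ) hA).trans ?_).trans
      (ENNReal.ofReal_le_ofReal (hdens (1 - t) ρ (by linarith) (by linarith) hρ
        (by rw [sub_sub_cancel]; exact hGρ)))
    have hH : HasDerivAt (fun ε => G (ρ + ε)) (φ ρ) 0 := by
      have h1 : HasDerivAt (fun ε : ℝ => ρ + ε) 1 0 := (hasDerivAt_id 0).const_add ρ
      have h2 : HasDerivAt G (φ ρ) (ρ + 0) := by rw [add_zero]; exact hGd ρ
      simpa using! h2.comp 0 h1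
    refine surfaceMeasure_le_of_hasDerivAt hH ?_ ?_ ?_
    · rw [add_zero, hGρ]
      exact ht0.le
    · rw [add_zero, hGρ, hA]
    · filter_upwards [self_mem_nhdsWithin] with ε hε
      have hε0 : 0 < ε := hε
      simp only [hG]
      rw [← hball (ρ + ε) (by linarith), ofReal_measureReal]
      refine measure_mono fun η ⟨a, ha, hηa⟩ => ?_
      have h1 : ‖a‖ < ρ := ha
      have h2 := norm_sub_norm_le η a
      have hd : dist η a < ε := hηa
      rw [dist_eq_norm] at hd
      show ‖η‖ < ρ + ε
      linarith

/-! ### Comparison of the two profiles. -/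

/-- The isoperimetric profile of the model measure vanishes at the endpoints. -/
lemma isoProfile_eq_zero_of_endpoint {d : Rn n → Rn n → ℝ} {μ : Measure (Rn n)}
    [IsProbabilityMeasure μ] {t : ℝ} (ht : t = 0 ∨ t = 1) : isoProfile d μ t = 0 := by
  rw [← nonpos_iff_eq_zero]
  rcases ht with rfl | rfl
  · refine (isoProfile_le MeasurableSet.empty (by simp)).trans ?_
    have : ∀ ε, enlargement d ∅ ε = ∅ := fun ε => by simp [enlargement]
    simp [surfaceMeasure, this]
  · refine (isoProfile_le MeasurableSet.univ (by simp)).trans ?_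
    have : ∀ ε, μ (enlargement d univ ε) - μ univ = 0 := fun ε =>
      tsub_eq_zero_of_le (measure_mono (subset_univ _))
    simp only [surfaceMeasure, this]
    simp

/-- Both profiles are compared with s times a power of 1 - log s ≥ 1, so only the exponents matter.
Equality in `hrq` is allowed, hence no δ is lost here. -/
theorem IsGauge.profileDominates {m l : ℕ} {X : Fin l → Rn (m + 1) → Rn (m + 1)}
    {N : Rn (m + 1) → ℝ} {α p C : ℝ} {GN Gx : Rn (m + 1) → Rn l} {j : Fin l}
    (hg : IsGauge X N α p C GN Gx j) {d : Rn (m + 1) → Rn (m + 1) → ℝ} (hd : IsProperMetric d)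
    (hdX : MetricRelatedTo d X) (hdN : ∀ ξ, d 0 ξ ≤ C * N ξ) (hNd : ∀ ξ, N ξ ≤ C * d 0 ξ)
    (hZ : Integrable (gaugeWeight N p)) (hP : LocalPoincare d X) {Q : ℝ} (hQ : 0 < Q)
    (hS : LocalSuperPoincare X (powerMeasure N p) Q) {r : ℝ} (hr : 1 ≤ r)
    (hrq : 1 - 1 / r ≤ gaugeExp α p / p) : ProfileDominates d (powerMeasure N p) r := by
  have := isProbabilityMeasure_powerMeasure hZ
  have := isProbabilityMeasure_powerMeasure (integrable_gaugeWeight_norm (m := m) (r := r)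
    (by linarith))
  obtain ⟨C₅, hC₅, hlog⟩ := hg.exists_log_cheeger hd hdN hNd hZ hP hQ hS
  obtain ⟨C₆, hC₆, hmodel⟩ := exists_modelProfile_le m hr
  refine ⟨1 / (2 * C₅ * C₆), by positivity, fun t ht => ?_⟩
  by_cases hend : t = 0 ∨ t = 1
  · rw [modelProfile, isoProfile_eq_zero_of_endpoint hend, mul_zero]
    exact zero_le
  rw [not_or] at hend
  have ht0 : 0 < t := ht.1.lt_of_ne' hend.1
  have ht1 : t < 1 := ht.2.lt_of_ne hend.2
  have h1 := hmodel t ⟨ht0, ht1⟩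
  set s := min t (1 - t) with hs
  have hs0 : 0 < s := lt_min ht0 (by linarith)
  have hs2 : s ≤ 1 / 2 := by
    rcases le_total t (1 - t) with h | h
    · rw [hs, min_eq_left h]
      linarith
    · rw [hs, min_eq_right h]
      linarith
  have h2 : ENNReal.ofReal (s * (1 - Real.log s) ^ (gaugeExp α p / p) / (2 * C₅)) ≤
      isoProfile d (powerMeasure N p) t :=
    le_isoProfile_of_functional hg.regular hd hdX (powerMeasure_absolutelyContinuous N p) hC₅ ht0 ht1
      fun f G hf hfc hf0 hf1 h3 h4 => hlog f G hf hfc hf0 hf1 s hs0 hs2 h3 h4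
  refine le_trans ?_ h2
  refine (mul_le_mul_right h1 _).trans ?_
  rw [← ENNReal.ofReal_mul (by positivity)]
  refine ENNReal.ofReal_le_ofReal ?_
  have h3 : (1 - Real.log s) ^ (1 - 1 / r) ≤ (1 - Real.log s) ^ (gaugeExp α p / p) := by
    refine Real.rpow_le_rpow_of_exponent_le ?_ hrq
    linarith [Real.log_nonpos hs0.le (by linarith)]
  have h4 := mul_le_mul_of_nonneg_left h3 (by positivity : 0 ≤ s / (2 * C₅))
  refine le_trans (le_of_eq ?_) (h4.trans_eq ?_)
  · field_simp
  · field_simp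

/-- The assumptions of the main theorem, with a single constant. -/
theorem exists_isGauge {m l : ℕ}
    {X : Fin l → Rn (m + 1) → Rn (m + 1)} (hX : IsSubgradient X)
    {d : Rn (m + 1) → Rn (m + 1) → ℝ} (hd : IsProperMetric d)
    {N : Rn (m + 1) → ℝ} (hN : Continuous N) {α p : ℝ} (hα : 0 < α) (hp : α + 1 ≤ p)
    (hestimates : GaugeEstimates X N α) (hlayer : LayerConditions X)
    (hcomparison : GaugeComparison d N) : ∃ (C : ℝ) (GN Gx : Rn (m + 1) → Rn l) (j : Fin l),
      IsGauge X N α p C GN Gx j ∧ (∀ ξ, d 0 ξ ≤ C * N ξ) ∧ ∀ ξ, N ξ ≤ C * d 0 ξ := by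
  obtain ⟨GN, -, C₁, hC₁, hGN, -, hlow, hup, hlap, -⟩ := hestimates
  obtain ⟨⟨Gx, C₂, hGx, hGxle, -⟩, j, hj⟩ := hlayer
  obtain ⟨C₃, hC₃, hcomp⟩ := hcomparison
  have hN0 : ∀ ξ, 0 ≤ N ξ := fun ξ =>
    nonneg_of_mul_nonneg_right ((abs_nonneg _).trans (hcomp ξ).1) hC₃
  set C := 1 + C₁ + |C₂| + C₃ with hC
  have h1 : C₁ ≤ C := by linarith [abs_nonneg C₂]
  have h2 : C₂ ≤ C := by linarith [le_abs_self C₂]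
  have h3 : C₃ ≤ C := by linarith [abs_nonneg C₂]
  have h4 : 1 ≤ C := by linarith [abs_nonneg C₂]
  have hreg : ∀ i, IsRegularField (X i) := hX.isRegularField
  have hdN : ∀ ξ, d 0 ξ ≤ C * N ξ := fun ξ =>
    (hcomp ξ).2.1.trans (mul_le_mul_of_nonneg_right h3 (hN0 ξ))
  have hNd : ∀ ξ, N ξ ≤ C * d 0 ξ := fun ξ =>
    (hcomp ξ).2.2.trans (mul_le_mul_of_nonneg_right h3 (hd.nonneg _ _))
  have habs : ∀ ξ, |ξ 0| ≤ C * N ξ := fun ξ =>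
    (hcomp ξ).1.trans (mul_le_mul_of_nonneg_right h3 (hN0 ξ))
  have hratio : ∀ ξ, 0 ≤ |ξ 0| ^ α / N ξ ^ α := fun ξ =>
    div_nonneg (Real.rpow_nonneg (abs_nonneg _) _) (Real.rpow_nonneg (hN0 ξ) _)
  have hup' : ∀ᵐ ξ, ‖GN ξ‖ ≤ C * (|ξ 0| ^ α / N ξ ^ α) := by
    filter_upwards [hup] with ξ hξ
    exact hξ.trans (mul_le_mul_of_nonneg_right h1 (hratio ξ))
  refine ⟨C, GN, Gx, j, ?_, hdN, hNd⟩
  exact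
  { regular := hreg
    alpha_pos := hα
    le_p := hp
    one_le := h4
    nonneg := hN0
    pos := fun ξ hξ => (hN0 ξ).lt_of_ne fun h0 => hξ <| by
      have h5 := (hcomp ξ).2.1
      rw [← h0, mul_zero] at h5
      exact ((hd.eq_zero_iff 0 ξ).1 (le_antisymm h5 (hd.nonneg _ _))).symm
    zero := le_antisymm (by simpa [hd.self] using hNd 0) (hN0 0)
    continuous := hN
    abs_le := habs
    -- The gradient of N is given only off the origin. It is bounded by C · C^α and N is continuous,
    -- so the origin is removable.
    gradN := fun i => HasWeakFieldDeriv.hasLipDeriv_of_compl_singleton (hreg i) hN (hGN i)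
      fun R => ⟨C * C ^ α, by
      filter_upwards [hup'] with ξ hξ _
      refine (Rn.abs_apply_le _ _).trans (hξ.trans (mul_le_mul_of_nonneg_left ?_ (by linarith)))
      rw [← Real.div_rpow (abs_nonneg _) (hN0 ξ)]
      exact Real.rpow_le_rpow (div_nonneg (abs_nonneg _) (hN0 ξ))
        (div_le_of_le_mul₀ (hN0 ξ) (by linarith) (habs ξ)) hα.le⟩
    gradx := fun i => ⟨by fun_prop, hGx i, fun R => ⟨C₂, by
      filter_upwards [hGxle] with ξ hξ _
      exact (Rn.abs_apply_le _ _).trans hξ⟩⟩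
    deriv_x := ⟨by fun_prop, hj, continuous_const.isLocBdd⟩
    lower := by
      filter_upwards [hlow] with ξ hξ
      exact hξ.trans (mul_le_mul_of_nonneg_right h1 (norm_nonneg _))
    upper := hup'
    gradx_le := by
      filter_upwards [hGxle] with ξ hξ
      exact hξ.trans h2
    laplacian := fun φ hφ hφ0 => (hlap φ hφ hφ0).trans (mul_le_mul_of_nonneg_right h1
      (integral_nonneg fun ξ => mul_nonneg (div_nonneg (Real.rpow_nonneg (abs_nonneg _) _)
        (Real.rpow_nonneg (hN0 ξ) _)) (hφ0 ξ))) }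

theorem mainTheorem7 {m l : ℕ}
    (X : Fin l → EuclideanSpace ℝ (Fin (m + 1)) → EuclideanSpace ℝ (Fin (m + 1)))
    (hX : IsSubgradient X)
    (d : EuclideanSpace ℝ (Fin (m + 1)) → EuclideanSpace ℝ (Fin (m + 1)) → ℝ)
    (hd : IsProperMetric d) (hdX : MetricRelatedTo d X)
    (N : EuclideanSpace ℝ (Fin (m + 1)) → ℝ) (hN : Continuous N)
    (α p : ℝ) (hα : 0 < α)
    (hestimates : GaugeEstimates X N α)
    (hlayer : LayerConditions X)
    (hcomparison : GaugeComparison d N)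
    (hZ : Integrable (fun ξ => Real.exp (-(N ξ) ^ p)))
    (Q : ℝ) (hQ : 0 < Q)
    (hsuper : LocalSuperPoincare X (powerMeasure N p) Q)
    (hpoincare : LocalPoincare d X) :
    (p = α + 1 → ProfileDominates d (powerMeasure N p) 1) ∧
    (α + 1 < p → ∀ δ ∈ Ioc (0 : ℝ) 1,
      (α + 1 - δ) * p / (α + 1 - δ + α * (p - δ)) ∈
        Ico (1 : ℝ) ((α + 1) * p / (α + 1 + α * p)) ∧
      ProfileDominates d (powerMeasure N p)
        ((α + 1 - δ) * p / (α + 1 - δ + α * (p - δ)))) := by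
  have key : α + 1 ≤ p → ∀ r : ℝ, 1 ≤ r → 1 - 1 / r ≤ gaugeExp α p / p →
      ProfileDominates d (powerMeasure N p) r := fun hp r hr hrq => by
    obtain ⟨C, GN, Gx, j, hg, hdN, hNd⟩ :=
      exists_isGauge hX hd hN hα hp hestimates hlayer hcomparison
    exact hg.profileDominates hd hdX hdN hNd hZ hpoincare hQ hsuper hr hrq
  refine ⟨fun hp => key hp.ge 1 le_rfl ?_, fun hp δ hδ => ?_⟩
  -- For p = α + 1 the exponent κ is zero, and only r = 1 is claimed.
  · rw [hp, gaugeExp]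
    simp
  · have hp0 : 0 < p := by linarith
    have hδ0 := hδ.1
    have hδ1 := hδ.2
    have ha : 0 < α + 1 - δ := by linarith
    have hpa : 0 < p - α - 1 := by linarith
    have hb : 0 < α + 1 - δ + α * (p - δ) :=
      add_pos ha (mul_pos hα (by linarith))
    -- Numerator minus denominator equals (1 - δ)(p - α - 1).
    have hr : 1 ≤ (α + 1 - δ) * p / (α + 1 - δ + α * (p - δ)) := by
      rw [one_le_div hb]
      linarith [mul_nonneg (sub_nonneg.2 hδ1) hpa.le]
    refine ⟨⟨hr, ?_⟩, key hp.le _ hr ?_⟩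
    · rw [div_lt_div_iff₀ hb (by positivity)]
      have h1 : 0 < p * (δ * α * (p - α - 1)) := by positivity
      linarith
    -- Compared with κ/p = (p - α - 1)/((α + 1) p), what is needed is (1 - δ)(α + 1) ≤ α + 1 - δ,
    -- that is 0 ≤ δα.
    · have h1 : 1 - 1 / ((α + 1 - δ) * p / (α + 1 - δ + α * (p - δ))) =
          (1 - δ) * (p - α - 1) / ((α + 1 - δ) * p) := by
        field_simp
        ring
      rw [h1, gaugeExp, div_div, div_le_div_iff₀ (by positivity) (by positivity)]
      have h2 : 0 ≤ p * (p - α - 1) * (δ * α) := by positivity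
      linarith
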